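/- Lemma 4.3 (pullback_of_forms). Let $k$ be an algebraically closed field of arbitrary characteristic. A variety is an integral separated $k$-scheme of finite type. An orbifold $(X,\Delta)$ is a variety $X$ with a $\mathbb{Q}$-Weil divisor $\Delta=\sum_i\nu_i\Delta_i$ with coefficients $\nu_i\in[0,1]$ such that for every prime divisor $D$ of $X$, with coefficient $\nu_D$ in $\Delta$, the multiplicity $m(D):=(1-\nu_D)^{-1}$ lies in $\mathbb{Z}\cup\{\infty\}$. It is smooth if $X$ is smooth over $k$, every component of $\operatorname{supp}\Delta$ is smooth over $k$, and étale-locally around every point of $X$ there are local coordinates $x_1,\dots,x_d$ (functions defining an étale morphism to $\mathbb{A}^d_k$, $d=\dim X$) such that $\operatorname{supp}\Delta$ is given by $x_1\cdots x_\ell=0$ for some $\ell\le d$; such coordinates are said to exhibit $\Delta$ in normal crossing form. A morphism of smooth orbifolds $f:(X,\Delta_X)\to(Y,\Delta_Y)$ is a morphism $f:X\to Y$ of varieties over $k$ with $f(X)\not\subseteq\operatorname{supp}\Delta_Y$ such that for every prime divisor $E\subseteq\operatorname{supp}\Delta_Y$ and every prime divisor $D\subseteq\operatorname{supp}f^*E$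 one has $t\,m(D)\ge m(E)$, where $t$ is the coefficient of $D$ in $f^*E$. For a smooth orbifold $(X,\Delta)$ and integers $n,p\ge 0$, let $S^n\Omega^p_{(X,\Delta)}$ be the $\mathcal{O}_X$-submodule of $\operatorname{Sym}^n\Omega^p_X(\log\lceil\Delta\rceil)$ (hence of the constant sheaf of rational sections of $\operatorname{Sym}^n\Omega^p_X$) that is étale-locally generated by the elements $$x^{\lceil k/m\rceil}\bigotimes_{i=1}^n\frac{dx_{J_i}}{x_{J_i}},\qquad J_1,\dots,J_n\subseteq\{1,\dots,d\},\ |J_i|=p,$$ where $x_1,\dots,x_d$ are local coordinates exhibiting $\Delta$ in normal crossing form, $dx_J=\bigwedge_{j\in J}dx_j$, $x_J=\prod_{j\in J}x_j$, $k_j$ is the number of $i$ with $j\in J_i$, $m_j$ is the multiplicity of the coordinate $x_j$ in $\Delta$, and $x^{\lceil k/m\rceil}=\prod_j x_j^{\lceil k_j/m_j\rceil}$ (with $k_j/\infty=0$). Let $f:(X,\Delta_X)\to(Y,\Delta_Y)$ be a morphism of smooth orbifolds and let $n,p\ge 0$ be integers. Then pullback of differential forms induces a morphism of $\mathcal{O}_X$-modules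 $$f^*S^n\Omega^p_{(Y,\Delta_Y)}\to S^n\Omega^p_{(X,\Delta_X)}.$$ That is, there is a unique morphism of $\mathcal{O}_X$-modules $f^*S^n\Omega^p_{(Y,\Delta_Y)}\to S^n\Omega^p_{(X,\Delta_X)}$ which, for every local section $\omega$ of $S^n\Omega^p_{(Y,\Delta_Y)}$, sends $f^*\omega$ to the pullback of the symmetric form $\omega$ along $f$. This pullback is a rational symmetric form on $X$; it is defined because $\omega$ is regular at the image of the generic point of $X$, which does not lie in $\operatorname{supp}\Delta_Y$. -/

import Mathlib

open CategoryTheory AlgebraicGeometry TopologicalSpace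
open scoped KaehlerDifferential

universe u

noncomputable section

/-! ### Symmetric products of differential forms on a `k`-algebra -/

/-- The symmetric algebra, over `A`, of the module of `p`-forms `Ω^p_{A/k} = ⋀^p Ω_{A/k}`. Its
degree `n` part is `Sym^n Ω^p_{A/k}`, spanned by the products of `n` forms. -/
def SymForms (k A : Type u) [CommRing k] [CommRing A] [Algebra k A] (p : ℕ) : Type u :=
  SymmetricAlgebra A (⋀[A]^p (Ω[A⁄k]))

namespace SymForms

instance instCommRing (k A : Type u) [CommRing k] [CommRing A] [Algebra k A] (p : ℕ) :
    CommRing (SymForms k A p) :=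
  inferInstanceAs (CommRing (SymmetricAlgebra A (⋀[A]^p (Ω[A⁄k]))))

instance instAlgebra (k A : Type u) [CommRing k] [CommRing A] [Algebra k A] (p : ℕ) :
    Algebra A (SymForms k A p) :=
  inferInstanceAs (Algebra A (SymmetricAlgebra A (⋀[A]^p (Ω[A⁄k]))))

/-- The inclusion of `Ω^p_{A/k}` as the degree one part. -/
def ι (k A : Type u) [CommRing k] [CommRing A] [Algebra k A] (p : ℕ) :
    (⋀[A]^p (Ω[A⁄k])) →ₗ[A] SymForms k A p :=
  SymmetricAlgebra.ι A (⋀[A]^p (Ω[A⁄k]))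

end SymForms

/-- The `φ`-semilinear map `Ω^p_{A/k} → Ω^p_{B/k}`,
`da₁ ∧ ⋯ ∧ da_p ↦ dφ(a₁) ∧ ⋯ ∧ dφ(a_p)`, of a morphism `φ : A → B` of `k`-algebras. -/
def formsMap {k A B : Type u} [CommRing k] [CommRing A] [CommRing B] [Algebra k A] [Algebra k B]
    (p : ℕ) (φ : A →ₐ[k] B) : (⋀[A]^p (Ω[A⁄k])) →ₛₗ[φ.toRingHom] (⋀[B]^p (Ω[B⁄k])) :=
  letI : Algebra A B := φ.toRingHom.toAlgebra
  haveI : IsScalarTower k A B := IsScalarTower.of_algebraMap_eq' φ.comp_algebraMap.symm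
  let ψ : (Ω[A⁄k]) [⋀^Fin p]→ₗ[A] (⋀[B]^p (Ω[B⁄k])) :=
    { toFun := fun v ↦ exteriorPower.ιMulti B p fun i ↦ KaehlerDifferential.map k k A B (v i)
      map_update_add' := by
        intro _ v i x y
        have h (z : Ω[A⁄k]) : (fun j ↦ KaehlerDifferential.map k k A B (Function.update v i z j)) =
            Function.update (fun j ↦ KaehlerDifferential.map k k A B (v j)) i
              (KaehlerDifferential.map k k A B z) :=
          funext fun j ↦ Function.apply_update (fun _ ↦ KaehlerDifferential.map k k A B) v i z j
        simp only [h, map_add, AlternatingMap.map_update_add]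
      map_update_smul' := by
        intro _ v i c x
        have h (z : Ω[A⁄k]) : (fun j ↦ KaehlerDifferential.map k k A B (Function.update v i z j)) =
            Function.update (fun j ↦ KaehlerDifferential.map k k A B (v j)) i
              (KaehlerDifferential.map k k A B z) :=
          funext fun j ↦ Function.apply_update (fun _ ↦ KaehlerDifferential.map k k A B) v i z j
        simp only [h, map_smul]
        rw [← algebraMap_smul B c, AlternatingMap.map_update_smul, algebraMap_smul]
      map_eq_zero_of_eq' := by
        intro v i j hij hne
        exact AlternatingMap.map_eq_zero_of_eq _ _ (by simp only [hij]) hne }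
  { toFun := exteriorPower.alternatingMapLinearEquiv ψ
    map_add' := map_add _
    map_smul' := fun c x ↦ by
      rw [map_smul, ← algebraMap_smul B c]
      rfl }

/-- The ring homomorphism `Sym Ω^p_{A/k} → Sym Ω^p_{B/k}` of a morphism `φ : A → B` of
`k`-algebras: it is `φ` in degree zero and `formsMap p φ` in degree one. -/
def symFormsMap {k A B : Type u} [CommRing k] [CommRing A] [CommRing B] [Algebra k A] [Algebra k B]
    (p : ℕ) (φ : A →ₐ[k] B) : SymForms k A p →+* SymForms k B p :=
  letI : Algebra A (SymForms k B p) :=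
    ((algebraMap B (SymForms k B p)).comp φ.toRingHom).toAlgebra
  (SymmetricAlgebra.lift (R := A) (A := SymForms k B p)
    { toFun := fun v : (⋀[A]^p (Ω[A⁄k])) ↦ SymForms.ι k B p (formsMap p φ v)
      map_add' := fun v w ↦ by rw [map_add, map_add]
      map_smul' := fun c v ↦ by
        rw [LinearMap.map_smulₛₗ, map_smul, Algebra.smul_def, Algebra.smul_def]
        rfl }).toRingHom

lemma symFormsMap_algebraMap {k A B : Type u} [CommRing k] [CommRing A] [CommRing B] [Algebra k A]
    [Algebra k B] (p : ℕ) (φ : A →ₐ[k] B) (a : A) :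
    symFormsMap p φ (algebraMap A _ a) = algebraMap B _ (φ a) := by
  let _ : Algebra A (SymForms k B p) :=
    ((algebraMap B (SymForms k B p)).comp φ.toRingHom).toAlgebra
  exact AlgHom.commutes (SymmetricAlgebra.lift (R := A) (A := SymForms k B p) _) a

lemma symFormsMap_smul {k A B : Type u} [CommRing k] [CommRing A] [CommRing B] [Algebra k A]
    [Algebra k B] (p : ℕ) (φ : A →ₐ[k] B) (a : A) (ω : SymForms k A p) :
    symFormsMap p φ (a • ω) = φ a • symFormsMap p φ ω := by
  rw [Algebra.smul_def, map_mul, symFormsMap_algebraMap, ← Algebra.smul_def]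

/-! ### Local rings of schemes over `k` -/

/-- The `k`-algebra structure on the local rings of a `k`-scheme. -/
instance stalkAlgebraOver (k : Type u) [Field k] (X : Scheme.{u}) [X.Over (Spec (.of k))] (x : X) :
    Algebra k (X.presheaf.stalk x) :=
  ((X.presheaf.germ ⊤ x (Opens.mem_top _)).hom.comp ((X ↘ Spec (.of k)).appTop.hom.comp
    (Scheme.ΓSpecIso (.of k)).inv.hom)).toAlgebra

/-- If `y` is a specialization of `x`: the localization map `𝒪_{X,y} → 𝒪_{X,x}`. -/
def stalkSpecAlgHom (k : Type u) [Field k] (X : Scheme.{u}) [X.Over (Spec (.of k))] {x y : X}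
    (h : x ⤳ y) : X.presheaf.stalk y →ₐ[k] X.presheaf.stalk x where
  __ := (X.presheaf.stalkSpecializes h).hom
  commutes' a := by
    change ((X.presheaf.germ ⊤ y (Opens.mem_top _) ≫ X.presheaf.stalkSpecializes h).hom) _ = _
    rw [TopCat.Presheaf.germ_stalkSpecializes]
    rfl

/-- The map `𝒪_{Y,f(x)} → 𝒪_{X,x}` induced by a morphism `f : X → Y` of `k`-schemes. -/
def stalkMapAlgHom (k : Type u) [Field k] {X Y : Scheme.{u}} [X.Over (Spec (.of k))]
    [Y.Over (Spec (.of k))] (f : X ⟶ Y) [f.IsOver (Spec (.of k))] (x : X) :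
    Y.presheaf.stalk (f x) →ₐ[k] X.presheaf.stalk x where
  __ := (f.stalkMap x).hom
  commutes' a := by
    have h : (Y ↘ Spec (.of k)).appTop ≫ Y.presheaf.germ ⊤ (f x) (Opens.mem_top _) ≫ f.stalkMap x =
        (X ↘ Spec (.of k)).appTop ≫ X.presheaf.germ ⊤ x (Opens.mem_top _) := by
      rw [Scheme.Hom.germ_stalkMap, ← comp_over f (Spec (.of k)), Scheme.Hom.comp_appTop,
        Category.assoc]
      rfl
    exact congr($(h).hom ((Scheme.ΓSpecIso (.of k)).inv.hom a))

lemma specializes_of_isOpenMap {W X : Scheme.{u}} [IsIntegral W] [IsIntegral X] (g : W ⟶ X)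
    (hg : IsOpenMap g) : g (genericPoint W) ⤳ genericPoint X := by
  obtain ⟨w, hw⟩ : genericPoint X ∈ Set.range g :=
    ((genericPoint_spec X).mem_open_set_iff hg.isOpen_range).2
      ⟨_, trivial, Set.mem_range_self (genericPoint W)⟩
  rw [← hw]
  exact ((genericPoint_spec W).specializes trivial).map g.continuous

/-- The extension `k(X) → k(W)` of function fields induced by an étale morphism `g : W → X` of
integral `k`-schemes. -/
def functionFieldMap (k : Type u) [Field k] {W X : Scheme.{u}} [W.Over (Spec (.of k))]
    [X.Over (Spec (.of k))] [IsIntegral W] [IsIntegral X] (g : W ⟶ X) [g.IsOver (Spec (.of k))]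
    [Etale g] : X.functionField →ₐ[k] W.functionField :=
  (stalkMapAlgHom k g (genericPoint W)).comp
    (stalkSpecAlgHom k X (specializes_of_isOpenMap g g.isOpenMap))

/-- The local ring `𝒪_{X,x}` of an integral scheme as a subring of the function field. -/
def localSubring (X : Scheme.{u}) [IsIntegral X] (x : X) : Subring X.functionField :=
  (algebraMap (X.presheaf.stalk x) X.functionField).range

lemma functionFieldMap_mem (k : Type u) [Field k] {W X : Scheme.{u}} [W.Over (Spec (.of k))]
    [X.Over (Spec (.of k))] [IsIntegral W] [IsIntegral X] (g : W ⟶ X) [g.IsOver (Spec (.of k))]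
    [Etale g] (w : W) {r : X.functionField} (hr : r ∈ localSubring X (g w)) :
    functionFieldMap k g r ∈ localSubring W w := by
  obtain ⟨a, rfl⟩ := hr
  have hη := (genericPoint_spec W).specializes (Set.mem_univ w)
  refine ⟨(g.stalkMap w).hom a, ?_⟩
  change (g.stalkMap w ≫ W.presheaf.stalkSpecializes hη).hom a =
    ((X.presheaf.stalkSpecializes _ ≫ X.presheaf.stalkSpecializes _) ≫ g.stalkMap _).hom a
  rw [← Scheme.Hom.stalkSpecializes_stalkMap, TopCat.Presheaf.stalkSpecializes_comp]

/-! ### Orbifolds -/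

/-- An orbifold `(X, Δ)` over `k`: a variety `X` (an integral separated `k`-scheme of finite type)
and a `ℚ`-Weil divisor `Δ` on `X` with coefficients in `[0, 1]` such that all multiplicities
`(1 - ν)⁻¹` are integers or infinite. A prime divisor is given by its generic point, which is a
point of codimension one. -/
structure Orbifold (k : Type u) [Field k] where
  X : Scheme.{u}
  [overSpec : X.Over (Spec (.of k))]
  [isIntegral : IsIntegral X]
  [isSeparated : IsSeparated (X ↘ Spec (.of k))]
  [locallyOfFiniteType : LocallyOfFiniteType (X ↘ Spec (.of k))]
  [quasiCompact : QuasiCompact (X ↘ Spec (.of k))]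
  Δ : AlgebraicCycle X ℚ
  coheight_eq_one : ∀ E, Δ E ≠ 0 → Order.coheight E = 1
  coeff_nonneg : ∀ E, 0 ≤ Δ E
  coeff_le_one : ∀ E, Δ E ≤ 1
  mult_integral : ∀ E, Δ E ≠ 1 → ∃ m : ℕ, (1 - Δ E)⁻¹ = m

attribute [instance] Orbifold.overSpec Orbifold.isIntegral Orbifold.isSeparated
  Orbifold.locallyOfFiniteType Orbifold.quasiCompact

namespace Orbifold

open Opposite

/-- The multiplicity `(1 - ν)⁻¹ ∈ {1, 2, …, ∞}` of a prime divisor, where `ν` is its coefficient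
in `Δ`. -/
def mult {k : Type u} [Field k] (𝒳 : Orbifold k) (E : 𝒳.X) : ℕ∞ :=
  if 𝒳.Δ E = 1 then ⊤ else (⌊(1 - 𝒳.Δ E)⁻¹⌋₊ : ℕ)

/-- The support of the orbifold divisor. -/
def supp {k : Type u} [Field k] (𝒳 : Orbifold k) : Set 𝒳.X :=
  {x | ∃ E, 𝒳.Δ E ≠ 0 ∧ E ⤳ x}

/-- Local coordinates, on an étale open `g : W → X`, which exhibit `Δ` in normal crossing form:
functions `x₁, …, x_d` on `W` which define an étale morphism `W → 𝔸^d_k`, such that on `W` the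
support of `Δ` is given by the equation `∏_{i ∈ I} x_i = 0` for some `I ⊆ {1, …, d}`. -/
structure Chart {k : Type u} [Field k] (𝒳 : Orbifold k) where
  W : Scheme.{u}
  [overSpec : W.Over (Spec (.of k))]
  [isIntegral : IsIntegral W]
  g : W ⟶ 𝒳.X
  [isOver : g.IsOver (Spec (.of k))]
  [etale : Etale g]
  d : ℕ
  coord : Fin d → Γ(W, ⊤)
  etale_coord : Etale (AffineSpace.homOfVector (n := ULift.{u} (Fin d)) (W ↘ Spec (.of k))
    fun j ↦ coord j.down)
  I : Finset (Fin d)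
  mem_supp_iff : ∀ w : W, g w ∈ 𝒳.supp ↔ w ∉ W.basicOpen (∏ i ∈ I, coord i)

attribute [instance] Chart.overSpec Chart.isIntegral Chart.isOver Chart.etale

/-- An orbifold `(X, Δ)` is smooth if `X` is smooth over `k` and `supp Δ` is a divisor with strict
normal crossings: every component of `supp Δ` (with its reduced structure) is smooth over `k`, and
étale-locally around every point `supp Δ` is given by an equation `x₁ ⋯ x_n = 0` in local
coordinates. -/
structure IsSmooth {k : Type u} [Field k] (𝒳 : Orbifold k) : Prop where
  smooth : Smooth (𝒳.X ↘ Spec (.of k))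
  smooth_component : ∀ E, 𝒳.Δ E ≠ 0 →
    Smooth ((Scheme.IdealSheafData.vanishingIdeal (Closeds.closure {E})).subschemeι ≫
      𝒳.X ↘ Spec (.of k))
  exists_chart : ∀ x : 𝒳.X, ∃ c : 𝒳.Chart, x ∈ Set.range c.g

/-! ### Orbifold symmetric differentials -/

namespace Chart

/-- The coordinate `x_j` as a rational function on `W`. -/
def coordK {k : Type u} [Field k] {𝒳 : Orbifold k} (c : 𝒳.Chart) (j : Fin c.d) :
    c.W.functionField :=
  (c.W.presheaf.germ ⊤ (genericPoint c.W) (Opens.mem_top _)).hom (c.coord j)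

/-- The multiplicity in `Δ` of the coordinate `x_j` near the point `w`: the multiplicity of the
image in `X` of the component of `{x_j = 0}` through `w`, or `1` if `x_j` does not vanish at `w`.
As `{x_j = 0}` is smooth over `k`, it has at most one component through `w`, so that the supremum
runs over at most one prime divisor. -/
def coordMult {k : Type u} [Field k] {𝒳 : Orbifold k} (c : 𝒳.Chart) (w : c.W) (j : Fin c.d) :
    ℕ∞ :=
  max 1 (⨆ D ∈ {D : c.W | D ⤳ w ∧ Order.coheight D = 1 ∧ D ∉ c.W.basicOpen (c.coord j)},
    𝒳.mult (c.g D))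

/-- The rounded-up quotient `⌈a / m⌉`, where `a / ∞ = 0`. -/
def ceilQuot (a : ℕ) (m : ℕ∞) : ℕ :=
  if m = ⊤ then 0 else ⌈(a : ℚ) / (m.toNat : ℚ)⌉₊

/-- The element `x^⌈k/m⌉ ⊗_{i=1}^n dx_{J_i} / x_{J_i}` for `p`-element subsets `J₁, …, J_n` of
`{1, …, d}` (given by their increasing enumerations), where `k_j` is the number of indices `i` with
`j ∈ J_i`, and `m_j` is the multiplicity of `x_j` in `Δ` near `w`. -/
def generator {k : Type u} [Field k] {𝒳 : Orbifold k} (c : 𝒳.Chart) (n p : ℕ) (w : c.W)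
    (J : Fin n → (Fin p ↪o Fin c.d)) : SymForms k c.W.functionField p :=
  (∏ j, c.coordK j ^ ceilQuot (Nat.card {i : Fin n // j ∈ Set.range (J i)}) (c.coordMult w j)) •
    ∏ i, SymForms.ι k c.W.functionField p
      ((∏ a, c.coordK (J i a))⁻¹ • exteriorPower.ιMulti c.W.functionField p
        fun a ↦ KaehlerDifferential.D k c.W.functionField (c.coordK (J i a)))

/-- The `𝒪_{W,w}`-module spanned by these elements, inside the rational symmetric forms on `W`. -/
def localModule {k : Type u} [Field k] {𝒳 : Orbifold k} (c : 𝒳.Chart) (n p : ℕ) (w : c.W) :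
    Submodule (localSubring c.W w) (SymForms k c.W.functionField p) :=
  Submodule.span _ (Set.range (c.generator n p w))

/-- Pullback of rational symmetric forms from `X` to `W`. -/
def pull {k : Type u} [Field k] {𝒳 : Orbifold k} (c : 𝒳.Chart) (p : ℕ) :
    SymForms k 𝒳.X.functionField p →+* SymForms k c.W.functionField p :=
  symFormsMap p (functionFieldMap k c.g)

end Chart

/-- The stalk at `x` of the sheaf `S^n Ω^p_{(X,Δ)}` of a smooth orbifold, which is étale-locally
generated by the elements `x^⌈k/m⌉ ⊗ dx_{J_i} / x_{J_i}`: it consists of those rational symmetric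
forms on `X` whose pullback to any étale open with coordinates exhibiting `Δ` in normal crossing
form lies, at any point over `x`, in the module spanned by these elements. -/
def stalkForms {k : Type u} [Field k] (𝒳 : Orbifold k) (n p : ℕ) (x : 𝒳.X) :
    Submodule (localSubring 𝒳.X x) (SymForms k 𝒳.X.functionField p) where
  carrier := {ω | ∀ (c : 𝒳.Chart) (w : c.W), c.g w = x → c.pull p ω ∈ c.localModule n p w}
  add_mem' ha hb c w hw := by
    rw [map_add]
    exact add_mem (ha c w hw) (hb c w hw)
  zero_mem' c w _ := by
    rw [map_zero]
    exact zero_mem _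
  smul_mem' r ω hω c w hw := by
    subst hw
    have h : c.pull p (r • ω) = functionFieldMap k c.g (r : 𝒳.X.functionField) • c.pull p ω :=
      symFormsMap_smul p _ _ _
    rw [h]
    exact (c.localModule n p w).smul_mem ⟨_, functionFieldMap_mem k c.g w r.2⟩ (hω c w rfl)

/-- Sections of `S^n Ω^p_{(X,Δ)}` are (constant families of) rational symmetric forms which lie in
the stalk at every point. -/
def formsPredicate {k : Type u} [Field k] (𝒳 : Orbifold k) (n p : ℕ) :
    TopCat.LocalPredicate (X := (𝒳.X : TopCat)) fun _ ↦ SymForms k 𝒳.X.functionField p where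
  pred s := (∀ x y, s x = s y) ∧ ∀ x, s x ∈ 𝒳.stalkForms n p x.1
  res i s hs := ⟨fun _ _ ↦ hs.1 _ _, fun x ↦ hs.2 (i x)⟩
  locality {U} s hs := by
    refine ⟨fun x y ↦ ?_, fun x ↦ ?_⟩
    · obtain ⟨V, hxV, i, hV⟩ := hs x
      obtain ⟨V', hyV', i', hV'⟩ := hs y
      obtain ⟨z, hz, hz'⟩ := nonempty_preirreducible_inter V.2 V'.2 ⟨_, hxV⟩ ⟨_, hyV'⟩
      exact (hV.1 ⟨_, hxV⟩ ⟨z, hz⟩).trans (hV'.1 ⟨z, hz'⟩ ⟨_, hyV'⟩)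
    · obtain ⟨V, hxV, i, hV⟩ := hs x
      exact hV.2 ⟨_, hxV⟩

/-- The group of sections of `S^n Ω^p_{(X,Δ)}` over an open subset. -/
def formsSections {k : Type u} [Field k] (𝒳 : Orbifold k) (n p : ℕ) (U : 𝒳.X.Opens) :
    AddSubgroup (U → SymForms k 𝒳.X.functionField p) where
  carrier := {s | (𝒳.formsPredicate n p).pred s}
  add_mem' ha hb := ⟨fun x y ↦ congr_arg₂ (· + ·) (ha.1 x y) (hb.1 x y),
    fun x ↦ add_mem (ha.2 x) (hb.2 x)⟩
  zero_mem' := ⟨fun _ _ ↦ rfl, fun _ ↦ zero_mem _⟩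
  neg_mem' ha := ⟨fun x y ↦ congr_arg (- ·) (ha.1 x y), fun x ↦ neg_mem (ha.2 x)⟩

/-- A function on `U` acts on a section through its germs, viewed in the function field. -/
instance formsSectionsSMul {k : Type u} [Field k] (𝒳 : Orbifold k) (n p : ℕ) (U : 𝒳.X.Opens) :
    SMul Γ(𝒳.X, U) (𝒳.formsSections n p U) where
  smul r s := ⟨fun x ↦ algebraMap (𝒳.X.presheaf.stalk x.1) 𝒳.X.functionField
      ((𝒳.X.presheaf.germ U x.1 x.2).hom r) • s.1 x, by
    refine ⟨fun x y ↦ ?_, fun x ↦ (𝒳.stalkForms n p x.1).smul_mem ⟨_, _, rfl⟩ (s.2.2 x)⟩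
    have : Nonempty U := ⟨x⟩
    exact congr_arg₂ (· • ·)
      ((Scheme.algebraMap_germ_eq_germToFunctionField _ x.2 r).trans
        (Scheme.algebraMap_germ_eq_germToFunctionField _ y.2 r).symm) (s.2.1 x y)⟩

lemma formsSections_add_apply {k : Type u} [Field k] (𝒳 : Orbifold k) (n p : ℕ) (U : 𝒳.X.Opens)
    (s t : 𝒳.formsSections n p U) (x : U) : (s + t).1 x = s.1 x + t.1 x := rfl

lemma formsSections_zero_apply {k : Type u} [Field k] (𝒳 : Orbifold k) (n p : ℕ) (U : 𝒳.X.Opens)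
    (x : U) : (0 : 𝒳.formsSections n p U).1 x = 0 := rfl

lemma formsSections_smul_apply {k : Type u} [Field k] (𝒳 : Orbifold k) (n p : ℕ) (U : 𝒳.X.Opens)
    (r : Γ(𝒳.X, U)) (s : 𝒳.formsSections n p U) (x : U) :
    (r • s).1 x = algebraMap (𝒳.X.presheaf.stalk x.1) 𝒳.X.functionField
      ((𝒳.X.presheaf.germ U x.1 x.2).hom r) • s.1 x := rfl

instance formsSectionsModule {k : Type u} [Field k] (𝒳 : Orbifold k) (n p : ℕ) (U : 𝒳.X.Opens) :
    Module Γ(𝒳.X, U) (𝒳.formsSections n p U) where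
  one_smul s := Subtype.ext <| funext fun x ↦ by
    rw [formsSections_smul_apply, map_one, map_one, one_smul]
  mul_smul a b s := Subtype.ext <| funext fun x ↦ by
    simp only [formsSections_smul_apply, map_mul, mul_smul]
  smul_zero a := Subtype.ext <| funext fun x ↦ by
    rw [formsSections_smul_apply, formsSections_zero_apply]
    exact Algebra.smul_def (A := SymForms k 𝒳.X.functionField p) _ 0 |>.trans (mul_zero _)
  smul_add a s t := Subtype.ext <| funext fun x ↦ by
    rw [formsSections_add_apply, formsSections_smul_apply, formsSections_smul_apply,
      formsSections_smul_apply, formsSections_add_apply, smul_add]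
  add_smul a b s := Subtype.ext <| funext fun x ↦ by
    rw [formsSections_smul_apply, formsSections_add_apply, formsSections_smul_apply,
      formsSections_smul_apply, map_add, map_add, add_smul]
  zero_smul s := Subtype.ext <| funext fun x ↦ by
    rw [formsSections_smul_apply, formsSections_zero_apply, map_zero, map_zero, zero_smul]

/-- The abelian presheaf underlying `S^n Ω^p_{(X,Δ)}`. -/
def formsPresheaf {k : Type u} [Field k] (𝒳 : Orbifold k) (n p : ℕ) : 𝒳.X.Opensᵒᵖ ⥤ Ab.{u} where
  obj U := AddCommGrpCat.of (𝒳.formsSections n p U.unop)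
  map {U V} i := AddCommGrpCat.ofHom
    { toFun := fun s ↦ ⟨fun x ↦ s.1 (i.unop x), (𝒳.formsPredicate n p).res i.unop s.1 s.2⟩
      map_zero' := rfl
      map_add' := fun _ _ ↦ rfl }

instance formsPresheafModule {k : Type u} [Field k] (𝒳 : Orbifold k) (n p : ℕ)
    (U : 𝒳.X.Opensᵒᵖ) : Module (𝒳.X.ringCatSheaf.obj.obj U) ((𝒳.formsPresheaf n p).obj U) :=
  inferInstanceAs (Module Γ(𝒳.X, U.unop) (𝒳.formsSections n p U.unop))

/-- The sheaf `S^n Ω^p_{(X,Δ)}` of orbifold symmetric differentials, as an `𝒪_X`-module. -/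
def symDiff {k : Type u} [Field k] (𝒳 : Orbifold k) (n p : ℕ) : 𝒳.X.Modules where
  val := PresheafOfModules.ofPresheaf (𝒳.formsPresheaf n p) fun U V i r s ↦ by
    refine Subtype.ext <| funext fun x ↦ ?_
    exact congr_arg (fun a : 𝒳.X.presheaf.stalk x.1 ↦
      algebraMap (𝒳.X.presheaf.stalk x.1) 𝒳.X.functionField a • s.1 (i.unop x))
      (TopCat.Presheaf.germ_res_apply 𝒳.X.presheaf i.unop x.1 x.2 r).symm
  isSheaf := by
    change TopCat.Presheaf.IsSheaf (C := Ab) (X := 𝒳.X.toTopCat) (𝒳.formsPresheaf n p)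
    refine (TopCat.Presheaf.isSheaf_iff_isSheaf_comp (forget Ab) (𝒳.formsPresheaf n p)).2 ?_
    exact (TopCat.subsheafToTypes (𝒳.formsPredicate n p)).2

/-- The value at a point of a section of `S^n Ω^p_{(X,Δ)}`, as a rational symmetric form. -/
def evalForm {k : Type u} [Field k] (𝒳 : Orbifold k) {n p : ℕ} {U : 𝒳.X.Opens}
    (s : Γ(𝒳.symDiff n p, U)) (x : U) : SymForms k 𝒳.X.functionField p :=
  (show 𝒳.formsSections n p U from s).1 x

/-! ### Morphisms of orbifolds and pullback of forms -/

/-- The coefficient of `D` in `f^* E` for a prime divisor `E` of `Y` and a prime divisor `D` of `X`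
with `f(D) ⊆ E`, i.e. the length of `𝒪_{X,D} / I_E 𝒪_{X,D}` where `I_E ⊆ 𝒪_{Y,f(D)}` is the ideal of
`E`. When `I_E` is generated by a local equation `h` of `E`, this is the order of vanishing of
`h ∘ f` along `D`. -/
def pullbackCoeff {X Y : Scheme.{u}} (f : X ⟶ Y) {E : Y} {D : X} (h : E ⤳ f D) : ℕ∞ :=
  Module.length (X.presheaf.stalk D) (X.presheaf.stalk D ⧸
    ((IsLocalRing.maximalIdeal (Y.presheaf.stalk E)).comap
      (Y.presheaf.stalkSpecializes h).hom).map (f.stalkMap D).hom)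

/-- A morphism `f : (X, Δ_X) → (Y, Δ_Y)` of orbifolds, for `X` normal and `Y` locally factorial: a
morphism of varieties over `k` with `f(X) ⊄ supp Δ_Y` such that `t ⬝ m(D) ≥ m(E)` for all prime divisors
`E ⊆ supp Δ_Y` and `D ⊆ supp f^* E`, where `t` is the coefficient of `D` in `f^* E`. -/
structure IsMorphism {k : Type u} [Field k] (𝒳 𝒴 : Orbifold k) (f : 𝒳.X ⟶ 𝒴.X)
    [f.IsOver (Spec (.of k))] : Prop where
  not_subset : ¬ Set.range f ⊆ 𝒴.supp
  mult_le : ∀ (E : 𝒴.X) (D : 𝒳.X) (h : E ⤳ f D), 𝒴.Δ E ≠ 0 → Order.coheight D = 1 →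
    𝒴.mult E ≤ pullbackCoeff f h * 𝒳.mult D

/-- `ω'` is the pullback along `f : X → Y` of the rational symmetric form `ω` on `Y`: the form `ω`
comes from a symmetric form which is regular at the image `ξ` of the generic point of `X` (an
element of `Sym Ω^p_{𝒪_{Y,ξ}/k}`), and `ω'` is the image of the latter under the map induced by
`𝒪_{Y,ξ} → k(X)`. -/
def IsPullback (k : Type u) [Field k] {X Y : Scheme.{u}} [X.Over (Spec (.of k))]
    [Y.Over (Spec (.of k))] [IsIntegral X] [IsIntegral Y] (f : X ⟶ Y) [f.IsOver (Spec (.of k))]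
    (p : ℕ) (ω : SymForms k Y.functionField p) (ω' : SymForms k X.functionField p) : Prop :=
  ∃ τ : SymForms k (Y.presheaf.stalk (f (genericPoint X))) p,
    symFormsMap p (stalkSpecAlgHom k Y ((genericPoint_spec Y).specializes trivial)) τ = ω ∧
      symFormsMap p (stalkMapAlgHom k f (genericPoint X)) τ = ω'

/-- The morphism `φ : f^* S^n Ω^p_{(Y,Δ_Y)} → S^n Ω^p_{(X,Δ_X)}` is induced by pullback of
differential forms: for every local section `ω` of `S^n Ω^p_{(Y,Δ_Y)}`, the section `φ(f^* ω)` is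
the pullback of `ω` along `f`. -/
def IsInducedByPullback {k : Type u} [Field k] {𝒳 𝒴 : Orbifold k} (f : 𝒳.X ⟶ 𝒴.X)
    [f.IsOver (Spec (.of k))] (n p : ℕ)
    (φ : (Scheme.Modules.pullback f).obj (𝒴.symDiff n p) ⟶ 𝒳.symDiff n p) : Prop :=
  ∀ (V : 𝒴.X.Opens) (ω : Γ(𝒴.symDiff n p, V)) (x : (f ⁻¹ᵁ V : 𝒳.X.Opens)),
    IsPullback k f p (𝒴.evalForm ω ⟨f x, x.2⟩) (𝒳.evalForm
      ((((Scheme.Modules.pullbackPushforwardAdjunction f).homEquiv _ _ φ).app V).hom ω) x)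

end Orbifold

end

/-!
The coefficients of a form of `S^n Ω^p_{(X,Δ)}` in the logarithmic basis `dx_J / x_J` of a chart
`W` are the multiples of `x^⌈k/m⌉` in `𝒪_{W,w}`. Since `𝒪_{W,w}` is noetherian and normal, it
suffices to check these conditions on a pulled back form at the points `D` of codimension one.
There `𝒪_{W,D}` and the local ring of a chart of `Y` over `f(D)` are dominated by a discrete
valuation ring `R` which is faithfully flat and étale over `𝒪_{W,D}`, and by descent one may work
over `R`. Let `ϖ` be a uniformizer of `R` and `y_l` a coordinate of multiplicity `m(E) ≠ 1`. As
the components of the orbifold divisor are smooth, `y_l` is a local equation of such a component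
`E`, so that `y_l = u ϖ^t` with a unit `u` and `t m(D) ≥ m(E)`. If `ϖ` is one of the coordinates
`x_i`, then `dy_l / y_l` has a logarithmic pole along `x_i` only, and subadditivity of `⌈⬝ / m⌉`
bounds the order of the coefficients; otherwise `D` is not contained in the orbifold divisor, so
`m(D) = 1`, and the zero of `y_l` of order `⌈k_l / m(E)⌉ t ≥ k_l` cancels the poles of the `k_l`
factors `dy_l / y_l`.
-/

noncomputable section

/-! ### Coordinates on symmetric forms -/

section Functoriality

variable {k A B C : Type u} [CommRing k] [CommRing A] [CommRing B] [CommRing C]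
  [Algebra k A] [Algebra k B] [Algebra k C]

/-- The `φ`-semilinear map `Ω_{A/k} → Ω_{B/k}`, `da ↦ dφ(a)`. Unlike `KaehlerDifferential.map` it
takes `φ` as an argument, so that maps along different `φ` can be composed and compared. -/
def diffMap (φ : A →ₐ[k] B) : (Ω[A⁄k]) →ₛₗ[φ.toRingHom] (Ω[B⁄k]) :=
  letI : Algebra A B := φ.toRingHom.toAlgebra
  haveI : IsScalarTower k A B := IsScalarTower.of_algebraMap_eq' φ.comp_algebraMap.symm
  { toFun := KaehlerDifferential.map k k A B
    map_add' := map_add _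
    map_smul' := fun c x ↦ by
      rw [map_smul, ← algebraMap_smul B c]
      rfl }

@[simp]
lemma diffMap_D (φ : A →ₐ[k] B) (a : A) :
    diffMap φ (KaehlerDifferential.D k A a) = KaehlerDifferential.D k B (φ a) := by
  let _ : Algebra A B := φ.toRingHom.toAlgebra
  have : IsScalarTower k A B := IsScalarTower.of_algebraMap_eq' φ.comp_algebraMap.symm
  exact KaehlerDifferential.map_D k k A B a

lemma diffMap_smul (φ : A →ₐ[k] B) (a : A) (x : Ω[A⁄k]) :
    diffMap φ (a • x) = φ a • diffMap φ x :=
  LinearMap.map_smulₛₗ _ _ _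

lemma diffMap_comp (φ : A →ₐ[k] B) (ψ : B →ₐ[k] C) (x : Ω[A⁄k]) :
    diffMap (ψ.comp φ) x = diffMap ψ (diffMap φ x) := by
  have hx : x ∈ Submodule.span A (Set.range (KaehlerDifferential.D k A)) :=
    KaehlerDifferential.span_range_derivation k A ▸ Submodule.mem_top
  induction hx using Submodule.span_induction with
  | mem x hx =>
    obtain ⟨a, rfl⟩ := hx
    simp only [diffMap_D, AlgHom.comp_apply]
  | zero => simp only [map_zero]
  | add x y _ _ hx hy => simp only [map_add, hx, hy]
  | smul a x _ hx => simp only [diffMap_smul, hx, AlgHom.comp_apply]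

lemma formsMap_ιMulti (p : ℕ) (φ : A →ₐ[k] B) (v : Fin p → Ω[A⁄k]) :
    formsMap p φ (exteriorPower.ιMulti A p v) =
      exteriorPower.ιMulti B p fun i ↦ diffMap φ (v i) := by
  let _ : Algebra A B := φ.toRingHom.toAlgebra
  have : IsScalarTower k A B := IsScalarTower.of_algebraMap_eq' φ.comp_algebraMap.symm
  exact exteriorPower.alternatingMapLinearEquiv_apply_ιMulti _ v

lemma symFormsMap_ι (p : ℕ) (φ : A →ₐ[k] B) (v : ⋀[A]^p (Ω[A⁄k])) :
    symFormsMap p φ (SymForms.ι k A p v) = SymForms.ι k B p (formsMap p φ v) := by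
  let _ : Algebra A (SymForms k B p) :=
    ((algebraMap B (SymForms k B p)).comp φ.toRingHom).toAlgebra
  exact SymmetricAlgebra.lift_ι_apply _ v

lemma SymForms.induction {p : ℕ} {motive : SymForms k A p → Prop}
    (scalar : ∀ a, motive (algebraMap A _ a))
    (ι : ∀ v : Fin p → Ω[A⁄k], motive (SymForms.ι k A p (exteriorPower.ιMulti A p v)))
    (add : ∀ x y, motive x → motive y → motive (x + y))
    (mul : ∀ x y, motive x → motive y → motive (x * y)) (x : SymForms k A p) : motive x := by
  refine SymmetricAlgebra.induction _ _ (motive := motive) scalar (fun v ↦ ?_) mul add x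
  change motive (SymForms.ι k A p v)
  have hv : v ∈ Submodule.span A (Set.range (exteriorPower.ιMulti A p (M := Ω[A⁄k]))) :=
    exteriorPower.ιMulti_span A p (Ω[A⁄k]) ▸ Submodule.mem_top
  induction hv using Submodule.span_induction with
  | mem x hx => obtain ⟨w, rfl⟩ := hx; exact ι w
  | zero => simpa using scalar 0
  | add x y _ _ hx hy => rw [map_add]; exact add _ _ hx hy
  | smul a x _ hx => rw [map_smul, Algebra.smul_def]; exact mul _ _ (scalar a) hx

lemma symFormsMap_comp (p : ℕ) (φ : A →ₐ[k] B) (ψ : B →ₐ[k] C) (x : SymForms k A p) :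
    symFormsMap p (ψ.comp φ) x = symFormsMap p ψ (symFormsMap p φ x) := by
  induction x using SymForms.induction with
  | scalar a => simp only [symFormsMap_algebraMap, AlgHom.comp_apply]
  | ι v => simp only [symFormsMap_ι, formsMap_ιMulti, diffMap_comp]
  | add x y hx hy => simp only [map_add, hx, hy]
  | mul x y hx hy => simp only [map_mul, hx, hy]

end Functoriality

section Coordinates

open MvPolynomial

variable {k A B : Type u} [CommRing k] [CommRing A] [CommRing B] [Algebra k A] [Algebra k B]

lemma repr_diffMap {ι : Type*} {b : Module.Basis ι A (Ω[A⁄k])} {b' : Module.Basis ι B (Ω[B⁄k])}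
    {φ : A →ₐ[k] B} (h : ∀ i, b' i = diffMap φ (b i)) (x : Ω[A⁄k]) (i : ι) :
    b'.repr (diffMap φ x) i = φ (b.repr x i) := by
  classical
  have hx : x ∈ Submodule.span A (Set.range b) := b.span_eq ▸ Submodule.mem_top
  induction hx using Submodule.span_induction with
  | mem x hx =>
    obtain ⟨j, rfl⟩ := hx
    rw [← h, Module.Basis.repr_self, Module.Basis.repr_self, Finsupp.single_apply,
      Finsupp.single_apply, apply_ite φ, map_one, map_zero]
  | zero => simp only [map_zero, Finsupp.zero_apply]
  | add x y _ _ hx hy => simp only [map_add, Finsupp.add_apply, hx, hy]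
  | smul c x _ hx =>
    simp only [diffMap_smul, map_smul, Finsupp.smul_apply, smul_eq_mul, map_mul, hx]

variable {ι : Type*} [LinearOrder ι] (b : Module.Basis ι A (Ω[A⁄k]))
  (b' : Module.Basis ι B (Ω[B⁄k])) (p : ℕ)

/-- The basis `b_J = b_{j₁} ∧ ⋯ ∧ b_{j_p}` of `Ω^p_{A/k}` attached to a basis `b` of `Ω_{A/k}`. The
index sets `J` are given by their increasing enumerations. -/
def formsBasis : Module.Basis (Fin p ↪o ι) A (⋀[A]^p (Ω[A⁄k])) :=
  (b.exteriorPower p).reindex Set.powersetCard.ofFinEmbEquiv.symm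

lemma formsBasis_apply (J : Fin p ↪o ι) :
    formsBasis b p J = exteriorPower.ιMulti A p (b ∘ J) := by
  rw [formsBasis, Module.Basis.reindex_apply, exteriorPower.basis_apply]
  simp [exteriorPower.ιMulti_family]

lemma formsBasis_repr_ιMulti (J : Fin p ↪o ι) (v : Fin p → Ω[A⁄k]) :
    (formsBasis b p).repr (exteriorPower.ιMulti A p v) J =
      (Matrix.of fun i j ↦ b.repr (v i) (J j)).det := by
  rw [formsBasis, Module.Basis.repr_reindex_apply, exteriorPower.basis_repr_apply,
    exteriorPower.ιMultiDual_apply_ιMulti]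
  simp

/-- The identification of the algebra of symmetric forms with a polynomial ring in the variables
`b_J`, for a basis `b` of `Ω_{A/k}`. -/
def symCoord : SymForms k A p ≃ₐ[A] MvPolynomial (Fin p ↪o ι) A :=
  SymmetricAlgebra.equivMvPolynomial (formsBasis b p)

lemma symCoord_ι_basis (J : Fin p ↪o ι) :
    symCoord b p (SymForms.ι k A p (exteriorPower.ιMulti A p (b ∘ J))) = X J := by
  rw [← formsBasis_apply]
  exact SymmetricAlgebra.equivMvPolynomial_ι_apply (formsBasis b p) J

lemma symCoord_ι [Fintype (Fin p ↪o ι)] (x : ⋀[A]^p (Ω[A⁄k])) :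
    symCoord b p (SymForms.ι k A p x) = ∑ J, C ((formsBasis b p).repr x J) * X J := by
  conv_lhs => rw [← (formsBasis b p).sum_repr x]
  simp only [map_sum, map_smul, formsBasis_apply, symCoord_ι_basis, smul_eq_C_mul]

variable {b b'} {φ : A →ₐ[k] B}

lemma symCoord_symFormsMap [Finite (Fin p ↪o ι)] (h : ∀ i, b' i = diffMap φ (b i))
    (x : SymForms k A p) :
    symCoord b' p (symFormsMap p φ x) = MvPolynomial.map φ.toRingHom (symCoord b p x) := by
  have := Fintype.ofFinite (Fin p ↪o ι)
  induction x using SymForms.induction with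
  | scalar a =>
    simp only [symFormsMap_algebraMap, AlgEquiv.commutes, algebraMap_eq, map_C]
    rfl
  | ι v =>
    rw [symFormsMap_ι, formsMap_ιMulti, symCoord_ι, symCoord_ι, map_sum]
    refine Finset.sum_congr rfl fun J _ ↦ ?_
    rw [map_mul, map_C, map_X, formsBasis_repr_ιMulti, formsBasis_repr_ιMulti,
      RingHom.map_det φ.toRingHom]
    congr 3
    exact Matrix.ext fun i j ↦ repr_diffMap h (v i) (J j)
  | add x y hx hy => simp only [map_add, hx, hy]
  | mul x y hx hy => simp only [map_mul, hx, hy]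

lemma symFormsMap_injective [Finite (Fin p ↪o ι)] (h : ∀ i, b' i = diffMap φ (b i))
    (hφ : Function.Injective φ) : Function.Injective (symFormsMap p φ) := by
  intro x y hxy
  apply (symCoord b p).injective
  apply MvPolynomial.map_injective φ.toRingHom hφ
  rw [← symCoord_symFormsMap p h, ← symCoord_symFormsMap p h, hxy]

lemma mem_range_symFormsMap_iff_coeff [Finite (Fin p ↪o ι)] (h : ∀ i, b' i = diffMap φ (b i))
    (ω : SymForms k B p) :
    ω ∈ Set.range (symFormsMap p φ) ↔ ∀ μ, coeff μ (symCoord b' p ω) ∈ Set.range φ := by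
  constructor
  · rintro ⟨τ, rfl⟩ μ
    rw [symCoord_symFormsMap p h, coeff_map]
    exact ⟨_, rfl⟩
  · intro hω
    obtain ⟨P, hP⟩ : symCoord b' p ω ∈ Set.range (MvPolynomial.map φ.toRingHom) := by
      rw [mem_range_map_iff_coeffs_subset]
      intro c hc
      obtain ⟨μ, -, rfl⟩ := mem_coeffs_iff.1 hc
      exact hω μ
    refine ⟨(symCoord b p).symm P, (symCoord b' p).injective ?_⟩
    rw [symCoord_symFormsMap p h, AlgEquiv.apply_symm_apply, ← hP]

end Coordinates

/-! ### Commutative algebra -/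

section Normality

open TensorProduct

lemma isField_of_forall_isIdempotentElem {C : Type*} [CommRing C] [Nontrivial C]
    [IsArtinianRing C] [IsReduced C] (h : ∀ e : C, IsIdempotentElem e → e = 0 ∨ e = 1) :
    IsField C := by
  refine ⟨exists_pair_ne C, mul_comm, fun {x} hx ↦ ?_⟩
  obtain ⟨n, y, hy⟩ := IsArtinian.exists_pow_succ_smul_dvd x (1 : C)
  simp only [smul_eq_mul, mul_one] at hy
  have hxy : x * (1 - x * y) = 0 := by
    refine pow_eq_zero_iff n.succ_ne_zero |>.1 ?_
    rw [mul_pow, pow_succ (1 - x * y)]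
    rw [pow_succ] at hy ⊢
    linear_combination -x * (1 - x * y) ^ n * hy
  have hidem : IsIdempotentElem (x * y) := by
    rw [IsIdempotentElem]
    linear_combination (-y) * hxy
  rcases h _ hidem with h0 | h1
  · exact (hx (by linear_combination hxy + x * h0)).elim
  · exact ⟨y, h1⟩

lemma eq_zero_or_eq_one_of_isIdempotentElem {S : Type*} [CommRing S] [IsLocalRing S] {e : S}
    (he : IsIdempotentElem e) : e = 0 ∨ e = 1 := by
  rcases IsLocalRing.isUnit_or_isUnit_one_sub_self e with hu | hu
  · exact Or.inr ((IsIdempotentElem.iff_eq_one_of_isUnit hu).1 he)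
  · exact Or.inl (sub_eq_self.1 ((IsIdempotentElem.iff_eq_one_of_isUnit hu).1 he.one_sub))

lemma isField_of_isIntegrallyClosedIn {S C : Type*} [CommRing S] [IsLocalRing S] [CommRing C]
    [Algebra S C] [IsIntegrallyClosedIn S C] [IsArtinianRing C] [IsReduced C] : IsField C := by
  have hinj : Function.Injective (algebraMap S C) := IsIntegralClosure.algebraMap_injective S S C
  have : Nontrivial C := hinj.nontrivial
  refine isField_of_forall_isIdempotentElem fun e he ↦ ?_
  have hint : IsIntegral S e :=
    ⟨Polynomial.X ^ 2 - Polynomial.X, Polynomial.monic_X_pow_sub (by simp), by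
      simp [pow_two, he.eq]⟩
  obtain ⟨s, rfl⟩ := IsIntegrallyClosedIn.algebraMap_eq_of_integral hint
  have hs : IsIdempotentElem s := hinj (by rw [map_mul]; exact he.eq)
  exact (eq_zero_or_eq_one_of_isIdempotentElem hs).imp
    (fun h ↦ by rw [h, map_zero]) (fun h ↦ by rw [h, map_one])

lemma isIntegrallyClosedIn_tensorProduct {A S K : Type*} [CommRing A] [CommRing S] [CommRing K]
    [Algebra A S] [Algebra A K] [IsIntegrallyClosedIn A K] [Module.Flat A S]
    (h : Function.Surjective (TensorProduct.toIntegralClosure A S K)) :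
    IsIntegrallyClosedIn S (S ⊗[A] K) := by
  rw [isIntegrallyClosedIn_iff]
  refine ⟨Algebra.TensorProduct.includeLeft_injective (S := A)
    (IsIntegralClosure.algebraMap_injective A A K), fun {x} hx ↦ ?_⟩
  obtain ⟨z, hz⟩ := h ⟨x, hx⟩
  obtain rfl : Algebra.TensorProduct.map (.id S S) (integralClosure A K).val z = x :=
    congr_arg Subtype.val hz
  clear hz hx
  induction z with
  | zero => exact ⟨0, by simp only [map_zero]⟩
  | add a b ha hb =>
    obtain ⟨y, hy⟩ := ha
    obtain ⟨y', hy'⟩ := hb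
    exact ⟨y + y', by rw [map_add, map_add, hy, hy']⟩
  | tmul s c =>
    obtain ⟨a, ha⟩ := IsIntegrallyClosedIn.algebraMap_eq_of_integral (R := A) (A := K) c.2
    refine ⟨a • s, ?_⟩
    change (a • s) ⊗ₜ[A] (1 : K) = s ⊗ₜ[A] (c : K)
    rw [← ha, Algebra.algebraMap_eq_smul_one, TensorProduct.smul_tmul]

lemma isArtinianRing_and_isReduced_tensorProduct {A S : Type*} (K : Type*) [CommRing A]
    [CommRing S] [Field K] [Algebra A S] [Algebra A K] [Algebra.FormallyUnramified A S]
    [Algebra.EssFiniteType A S] : IsArtinianRing (S ⊗[A] K) ∧ IsReduced (S ⊗[A] K) := by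
  have : IsReduced (K ⊗[A] S) := Algebra.FormallyUnramified.isReduced_of_field K _
  have : Module.Finite K (K ⊗[A] S) := Algebra.FormallyUnramified.finite_of_free K _
  have : IsArtinianRing (K ⊗[A] S) := .of_finite K _
  let e := (Algebra.TensorProduct.comm A K S).toRingEquiv
  exact ⟨e.surjective.isArtinianRing, isReduced_of_injective e.symm e.symm.injective⟩

theorem isDomain_and_isIntegrallyClosed_of_etale {A B S : Type*} [CommRing A] [CommRing B]
    [CommRing S] [IsDomain A] [IsIntegrallyClosed A] [Algebra A B] [Algebra.Etale A B]
    [Algebra B S] [Algebra A S] [IsScalarTower A B S] (M : Submonoid B) [IsLocalization M S]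
    [IsLocalRing S] : IsDomain S ∧ IsIntegrallyClosed S := by
  let K := FractionRing A
  have : Module.Flat B S := IsLocalization.flat S M
  have : Module.Flat A S := Module.Flat.trans A B S
  have : Algebra.FormallyEtale B S := Algebra.FormallyEtale.of_isLocalization M
  have : Algebra.FormallyEtale A S := Algebra.FormallyEtale.comp A B S
  have : Algebra.EssFiniteType B S := Algebra.EssFiniteType.of_isLocalization S M
  have : Algebra.EssFiniteType A S := Algebra.EssFiniteType.comp A B S
  have : IsIntegrallyClosedIn A K := (isIntegrallyClosed_iff_isIntegrallyClosedIn K).1 inferInstance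
  have hic : IsIntegrallyClosedIn S (S ⊗[A] K) := isIntegrallyClosedIn_tensorProduct
    (TensorProduct.toIntegralClosure_bijective_of_tower (S := B)
      TensorProduct.toIntegralClosure_bijective_of_smooth
      (TensorProduct.toIntegralClosure_bijective_of_isLocalization M)).2
  obtain ⟨_, _⟩ := isArtinianRing_and_isReduced_tensorProduct (A := A) (S := S) K
  let _ : Field (S ⊗[A] K) := (isField_of_isIntegrallyClosedIn (S := S)).toField
  have hinj : Function.Injective (algebraMap S (S ⊗[A] K)) :=
    IsIntegralClosure.algebraMap_injective S S _
  have : IsDomain S := hinj.isDomain (algebraMap S (S ⊗[A] K))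
  have : FaithfulSMul S (S ⊗[A] K) := (faithfulSMul_iff_algebraMap_injective _ _).2 hinj
  have : IsFractionRing S (S ⊗[A] K) := .of_field _ _ fun z ↦ by
    obtain ⟨⟨x, s⟩, h⟩ := IsLocalization.surj
      (Algebra.algebraMapSubmonoid S (nonZeroDivisors A)) z
    have hs := (IsLocalization.map_units (S ⊗[A] K) s).ne_zero
    exact ⟨x, s, eq_div_of_mul_eq hs h⟩
  exact ⟨inferInstance, (isIntegrallyClosed_iff_isIntegrallyClosedIn (S ⊗[A] K)).2 hic⟩

end Normality

section AssociatedPrimes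

variable {R K : Type*} [CommRing R] [Field K] [Algebra R K] [IsFractionRing R K]

lemma exists_mul_eq_of_isIntegrallyClosed [IsNoetherianRing R] [IsIntegrallyClosed R]
    {P : Ideal R} (hP : P ≠ ⊥) {z : K} (hz : z ∉ Set.range (algebraMap R K))
    (hPz : ∀ q ∈ P, ∃ a, algebraMap R K a = z * algebraMap R K q) :
    ∃ p ∈ P, ∃ u ∉ P, algebraMap R K u = z * algebraMap R K p := by
  by_contra! hcon
  refine hz (IsIntegrallyClosed.algebraMap_eq_of_integral (R := R) ?_)
  refine isIntegral_of_smul_mem_submodule (Submodule.map (Algebra.linearMap R K) P) ?_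
    (Submodule.FG.map _ (IsNoetherian.noetherian P)) z ?_
  · obtain ⟨q, hq, hq0⟩ := Submodule.exists_mem_ne_zero_of_ne_bot hP
    rw [Submodule.ne_bot_iff]
    exact ⟨_, ⟨q, hq, rfl⟩, (map_ne_zero_iff _ (IsFractionRing.injective R K)).2 hq0⟩
  · rintro _ ⟨q, hq, rfl⟩
    obtain ⟨a, ha⟩ := hPz q hq
    exact ⟨a, by_contra fun haP ↦ hcon q hq a haP ha, ha⟩

variable [IsDomain R]

lemma isDiscreteValuationRing_localization_of_mul_eq [IsNoetherianRing R] {P : Ideal R}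
    [P.IsPrime] (hP : P ≠ ⊥) {z : K} (hPz : ∀ q ∈ P, ∃ a, algebraMap R K a = z * algebraMap R K q)
    {p u : R} (hp : p ∈ P) (hu : u ∉ P) (hpu : algebraMap R K u = z * algebraMap R K p) :
    IsDiscreteValuationRing (Localization.AtPrime P) := by
  have hfield : ¬ IsField (Localization.AtPrime P) := by
    rwa [IsLocalRing.isField_iff_maximalIdeal_eq, ← Localization.AtPrime.map_eq_maximalIdeal,
      Ideal.map_eq_bot_iff_of_injective
        (IsLocalization.injective _ P.primeCompl_le_nonZeroDivisors)]
  refine ((IsDiscreteValuationRing.TFAE _ hfield).out 0 4 rfl rfl).2 ⟨⟨algebraMap R _ p, ?_⟩⟩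
  rw [← Localization.AtPrime.map_eq_maximalIdeal, Ideal.submodule_span_eq]
  refine le_antisymm (Ideal.map_le_iff_le_comap.2 fun q hq ↦ ?_)
    ((Ideal.span_singleton_le_iff_mem _).2 (Ideal.mem_map_of_mem _ hp))
  obtain ⟨a, ha⟩ := hPz q hq
  have hqu : q * u = a * p := by
    apply IsFractionRing.injective R K
    rw [map_mul, map_mul, hpu, ha]
    ring
  have hunit := IsLocalization.map_units (Localization.AtPrime P) (⟨u, hu⟩ : P.primeCompl)
  rw [Ideal.mem_comap, ← Ideal.mul_unit_mem_iff_mem _ hunit, ← map_mul, hqu, map_mul]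
  exact Ideal.mul_mem_left _ _ (Ideal.mem_span_singleton_self _)

theorem mem_range_algebraMap_of_forall_isDiscreteValuationRing [IsNoetherianRing R]
    [IsIntegrallyClosed R] (x : K)
    (h : ∀ (P : Ideal R) [P.IsPrime], IsDiscreteValuationRing (Localization.AtPrime P) →
      ∃ s ∉ P, x * algebraMap R K s ∈ Set.range (algebraMap R K)) :
    x ∈ Set.range (algebraMap R K) := by
  by_contra hx
  let N : Submodule R K := LinearMap.range (Algebra.linearMap R K)
  have hmem (y : K) (r : R) : r ∈ (⊥ : Submodule R (K ⧸ N)).colon {N.mkQ y} ↔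
      ∃ a, algebraMap R K a = y * algebraMap R K r := by
    rw [Submodule.mem_colon_singleton, Submodule.mem_bot, ← map_smul, Submodule.mkQ_apply,
      Submodule.Quotient.mk_eq_zero, Algebra.smul_def, mul_comm]
    rfl
  have hx0 : N.mkQ x ≠ 0 := by
    rw [Submodule.mkQ_apply, Ne, Submodule.Quotient.mk_eq_zero]
    exact hx
  obtain ⟨P, hP, hle⟩ := exists_le_isAssociatedPrime_of_isNoetherianRing R (N.mkQ x) hx0
  obtain ⟨hPprime, z', hz'⟩ := (isAssociatedPrime_iff ..).1 hP
  obtain ⟨z, rfl⟩ := N.mkQ_surjective z'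
  have hzP (r : R) : r ∈ P ↔ ∃ a, algebraMap R K a = z * algebraMap R K r := by rw [hz', hmem]
  have hz : z ∉ Set.range (algebraMap R K) := fun ⟨r, hr⟩ ↦
    hPprime.ne_top <| (Ideal.eq_top_iff_one P).2 <| (hzP 1).2 ⟨r, by rw [map_one, mul_one, hr]⟩
  have hPbot : P ≠ ⊥ := by
    obtain ⟨⟨a, s⟩, hs⟩ := IsLocalization.surj (nonZeroDivisors R) z
    exact Submodule.ne_bot_iff _ |>.2 ⟨s, (hzP _).2 ⟨a, hs.symm⟩, nonZeroDivisors.ne_zero s.2⟩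
  obtain ⟨p, hp, u, hu, hpu⟩ := exists_mul_eq_of_isIntegrallyClosed hPbot hz fun q ↦ (hzP q).1
  obtain ⟨s, hs, hxs⟩ := h P
    (isDiscreteValuationRing_localization_of_mul_eq hPbot (fun q ↦ (hzP q).1) hp hu hpu)
  exact hs (hle ((hmem x s).2 hxs))

end AssociatedPrimes

section WeaklyUnramified

variable {O R : Type*} [CommRing O] [CommRing R] [IsLocalRing R] [IsNoetherianRing R]

lemma isDomain_of_maximalIdeal_eq_span {ϖ : R} (hϖ : ϖ ∈ nonZeroDivisors R)
    (hm : IsLocalRing.maximalIdeal R = Ideal.span {ϖ}) : IsDomain R := by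
  obtain ⟨P, hP⟩ := Ideal.nonempty_minimalPrimes (bot_ne_top (α := Ideal R))
  have hPprime : P.IsPrime := hP.1.1
  have hϖP : ϖ ∉ P := fun h ↦
    (Ideal.disjoint_nonZeroDivisors_of_mem_minimalPrimes hP).le_bot ⟨h, hϖ⟩
  have hle : P ≤ IsLocalRing.maximalIdeal R • P := fun q hq ↦ by
    obtain ⟨r, rfl⟩ := Ideal.mem_span_singleton'.1
      (hm ▸ IsLocalRing.le_maximalIdeal_of_isPrime P hq)
    rw [mul_comm]
    exact Submodule.smul_mem_smul (hm ▸ Ideal.mem_span_singleton_self ϖ)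
      ((hPprime.mem_or_mem hq).resolve_right hϖP)
  have hbot : P = ⊥ := Submodule.eq_bot_of_le_smul_of_le_jacobson_bot _ P
    (IsNoetherian.noetherian P) hle (IsLocalRing.maximalIdeal_le_jacobson ⊥)
  rw [hbot] at hPprime
  exact IsDomain.of_bot_isPrime R

lemma isDiscreteValuationRing_of_map_maximalIdeal [IsDomain O] [IsDiscreteValuationRing O]
    [Algebra O R] [Module.Flat O R]
    (h : (IsLocalRing.maximalIdeal O).map (algebraMap O R) = IsLocalRing.maximalIdeal R) :
    ∃ _ : IsDomain R, IsDiscreteValuationRing R := by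
  obtain ⟨ϖ, hϖ⟩ := IsDiscreteValuationRing.exists_irreducible O
  have hm : IsLocalRing.maximalIdeal R = Ideal.span {algebraMap O R ϖ} := by
    rw [← h, hϖ.maximalIdeal_eq, Ideal.map_span, Set.image_singleton]
  have hreg : algebraMap O R ϖ ∈ nonZeroDivisors R := by
    have : IsSMulRegular R ϖ := Module.Flat.isSMulRegular_of_nonZeroDivisors
      (mem_nonZeroDivisors_of_ne_zero hϖ.ne_zero)
    exact mem_nonZeroDivisors_iff_right.2 fun r hr ↦ this.right_eq_zero_of_smul <| by
      rw [Algebra.smul_def, mul_comm, hr]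
  have := isDomain_of_maximalIdeal_eq_span hreg hm
  have hfield : ¬ IsField R := by
    rw [IsLocalRing.isField_iff_maximalIdeal_eq, hm, Ideal.span_singleton_eq_bot]
    exact nonZeroDivisors.ne_zero hreg
  exact ⟨this, ((IsDiscreteValuationRing.TFAE R hfield).out 0 4 rfl rfl).2 ⟨⟨_, hm⟩⟩⟩

end WeaklyUnramified

section FaithfullyFlatDescent

variable {O R : Type*} [CommRing O] [IsDomain O] [CommRing R] [IsDomain R]
  [IsDiscreteValuationRing R] [Algebra O R] [Module.FaithfullyFlat O R]

lemma isDiscreteValuationRing_of_faithfullyFlat [IsLocalRing O] [IsNoetherianRing O]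
    (h : (IsLocalRing.maximalIdeal O).map (algebraMap O R) = IsLocalRing.maximalIdeal R) :
    IsDiscreteValuationRing O := by
  obtain ⟨ϖ, hϖ⟩ := IsDiscreteValuationRing.exists_irreducible R
  obtain ⟨a, ha, haϖ⟩ :
      ∃ a ∈ IsLocalRing.maximalIdeal O, algebraMap O R a ∉ Ideal.span {ϖ ^ 2} := by
    by_contra! hcon
    have hle : IsLocalRing.maximalIdeal R ≤ Ideal.span {ϖ ^ 2} := by
      rw [← h]
      exact Ideal.map_le_iff_le_comap.2 hcon
    rw [hϖ.maximalIdeal_eq, Ideal.span_singleton_le_span_singleton, pow_two] at hle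
    exact hϖ.not_isUnit <| isUnit_of_dvd_one <|
      (mul_dvd_mul_iff_left hϖ.ne_zero).1 (by rwa [mul_one])
  have hassoc : Associated ϖ (algebraMap O R a) := by
    have hdvd : ϖ ∣ algebraMap O R a := by
      rw [← Ideal.mem_span_singleton, ← hϖ.maximalIdeal_eq, ← h]
      exact Ideal.mem_map_of_mem _ ha
    obtain ⟨v, hv⟩ := hdvd
    have hvu : IsUnit v := by
      by_contra hvn
      obtain ⟨w, rfl⟩ := Ideal.mem_span_singleton.1
        (hϖ.maximalIdeal_eq ▸ (IsLocalRing.mem_maximalIdeal v).2 hvn)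
      exact haϖ (Ideal.mem_span_singleton.2 ⟨w, by rw [hv, pow_two, mul_assoc]⟩)
    exact ⟨hvu.unit, hv.symm⟩
  have hspan : IsLocalRing.maximalIdeal O = Ideal.span {a} := by
    rw [← Ideal.comap_map_eq_self_of_faithfullyFlat (B := R) (Ideal.span {a}), Ideal.map_span,
      Set.image_singleton, ← Ideal.span_singleton_eq_span_singleton.2 hassoc, ← hϖ.maximalIdeal_eq,
      ← h, Ideal.comap_map_eq_self_of_faithfullyFlat]
  have hfield : ¬ IsField O := by
    rw [IsLocalRing.isField_iff_maximalIdeal_eq, hspan, Ideal.span_singleton_eq_bot]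
    rintro rfl
    exact hϖ.ne_zero (hassoc.eq_zero_iff.2 (map_zero _))
  exact ((IsDiscreteValuationRing.TFAE O hfield).out 0 4 rfl rfl).2 ⟨⟨a, hspan⟩⟩

lemma length_quotient_le_addVal [IsDiscreteValuationRing O]
    (h : (IsLocalRing.maximalIdeal O).map (algebraMap O R) = IsLocalRing.maximalIdeal R)
    {J : Ideal O} {r : R} (hr : r ∈ J.map (algebraMap O R)) :
    Module.length O (O ⧸ J) ≤ IsDiscreteValuationRing.addVal R r := by
  obtain ⟨ϖ, hϖ⟩ := IsDiscreteValuationRing.exists_irreducible R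
  rcases eq_or_ne r 0 with rfl | hr0
  · rw [IsDiscreteValuationRing.addVal_zero]
    exact le_top
  obtain ⟨t, u, rfl⟩ := IsDiscreteValuationRing.eq_unit_mul_pow_irreducible hr0 hϖ
  obtain ⟨π, hπ⟩ := IsDiscreteValuationRing.exists_irreducible O
  have hspan : Ideal.span {algebraMap O R π} = Ideal.span {ϖ} := by
    rw [← hϖ.maximalIdeal_eq, ← h, hπ.maximalIdeal_eq, Ideal.map_span, Set.image_singleton]
  have hmem : π ^ t ∈ J := by
    rw [← Ideal.comap_map_eq_self_of_faithfullyFlat (B := R) J, Ideal.mem_comap, map_pow]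
    exact (J.map _).mem_of_dvd
      (pow_dvd_pow_of_dvd (Ideal.span_singleton_le_span_singleton.1 hspan.le) t)
      ((Ideal.unit_mul_mem_iff_mem _ u.isUnit).1 hr)
  calc Module.length O (O ⧸ J) ≤ Ring.ord O (π ^ t) :=
        Module.length_le_of_surjective
          (Submodule.factor ((Ideal.span_singleton_le_iff_mem _).2 hmem))
          (Submodule.factor_surjective _)
    _ = t := by
        rw [Ring.ord_pow (mem_nonZeroDivisors_of_ne_zero hπ.ne_zero), Ring.ord_of_irreducible hπ]
        simp
    _ = IsDiscreteValuationRing.addVal R (u * ϖ ^ t) :=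
        (IsDiscreteValuationRing.addVal_def' u hϖ t).symm

end FaithfullyFlatDescent

/-! ### Logarithmic generators -/

section CeilQuot

open Orbifold.Chart

lemma ceilQuot_top (a : ℕ) : ceilQuot a ⊤ = 0 := if_pos rfl

lemma ceilQuot_le_iff {m : ℕ} (hm : 1 ≤ m) (a q : ℕ) : ceilQuot a m ≤ q ↔ a ≤ q * m := by
  have hm0 : (0 : ℚ) < m := by exact_mod_cast hm
  rw [ceilQuot, if_neg (ENat.natCast_ne_top m), Nat.ceil_le, ENat.toNat_natCast, div_le_iff₀ hm0]
  exact_mod_cast Iff.rfl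

lemma ceilQuot_one (a : ℕ) : ceilQuot a 1 = a := by
  simp [ceilQuot]

lemma ceilQuot_zero {m : ℕ∞} : ceilQuot 0 m = 0 := by
  simp [ceilQuot]

lemma ceilQuot_mono {m : ℕ∞} (hm : 1 ≤ m) {a b : ℕ} (h : a ≤ b) :
    ceilQuot a m ≤ ceilQuot b m := by
  induction m with
  | top => simp only [ceilQuot_top, le_refl]
  | coe m =>
    have hm' : 1 ≤ m := by exact_mod_cast hm
    exact (ceilQuot_le_iff hm' _ _).2 (h.trans ((ceilQuot_le_iff hm' _ _).1 le_rfl))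

lemma ceilQuot_add_le {m : ℕ∞} (hm : 1 ≤ m) (a b : ℕ) :
    ceilQuot (a + b) m ≤ ceilQuot a m + ceilQuot b m := by
  induction m with
  | top => simp only [ceilQuot_top, le_refl]
  | coe m =>
    have hm' : 1 ≤ m := by exact_mod_cast hm
    rw [ceilQuot_le_iff hm', add_mul]
    exact add_le_add ((ceilQuot_le_iff hm' _ _).1 le_rfl) ((ceilQuot_le_iff hm' _ _).1 le_rfl)

lemma ceilQuot_sum_le {ι : Type*} {m : ℕ∞} (hm : 1 ≤ m) (s : Finset ι) (a : ι → ℕ) :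
    ceilQuot (∑ i ∈ s, a i) m ≤ ∑ i ∈ s, ceilQuot (a i) m :=
  s.le_sum_of_subadditive (ceilQuot · m) ceilQuot_zero.le (ceilQuot_add_le hm) a

lemma ceilQuot_le_mul {m m' : ℕ∞} (hm' : 1 ≤ m') {t : ℕ} (h : m' ≤ t * m) (a : ℕ) :
    ceilQuot a m ≤ t * ceilQuot a m' := by
  induction m with
  | top => simp only [ceilQuot_top, zero_le]
  | coe m =>
    lift m' to ℕ using ne_top_of_le_ne_top (ENat.natCast_ne_top (t * m)) (by exact_mod_cast h)
    norm_cast at hm' h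
    have hm : 1 ≤ m := Nat.pos_of_ne_zero fun h0 ↦ by rw [h0] at h; omega
    rw [ceilQuot_le_iff hm]
    calc a ≤ ceilQuot a m' * m' := (ceilQuot_le_iff hm' _ _).1 le_rfl
      _ ≤ ceilQuot a m' * (t * m) := Nat.mul_le_mul_left _ h
      _ = t * ceilQuot a m' * m := by ring

lemma ceilQuot_anti {m m' : ℕ∞} (hm : 1 ≤ m) (h : m ≤ m') (a : ℕ) :
    ceilQuot a m' ≤ ceilQuot a m := by
  simpa only [one_mul] using ceilQuot_le_mul (t := 1) hm (by rwa [Nat.cast_one, one_mul]) a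

lemma ceilQuot_le_self {m : ℕ∞} (hm : 1 ≤ m) (a : ℕ) : ceilQuot a m ≤ a :=
  (ceilQuot_anti le_rfl hm a).trans (ceilQuot_one a).le

end CeilQuot

section CoeffLattice

open MvPolynomial

variable {R L σ : Type*} [CommRing R] [CommRing L]

/-- The lattice of homogeneous polynomials of degree `n` whose coefficient at each monomial `μ` is
`e μ` times an element of the image of `j`. It describes the stalks of `S^n Ω^p_{(X,Δ)}` in
logarithmic coordinates, with `e μ = x^⌈k/m⌉`. -/
def coeffLattice (j : R →+* L) (n : ℕ) (e : (σ →₀ ℕ) → L) : AddSubgroup (MvPolynomial σ L) where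
  carrier := {P | P.IsHomogeneous n ∧ ∀ μ, ∃ r, coeff μ P = j r * e μ}
  zero_mem' := ⟨isHomogeneous_zero σ L n, fun μ ↦ ⟨0, by simp⟩⟩
  add_mem' := fun ⟨hP, hP'⟩ ⟨hQ, hQ'⟩ ↦ ⟨hP.add hQ, fun μ ↦ by
    obtain ⟨r, hr⟩ := hP' μ
    obtain ⟨s, hs⟩ := hQ' μ
    exact ⟨r + s, by rw [coeff_add, hr, hs, map_add, add_mul]⟩⟩
  neg_mem' := fun ⟨hP, hP'⟩ ↦ ⟨hP.neg, fun μ ↦ by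
    obtain ⟨r, hr⟩ := hP' μ
    exact ⟨-r, by rw [coeff_neg, hr, map_neg, neg_mul]⟩⟩

variable {j : R →+* L} {n : ℕ} {e e' : (σ →₀ ℕ) → L}

lemma C_mul_mem_coeffLattice {P : MvPolynomial σ L} (hP : P ∈ coeffLattice j n e) {c : L}
    (h : ∀ μ, ∃ r, c * e μ = j r * e' μ) : C c * P ∈ coeffLattice j n e' := by
  refine ⟨hP.1.C_mul c, fun μ ↦ ?_⟩
  obtain ⟨r, hr⟩ := hP.2 μ
  obtain ⟨s, hs⟩ := h μ
  exact ⟨r * s, by rw [coeff_C_mul, hr, map_mul, mul_assoc, ← hs]; ring⟩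

lemma mul_mem_coeffLattice {m : ℕ} {e'' : (σ →₀ ℕ) → L} {P Q : MvPolynomial σ L}
    (hP : P ∈ coeffLattice j n e) (hQ : Q ∈ coeffLattice j m e')
    (h : ∀ μ ν, ∃ r, e μ * e' ν = j r * e'' (μ + ν)) : P * Q ∈ coeffLattice j (n + m) e'' := by
  classical
  refine ⟨hP.1.mul hQ.1, fun μ ↦ ?_⟩
  have hterm : ∀ x ∈ Finset.HasAntidiagonal.antidiagonal μ,
      ∃ r, coeff x.1 P * coeff x.2 Q = j r * e'' μ := fun x hx ↦ by
    obtain ⟨r, hr⟩ := hP.2 x.1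
    obtain ⟨s, hs⟩ := hQ.2 x.2
    obtain ⟨q, hq⟩ := h x.1 x.2
    rw [Finset.HasAntidiagonal.mem_antidiagonal.1 hx] at hq
    exact ⟨r * s * q, by rw [hr, hs, map_mul, map_mul, mul_assoc (j r * j s), ← hq]; ring⟩
  choose! r hr using hterm
  exact ⟨_, by rw [coeff_mul, Finset.sum_congr rfl hr, ← Finset.sum_mul, ← map_sum]⟩

lemma one_mem_coeffLattice (h : e 0 = 1) : (1 : MvPolynomial σ L) ∈ coeffLattice j 0 e := by
  classical
  refine ⟨isHomogeneous_one σ L, fun μ ↦ ?_⟩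
  rw [coeff_one]
  split_ifs with h0
  · exact ⟨1, by rw [← h0, h, map_one, mul_one]⟩
  · exact ⟨0, by rw [map_zero, zero_mul]⟩

lemma sum_C_mul_X_mem_coeffLattice [Fintype σ] {c : σ → L}
    (h : ∀ s, ∃ r, c s = j r * e (Finsupp.single s 1)) :
    ∑ s, C (c s) * X s ∈ coeffLattice j 1 e := by
  classical
  refine sum_mem fun s _ ↦ ⟨(isHomogeneous_X L s).C_mul _, fun μ ↦ ?_⟩
  rw [coeff_C_mul, coeff_X]
  split_ifs with h0
  · rw [← h0, mul_one]
    exact h s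
  · exact ⟨0, by rw [map_zero, zero_mul, mul_zero]⟩

lemma prod_mem_coeffLattice_pow {ι : Type*} (s : Finset ι) {ϖ : R} (wt : (σ →₀ ℕ) →+ ℕ)
    (κ : ι → ℕ) {P : ι → MvPolynomial σ L}
    (h : ∀ a ∈ s, P a ∈ coeffLattice j 1 fun μ ↦ j ϖ ^ (wt μ - κ a)) :
    ∏ a ∈ s, P a ∈ coeffLattice j s.card fun μ ↦ j ϖ ^ (wt μ - ∑ a ∈ s, κ a) := by
  classical
  induction s using Finset.induction_on with
  | empty => exact one_mem_coeffLattice (by simp)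
  | insert a s ha ih =>
    rw [Finset.prod_insert ha, Finset.sum_insert ha, Finset.card_insert_of_notMem ha, add_comm]
    refine mul_mem_coeffLattice (h a (Finset.mem_insert_self _ _))
      (ih fun b hb ↦ h b (Finset.mem_insert_of_mem hb)) fun μ ν ↦ ?_
    have hle : wt (μ + ν) - (κ a + ∑ b ∈ s, κ b) ≤
        (wt μ - κ a) + (wt ν - ∑ b ∈ s, κ b) := by
      rw [map_add]
      omega
    obtain ⟨r, hr⟩ := pow_dvd_pow ϖ hle
    exact ⟨r, by rw [← pow_add, ← map_pow, hr, map_mul, map_pow, mul_comm]⟩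

end CoeffLattice

section LogGenerator

open MvPolynomial Orbifold.Chart

section Occ

variable {ι : Type*} [LinearOrder ι] {p : ℕ}

/-- The number `k_i` of factors `J` of the monomial `μ` which contain `i`. -/
def occ (i : ι) : ((Fin p ↪o ι) →₀ ℕ) →+ ℕ :=
  Finsupp.weight fun J : Fin p ↪o ι ↦ if i ∈ Set.range J then 1 else 0

lemma occ_single (i : ι) (J : Fin p ↪o ι) :
    occ i (Finsupp.single J 1) = if i ∈ Set.range J then 1 else 0 := by
  rw [occ, Finsupp.weight_single, one_smul]

lemma occ_sum_single {n : ℕ} (i : ι) (J : Fin n → (Fin p ↪o ι)) :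
    occ i (∑ a, Finsupp.single (J a) 1) = Nat.card {a : Fin n // i ∈ Set.range (J a)} := by
  rw [map_sum, Nat.card_eq_fintype_card, Fintype.card_subtype]
  simp only [occ_single, Finset.sum_boole, Nat.cast_id]

end Occ

lemma exists_sum_single_of_degree_eq {σ : Type*} {n : ℕ} (μ : σ →₀ ℕ) (h : μ.degree = n) :
    ∃ J : Fin n → σ, μ = ∑ a, Finsupp.single (J a) 1 := by
  classical
  induction n generalizing μ with
  | zero => exact ⟨Fin.elim0, by simpa using (Finsupp.degree_eq_zero_iff _).1 h⟩
  | succ n ih =>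
    have hμ : μ ≠ 0 := by
      rintro rfl
      simp at h
    obtain ⟨s, hs⟩ := Finsupp.ne_iff.1 hμ
    have hadd : Finsupp.single s 1 + (μ - Finsupp.single s 1) = μ :=
      add_tsub_cancel_of_le (Finsupp.single_le_iff.2 (Nat.one_le_iff_ne_zero.2 hs))
    obtain ⟨J, hJ⟩ := ih (μ - Finsupp.single s 1) <| by
      have := congr_arg Finsupp.degree hadd
      rw [map_add, h, Finsupp.degree_single] at this
      omega
    refine ⟨Fin.cons s J, ?_⟩
    simp only [Fin.sum_univ_succ, Fin.cons_zero, Fin.cons_succ]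
    rw [← hJ, hadd]

variable {k K : Type u} [CommRing k] [Field K] [Algebra k K] {ι : Type*} [LinearOrder ι]
  {n p : ℕ}

lemma smul_ιMulti_D (x : ι → K) (J : Fin p ↪o ι) :
    (∏ l, x (J l))⁻¹ • exteriorPower.ιMulti K p (fun l ↦ KaehlerDifferential.D k K (x (J l))) =
      exteriorPower.ιMulti K p fun l ↦ (x (J l))⁻¹ • KaehlerDifferential.D k K (x (J l)) := by
  rw [AlternatingMap.map_smul_univ, Finset.prod_inv_distrib]

variable [Fintype ι]

/-- The generator `x^⌈k/m⌉ ⊗ dx_{J_i} / x_{J_i}` for rational functions `x` of multiplicities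
`m`. -/
def logGenerator (x : ι → K) (m : ι → ℕ∞) (n p : ℕ) (J : Fin n → (Fin p ↪o ι)) :
    SymForms k K p :=
  (∏ i, x i ^ ceilQuot (Nat.card {a : Fin n // i ∈ Set.range (J a)}) (m i)) •
    ∏ a, SymForms.ι k K p ((∏ l, x (J a l))⁻¹ • exteriorPower.ιMulti K p
      fun l ↦ KaehlerDifferential.D k K (x (J a l)))

variable {x : ι → K} (m : ι → ℕ∞) {ε : Module.Basis ι K (Ω[K⁄k])}
  (hε : ∀ i, ε i = (x i)⁻¹ • KaehlerDifferential.D k K (x i))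
include hε

lemma symCoord_logGenerator (J : Fin n → (Fin p ↪o ι)) :
    symCoord ε p (logGenerator x m n p J) = monomial (∑ a, Finsupp.single (J a) 1)
      (∏ i, x i ^ ceilQuot (occ i (∑ a, Finsupp.single (J a) 1)) (m i)) := by
  have h (a : Fin n) : exteriorPower.ιMulti K p
      (fun l ↦ (x (J a l))⁻¹ • KaehlerDifferential.D k K (x (J a l))) =
      exteriorPower.ιMulti K p (ε ∘ J a) := congr_arg _ (funext fun l ↦ (hε _).symm)
  simp only [logGenerator, smul_ιMulti_D, h, map_smul, map_prod, symCoord_ι_basis,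
    occ_sum_single]
  rw [smul_eq_C_mul, ← mul_one (∏ i, x i ^ _), ← C_mul_monomial, monomial_sum_one, mul_one]
  rfl

lemma mem_span_logGenerator {O : Subring K} {v : SymForms k K p}
    (h : symCoord ε p v ∈
      coeffLattice O.subtype n fun μ ↦ ∏ i, x i ^ ceilQuot (occ i μ) (m i)) :
    v ∈ Submodule.span O (Set.range (logGenerator (k := k) x m n p)) := by
  rw [← (symCoord ε p).symm_apply_apply v, (symCoord ε p v).as_sum, map_sum]
  refine Submodule.sum_mem _ fun μ hμ ↦ ?_
  obtain ⟨r, hr⟩ := h.2 μ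
  have hdeg : μ.degree = n := by
    rw [Finsupp.degree_eq_weight_one]
    exact h.1 (mem_support_iff.1 hμ)
  obtain ⟨J, hJ⟩ := exists_sum_single_of_degree_eq μ hdeg
  have hmonomial : (symCoord ε p).symm (monomial μ (coeff μ (symCoord ε p v))) =
      (r : K) • logGenerator (k := k) x m n p J := by
    rw [AlgEquiv.symm_apply_eq, map_smul, symCoord_logGenerator m hε, ← hJ, hr, smul_monomial]
    rfl
  rw [hmonomial]
  exact Submodule.smul_mem _ r (Submodule.subset_span ⟨J, rfl⟩)

end LogGenerator

section OrbGenerator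

open MvPolynomial Orbifold.Chart

section Combinatorics

variable {κ : Type*} [LinearOrder κ] {n p : ℕ} (J : Fin n → (Fin p ↪o κ))

lemma prod_prod_apply_eq_prod_pow_card [Fintype κ] {M : Type*} [CommMonoid M] (c : κ → M) :
    ∏ a, ∏ q, c (J a q) = ∏ l, c l ^ Nat.card {a : Fin n // l ∈ Set.range (J a)} := by
  have h (a : Fin n) : ∏ q, c (J a q) = ∏ l, if l ∈ Set.range (J a) then c l else 1 := by
    rw [← Finset.prod_filter, ← RelEmbedding.coe_toEmbedding, ← Finset.prod_map]
    congr 1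
    ext l
    simp
  simp only [h]
  rw [Finset.prod_comm]
  refine Finset.prod_congr rfl fun l _ ↦ ?_
  rw [← Finset.prod_filter, Finset.prod_const, Nat.card_eq_fintype_card, Fintype.card_subtype]

lemma card_filter_exists_mem_le (N : Finset κ) :
    (Finset.univ.filter fun a ↦ ∃ q, J a q ∈ N).card ≤
      ∑ l ∈ N, Nat.card {a : Fin n // l ∈ Set.range (J a)} := by
  have hsub : (Finset.univ.filter fun a ↦ ∃ q, J a q ∈ N) ⊆
      N.biUnion fun l ↦ Finset.univ.filter fun a ↦ l ∈ Set.range (J a) := fun a ha ↦ by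
    obtain ⟨q, hq⟩ := (Finset.mem_filter.1 ha).2
    exact Finset.mem_biUnion.2
      ⟨J a q, hq, Finset.mem_filter.2 ⟨Finset.mem_univ a, Set.mem_range_self q⟩⟩
  refine (Finset.card_le_card hsub).trans (Finset.card_biUnion_le.trans_eq ?_)
  simp only [Nat.card_eq_fintype_card, Fintype.card_subtype]

lemma ceilQuot_card_filter_le [Fintype κ] {m : ℕ∞} (hm : 1 ≤ m) {m' : κ → ℕ∞}
    (hm' : ∀ l, 1 ≤ m' l) {t : κ → ℕ} (hle : ∀ l, t l ≠ 0 → m' l ≤ t l * m) :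
    ceilQuot (Finset.univ.filter fun a ↦ ∃ q, t (J a q) ≠ 0).card m ≤
      ∑ l, t l * ceilQuot (Nat.card {a : Fin n // l ∈ Set.range (J a)}) (m' l) := by
  let N := Finset.univ.filter fun l ↦ t l ≠ 0
  have hcard := card_filter_exists_mem_le J N
  simp only [N, Finset.mem_filter, Finset.mem_univ, true_and] at hcard
  refine (ceilQuot_mono hm hcard).trans ((ceilQuot_sum_le hm N _).trans ?_)
  refine (Finset.sum_le_sum fun l hl ↦ ?_).trans
    (Finset.sum_le_sum_of_subset (Finset.subset_univ N))
  exact ceilQuot_le_mul (hm' l) (hle l (Finset.mem_filter.1 hl).2) _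

end Combinatorics

lemma prod_pow_dvd_pow {ι R : Type*} [Fintype ι] [CommMonoid R] {x : ι → R} {i₀ : ι}
    (hunit : ∀ i, i ≠ i₀ → IsUnit (x i)) {e : ι → ℕ} {s : ℕ} (h : e i₀ ≤ s) :
    ∏ i, x i ^ e i ∣ x i₀ ^ s := by
  classical
  rw [← Finset.mul_prod_erase _ _ (Finset.mem_univ i₀), IsUnit.mul_right_dvd]
  · exact pow_dvd_pow _ h
  · exact Finset.prod_induction _ IsUnit (fun _ _ ↦ IsUnit.mul) isUnit_one
      fun i hi ↦ (hunit i (Finset.ne_of_mem_erase hi)).pow _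

variable {k R L : Type u} [CommRing k] [CommRing R] [Field L] [Algebra k R] [Algebra k L]

section Definitions

variable {S : Type u} [CommRing S] [Algebra k S] {κ : Type*} [LinearOrder κ] {n p : ℕ}

/-- The differential `dy` if `y` has multiplicity `1`, and `dy / y` otherwise. It is meaningful only
if `y` is invertible in the latter case, as `Ring.inverse` is `0` outside the units. -/
def orbDiff (y : S) (m : ℕ∞) : Ω[S⁄k] :=
  if m = 1 then KaehlerDifferential.D k S y else Ring.inverse y • KaehlerDifferential.D k S y

/-- The power `y^⌈a/m⌉`, omitted if `y` has multiplicity `1`. -/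
def orbPow (y : S) (m : ℕ∞) (a : ℕ) : S := if m = 1 then 1 else y ^ ceilQuot a m

lemma diffMap_orbDiff (β : S →ₐ[k] L) {y : S} {m : ℕ∞} (hy : m ≠ 1 → IsUnit y) :
    diffMap β (orbDiff y m) = orbDiff (β y) m := by
  by_cases hm : m = 1
  · simp only [orbDiff, hm, if_true, diffMap_D]
  · simp only [orbDiff, hm, if_false, diffMap_smul, diffMap_D, Ring.inverse_eq_inv]
    congr 1
    refine eq_inv_of_mul_eq_one_left ?_
    rw [← map_mul, Ring.inverse_mul_cancel _ (hy hm), map_one]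

variable [Fintype κ] (J : Fin n → (Fin p ↪o κ))

/-- The generator `y^⌈k/m⌉ ⊗ dy_{J_i} / y_{J_i}`, where the `y_j` of multiplicity `1` have been
cancelled. Unlike `logGenerator`, it is meaningful when some of these `y_j` vanish, as may happen
after a pullback. -/
def orbGenerator (y : κ → S) (m : κ → ℕ∞) (n p : ℕ) (J : Fin n → (Fin p ↪o κ)) :
    SymForms k S p :=
  (∏ l, orbPow (y l) (m l) (Nat.card {a : Fin n // l ∈ Set.range (J a)})) •
    ∏ a, SymForms.ι k S p (exteriorPower.ιMulti S p fun q ↦ orbDiff (y (J a q)) (m (J a q)))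

lemma symFormsMap_orbGenerator (β : S →ₐ[k] L) {y : κ → S} {m : κ → ℕ∞}
    (hy : ∀ l, m l ≠ 1 → IsUnit (y l)) :
    symFormsMap p β (orbGenerator y m n p J) = orbGenerator (fun l ↦ β (y l)) m n p J := by
  simp only [orbGenerator, symFormsMap_smul, map_prod, symFormsMap_ι, formsMap_ιMulti,
    diffMap_orbDiff β (hy _), orbPow, apply_ite β, map_one, map_pow]

lemma prod_ι_ιMulti_smul (c : κ → S) (v : κ → Ω[S⁄k]) :
    ∏ a, SymForms.ι k S p (exteriorPower.ιMulti S p fun q ↦ c (J a q) • v (J a q)) =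
      (∏ l, c l ^ Nat.card {a : Fin n // l ∈ Set.range (J a)}) •
        ∏ a, SymForms.ι k S p (exteriorPower.ιMulti S p fun q ↦ v (J a q)) := by
  simp only [AlternatingMap.map_smul_univ, map_smul]
  rw [Finset.prod_smul, prod_prod_apply_eq_prod_pow_card]

lemma logGenerator_eq_orbGenerator {y : κ → L} (hy : ∀ l, y l ≠ 0) (m : κ → ℕ∞) :
    logGenerator (k := k) y m n p J = orbGenerator y m n p J := by
  let c : κ → L := fun l ↦ if m l = 1 then (y l)⁻¹ else 1
  have hD (l : κ) : (y l)⁻¹ • KaehlerDifferential.D k L (y l) = c l • orbDiff (y l) (m l) := by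
    by_cases hm : m l = 1 <;>
      simp only [c, orbDiff, hm, if_true, if_false, one_smul, Ring.inverse_eq_inv]
  have hpow (l : κ) (a : ℕ) : y l ^ ceilQuot a (m l) * c l ^ a = orbPow (y l) (m l) a := by
    by_cases hm : m l = 1
    · simp only [c, orbPow, hm, if_true, ceilQuot_one, ← mul_pow, mul_inv_cancel₀ (hy l), one_pow]
    · simp only [c, orbPow, hm, if_false, one_pow, mul_one]
  simp only [logGenerator, smul_ιMulti_D, hD]
  rw [prod_ι_ιMulti_smul J c fun l ↦ orbDiff (y l) (m l), smul_smul, ← Finset.prod_mul_distrib]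
  simp only [hpow, orbGenerator]

end Definitions

variable {ι : Type*} {j : R →ₐ[k] L}

section LogCoordinates

variable {x : ι → R} {b : Module.Basis ι R (Ω[R⁄k])}
  (hb : ∀ i, b i = KaehlerDifferential.D k R (x i)) (hx : ∀ i, j (x i) ≠ 0)
  {ε : Module.Basis ι L (Ω[L⁄k])}
  (hε : ∀ i, ε i = (j (x i))⁻¹ • KaehlerDifferential.D k L (j (x i)))
include hb hx hε

lemma repr_log_D (r : R) (i : ι) :
    ε.repr (KaehlerDifferential.D k L (j r)) i =
      j (x i * b.repr (KaehlerDifferential.D k R r) i) := by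
  have hunit (i : ι) : IsUnit (j (x i)) := (hx i).isUnit
  have hbasis (i : ι) : ε.unitsSMul (fun i ↦ (hunit i).unit) i = diffMap j (b i) := by
    rw [Module.Basis.unitsSMul_apply, hε, hb, diffMap_D, Units.smul_def, IsUnit.unit_spec,
      smul_inv_smul₀ (hx i)]
  have h := repr_diffMap hbasis (KaehlerDifferential.D k R r) i
  rw [diffMap_D, Module.Basis.repr_unitsSMul, Units.smul_def, smul_eq_mul, Units.val_inv_eq_inv_val,
    IsUnit.unit_spec, inv_mul_eq_iff_eq_mul₀ (hx i)] at h
  rw [h, map_mul]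

variable {ϖ : R} (hϖ : j ϖ ≠ 0)
include hϖ

lemma repr_log_pow_mul_unit (t : ℕ) (u : Rˣ) (i : ι) :
    ε.repr ((j (ϖ ^ t * u))⁻¹ • KaehlerDifferential.D k L (j (ϖ ^ t * u))) i =
      j (x i * (((u⁻¹ : Rˣ) : R) * b.repr (KaehlerDifferential.D k R (u : R)) i)) +
      t * (j (x i * b.repr (KaehlerDifferential.D k R ϖ) i) / j ϖ) := by
  have hu : j ((u⁻¹ : Rˣ) : R) * j (u : R) = 1 := by rw [← map_mul, Units.inv_mul, map_one]
  have hu0 : j (u : R) ≠ 0 := right_ne_zero_of_mul_eq_one hu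
  rw [map_smul, Finsupp.smul_apply, repr_log_D hb hx hε, Derivation.leibniz,
    Derivation.leibniz_pow]
  simp only [map_add, map_smul, map_nsmul, Finsupp.add_apply, Finsupp.smul_apply, smul_eq_mul,
    map_mul, map_pow, eq_inv_of_mul_eq_one_left hu, nsmul_eq_mul, map_natCast]
  rcases t with - | t
  · simp only [pow_zero, Nat.cast_zero]
    field_simp
    ring
  · rw [Nat.add_sub_cancel]
    field_simp
    ring

lemma exists_repr_orbDiff {y : R} {m : ℕ∞} {t : ℕ} {u : Rˣ} (hy : m ≠ 1 → y = ϖ ^ t * u)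
    (ht : m = 1 → t = 0) :
    ∃ c : ι → R, ∀ i, ε.repr (orbDiff (j y) m) i =
      j (x i * c i) + t * (j (x i * b.repr (KaehlerDifferential.D k R ϖ) i) / j ϖ) := by
  by_cases hm : m = 1
  · refine ⟨b.repr (KaehlerDifferential.D k R y), fun i ↦ ?_⟩
    rw [orbDiff, if_pos hm, repr_log_D hb hx hε, ht hm, Nat.cast_zero, zero_mul, add_zero]
  · refine ⟨fun i ↦ ((u⁻¹ : Rˣ) : R) * b.repr (KaehlerDifferential.D k R (u : R)) i, fun i ↦ ?_⟩
    rw [orbDiff, if_neg hm, Ring.inverse_eq_inv, hy hm, repr_log_pow_mul_unit hb hx hε hϖ]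

end LogCoordinates

lemma exists_orbPow_eq {ϖ y : R} {m : ℕ∞} {t : ℕ} {u : Rˣ} (hy : m ≠ 1 → y = ϖ ^ t * u)
    (ht : m = 1 → t = 0) (a : ℕ) : ∃ v, orbPow (j y) m a = j (v * ϖ ^ (t * ceilQuot a m)) := by
  by_cases hm : m = 1
  · exact ⟨1, by rw [orbPow, if_pos hm, ht hm, zero_mul, pow_zero, one_mul, map_one]⟩
  · refine ⟨u ^ ceilQuot a m, ?_⟩
    rw [orbPow, if_neg hm, hy hm, ← map_pow, mul_pow, ← pow_mul, mul_comm]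

variable [LinearOrder ι] {n p : ℕ} {ε : Module.Basis ι L (Ω[L⁄k])}

section ProductsOfForms

lemma exists_formsBasis_repr_ιMulti_eq {v : Fin p → Ω[L⁄k]}
    (hv : ∀ q i, ε.repr (v q) i ∈ Set.range j) (K : Fin p ↪o ι) :
    ∃ r, (formsBasis ε p).repr (exteriorPower.ιMulti L p v) K = j r := by
  choose r hr using hv
  refine ⟨(Matrix.of fun q s ↦ r q (K s)).det, ?_⟩
  rw [formsBasis_repr_ιMulti, AlgHom.map_det]
  simp only [← hr]
  rfl

lemma exists_formsBasis_repr_ιMulti_eq_mul {v : Fin p → Ω[L⁄k]}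
    (hv : ∀ q i, ε.repr (v q) i ∈ Set.range j) {i₀ : ι} {ϖ : R}
    (hv₀ : ∀ q, ∃ r, ε.repr (v q) i₀ = j (ϖ * r)) {K : Fin p ↪o ι} (hK : i₀ ∈ Set.range K) :
    ∃ r, (formsBasis ε p).repr (exteriorPower.ιMulti L p v) K = j (r * ϖ) := by
  choose r hr using hv
  choose r₀ hr₀ using hv₀
  obtain ⟨s₀, hs₀⟩ := hK
  let A : Matrix (Fin p) (Fin p) R := .of fun q s ↦ if s = s₀ then r₀ q else r q (K s)
  have hdet := Matrix.det_mul_row (fun s ↦ if s = s₀ then ϖ else 1) A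
  rw [Finset.prod_ite_eq' Finset.univ s₀ fun _ ↦ ϖ, if_pos (Finset.mem_univ _)] at hdet
  refine ⟨A.det, ?_⟩
  rw [formsBasis_repr_ιMulti, mul_comm, ← hdet, AlgHom.map_det]
  congr 1
  ext q s
  by_cases hs : s = s₀
  · simp [A, hs, hs₀, hr₀]
  · simp [A, hs, hr]

variable [Finite ι] {v : Fin n → Fin p → Ω[L⁄k]}

lemma symCoord_prod_ι_mem_coeffLattice_one (hv : ∀ a q i, ε.repr (v a q) i ∈ Set.range j) :
    symCoord ε p (∏ a, SymForms.ι k L p (exteriorPower.ιMulti L p (v a))) ∈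
      coeffLattice (j : R →+* L) n fun _ ↦ 1 := by
  have := Fintype.ofFinite ι
  have hfactor (a : Fin n) : symCoord ε p (SymForms.ι k L p (exteriorPower.ιMulti L p (v a))) ∈
      coeffLattice (j : R →+* L) 1 fun _ ↦ (j : R →+* L) 1 ^ (0 - 0) := by
    rw [symCoord_ι]
    refine sum_C_mul_X_mem_coeffLattice fun K ↦ ?_
    obtain ⟨r, hr⟩ := exists_formsBasis_repr_ιMulti_eq (hv a) K
    exact ⟨r, by rw [hr, pow_zero, mul_one]; rfl⟩
  rw [map_prod]
  simpa using prod_mem_coeffLattice_pow Finset.univ 0 (fun _ ↦ 0) fun a _ ↦ hfactor a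

lemma symCoord_prod_ι_mem_coeffLattice_pow (hv : ∀ a q i, ε.repr (v a q) i ∈ Set.range j)
    (i₀ : ι) {ϖ : R} (S : Finset (Fin n))
    (hS : ∀ a ∉ S, ∀ q, ∃ r, ε.repr (v a q) i₀ = j (ϖ * r)) :
    symCoord ε p (∏ a, SymForms.ι k L p (exteriorPower.ιMulti L p (v a))) ∈
      coeffLattice (j : R →+* L) n fun μ ↦ j ϖ ^ (occ i₀ μ - S.card) := by
  have := Fintype.ofFinite ι
  have hfactor (a : Fin n) : symCoord ε p (SymForms.ι k L p (exteriorPower.ιMulti L p (v a))) ∈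
      coeffLattice (j : R →+* L) 1 fun μ ↦
        (j : R →+* L) ϖ ^ (occ i₀ μ - if a ∈ S then 1 else 0) := by
    rw [symCoord_ι]
    refine sum_C_mul_X_mem_coeffLattice fun K ↦ ?_
    rw [occ_single]
    by_cases h : a ∉ S ∧ i₀ ∈ Set.range K
    · obtain ⟨r, hr⟩ := exists_formsBasis_repr_ιMulti_eq_mul (hv a) (hS a h.1) h.2
      exact ⟨r, by rw [hr, if_neg h.1, if_pos h.2, pow_one, map_mul]; rfl⟩
    · obtain ⟨r, hr⟩ := exists_formsBasis_repr_ιMulti_eq (hv a) K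
      have hexp : (if i₀ ∈ Set.range K then 1 else 0) - (if a ∈ S then 1 else 0) = 0 := by
        split_ifs <;> tauto
      exact ⟨r, by rw [hr, hexp, pow_zero, mul_one]; rfl⟩
  rw [map_prod]
  simpa using prod_mem_coeffLattice_pow Finset.univ (occ i₀) _ fun a _ ↦ hfactor a

end ProductsOfForms

section Pullback

variable [Fintype ι] {x : ι → R} {b : Module.Basis ι R (Ω[R⁄k])}
  (hb : ∀ i, b i = KaehlerDifferential.D k R (x i)) (hx : ∀ i, j (x i) ≠ 0)
  (hε : ∀ i, ε i = (j (x i))⁻¹ • KaehlerDifferential.D k L (j (x i)))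
  {κ : Type*} [Fintype κ] [LinearOrder κ] {y : κ → R} {m' : κ → ℕ∞} {t : κ → ℕ} {u : κ → Rˣ}
  (ht : ∀ l, m' l = 1 → t l = 0)
include hb hx hε ht

theorem symCoord_orbGenerator_mem_coeffLattice_of_isUnit (hunit : ∀ i, IsUnit (x i))
    (mW : ι → ℕ∞) {ϖ : R} (hϖ : j ϖ ≠ 0) (hy : ∀ l, m' l ≠ 1 → y l = ϖ ^ t l * u l)
    (hle : ∀ l, t l ≠ 0 → m' l ≤ t l) (hm' : ∀ l, 1 ≤ m' l) (J : Fin n → (Fin p ↪o κ)) :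
    symCoord ε p (orbGenerator (fun l ↦ j (y l)) m' n p J) ∈
      coeffLattice (j : R →+* L) n fun μ ↦ ∏ i, j (x i) ^ ceilQuot (occ i μ) (mW i) := by
  let c : κ → L := fun l ↦ if t l = 0 then 1 else j ϖ
  have hpow (l : κ) (a : ℕ) : ∃ w, orbPow (j (y l)) (m' l) a = j w * c l ^ a := by
    obtain ⟨v, hv⟩ := exists_orbPow_eq (j := j) (hy l) (ht l) a
    by_cases h0 : t l = 0
    · exact ⟨v, by simp only [hv, c, h0, if_true, zero_mul, pow_zero, one_pow, mul_one]⟩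
    · have ha : a ≤ t l * ceilQuot a (m' l) := by
        refine (ceilQuot_one a).symm.trans_le ?_
        exact ceilQuot_le_mul (hm' l) (by rw [mul_one]; exact hle l h0) a
      obtain ⟨q, hq⟩ := pow_dvd_pow ϖ ha
      exact ⟨v * q, by simp only [hv, c, h0, if_false, hq, map_mul, map_pow]; ring⟩
  have hdiff (l : κ) (i : ι) : ε.repr (c l • orbDiff (j (y l)) (m' l)) i ∈ Set.range j := by
    obtain ⟨r, hr⟩ := exists_repr_orbDiff hb hx hε hϖ (hy l) (ht l)
    rw [map_smul, Finsupp.smul_apply, hr, smul_eq_mul]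
    by_cases h0 : t l = 0
    · exact ⟨_, by simp only [c, h0, if_true, one_mul, Nat.cast_zero, zero_mul, add_zero]; rfl⟩
    · refine ⟨ϖ * (x i * r i) + t l * (x i * b.repr (KaehlerDifferential.D k R ϖ) i), ?_⟩
      simp only [c, h0, if_false, map_add, map_mul, map_natCast]
      field_simp
  choose w hw using hpow
  have hprod := symCoord_prod_ι_mem_coeffLattice_one (ε := ε) (n := n) (p := p)
    fun a q i ↦ hdiff (J a q) i
  rw [orbGenerator, Finset.prod_congr rfl fun l _ ↦ hw l _, Finset.prod_mul_distrib, mul_smul,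
    ← prod_ι_ιMulti_smul J c fun l ↦ orbDiff (j (y l)) (m' l), map_smul, smul_eq_C_mul, ← map_prod]
  refine C_mul_mem_coeffLattice hprod fun μ ↦ ?_
  have hu : IsUnit (∏ i, x i ^ ceilQuot (occ i μ) (mW i)) :=
    IsUnit.prod_univ_iff.2 fun i ↦ (hunit i).pow _
  obtain ⟨z, hz⟩ := hu.dvd (a := ∏ l, w l (Nat.card {a : Fin n // l ∈ Set.range (J a)}))
  exact ⟨z, by rw [mul_one, hz, mul_comm, map_mul]; simp only [map_prod, map_pow, RingHom.coe_coe]⟩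

theorem symCoord_orbGenerator_mem_coeffLattice_of_branch {i₀ : ι}
    (hunit : ∀ i, i ≠ i₀ → IsUnit (x i)) {m : ℕ∞} (hm : 1 ≤ m) {mW : ι → ℕ∞} (hmW : m ≤ mW i₀)
    (hy : ∀ l, m' l ≠ 1 → y l = x i₀ ^ t l * u l) (hle : ∀ l, t l ≠ 0 → m' l ≤ t l * m)
    (hm' : ∀ l, 1 ≤ m' l) (J : Fin n → (Fin p ↪o κ)) :
    symCoord ε p (orbGenerator (fun l ↦ j (y l)) m' n p J) ∈
      coeffLattice (j : R →+* L) n fun μ ↦ ∏ i, j (x i) ^ ceilQuot (occ i μ) (mW i) := by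
  let S := Finset.univ.filter fun a ↦ ∃ q, t (J a q) ≠ 0
  have hD (i : ι) : j (x i * b.repr (KaehlerDifferential.D k R (x i₀)) i) / j (x i₀) =
      if i = i₀ then 1 else 0 := by
    rw [← hb, Module.Basis.repr_self]
    rcases eq_or_ne i i₀ with rfl | h
    · rw [Finsupp.single_eq_same, mul_one, div_self (hx i), if_pos rfl]
    · rw [Finsupp.single_eq_of_ne h, mul_zero, map_zero, zero_div, if_neg h]
  choose c hc using fun l ↦ exists_repr_orbDiff hb hx hε (hx i₀) (hy l) (ht l)
  simp only [hD] at hc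
  choose v hv using fun l a ↦ exists_orbPow_eq (j := j) (hy l) (ht l) a
  have hprod := symCoord_prod_ι_mem_coeffLattice_pow (ε := ε) (j := j) (p := p)
    (v := fun a q ↦ orbDiff (j (y (J a q))) (m' (J a q)))
    (fun a q i ↦ ⟨x i * c (J a q) i + t (J a q) * if i = i₀ then 1 else 0, by
      rw [hc, map_add, map_mul, map_mul, map_natCast, apply_ite j, map_one, map_zero]⟩)
    i₀ (ϖ := x i₀) S fun a ha q ↦ by
      have h0 : t (J a q) = 0 := by
        by_contra h
        exact ha (Finset.mem_filter.2 ⟨Finset.mem_univ a, q, h⟩)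
      exact ⟨c (J a q) i₀, by rw [hc, h0, Nat.cast_zero, zero_mul, add_zero]⟩
  rw [orbGenerator, Finset.prod_congr rfl fun l _ ↦ hv l _, map_smul, smul_eq_C_mul]
  refine C_mul_mem_coeffLattice hprod fun μ ↦ ?_
  let s := ∑ l, t l * ceilQuot (Nat.card {a : Fin n // l ∈ Set.range (J a)}) (m' l)
  have hexp : ceilQuot (occ i₀ μ) (mW i₀) ≤ s + (occ i₀ μ - S.card) := by
    calc ceilQuot (occ i₀ μ) (mW i₀) ≤ ceilQuot (occ i₀ μ) m := ceilQuot_anti hm hmW _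
      _ ≤ ceilQuot (S.card + (occ i₀ μ - S.card)) m := ceilQuot_mono hm (by omega)
      _ ≤ ceilQuot S.card m + ceilQuot (occ i₀ μ - S.card) m := ceilQuot_add_le hm _ _
      _ ≤ s + (occ i₀ μ - S.card) :=
        add_le_add (ceilQuot_card_filter_le J hm hm' hle) (ceilQuot_le_self hm _)
  obtain ⟨z, hz⟩ := prod_pow_dvd_pow hunit (e := fun i ↦ ceilQuot (occ i μ) (mW i)) hexp
  refine ⟨(∏ l, v l (Nat.card {a : Fin n // l ∈ Set.range (J a)})) * z, ?_⟩
  simp only [← map_prod, ← map_pow, RingHom.coe_coe, ← map_mul]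
  rw [Finset.prod_mul_distrib, Finset.prod_pow_eq_pow_sum, mul_assoc, ← pow_add, hz, mul_assoc,
    mul_comm z]

end Pullback

end OrbGenerator

/-! ### Étale coordinates -/

section EtaleCoordinates

open TensorProduct KaehlerDifferential

theorem exists_basis_of_formallyEtale {k A B : Type u} [CommRing k] [CommRing A] [CommRing B]
    [Algebra k A] [Algebra k B] {ι : Type*} (φ : A →ₐ[k] B) (hφ : φ.toRingHom.FormallyEtale)
    (b : Module.Basis ι A (Ω[A⁄k])) :
    ∃ b' : Module.Basis ι B (Ω[B⁄k]), ∀ i, b' i = diffMap φ (b i) := by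
  let _ : Algebra A B := φ.toRingHom.toAlgebra
  have : IsScalarTower k A B := IsScalarTower.of_algebraMap_eq' φ.comp_algebraMap.symm
  have : Algebra.FormallyEtale A B := hφ
  refine ⟨(b.baseChange B).map (tensorKaehlerEquivOfFormallyEtale k A B), fun i ↦ ?_⟩
  rw [Module.Basis.map_apply, Module.Basis.baseChange_apply,
    tensorKaehlerEquivOfFormallyEtale_apply, mapBaseChange_tmul, one_smul]
  rfl

theorem exists_basis_of_isLocalization {k A : Type u} (S : Type u) [CommRing k] [CommRing A]
    [CommRing S] [Algebra k A] [Algebra k S] [Algebra A S] [IsScalarTower k A S] (M : Submonoid A)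
    [IsLocalization M S] {ι : Type*} (b : Module.Basis ι A (Ω[A⁄k])) :
    ∃ b' : Module.Basis ι S (Ω[S⁄k]), ∀ i, b' i = diffMap (IsScalarTower.toAlgHom k A S) (b i) :=
  exists_basis_of_formallyEtale _
    (RingHom.formallyEtale_algebraMap.2 (Algebra.FormallyEtale.of_isLocalization M)) b

section IsEssentiallyEtale

variable {A B : Type u} [CommRing A] [CommRing B] [Algebra A B]

variable (A B) in
/-- `B` is a localization of an étale `A`-algebra. -/
def IsEssentiallyEtale : Prop :=
  ∃ (C : Type u) (_ : CommRing C) (_ : Algebra A C) (_ : Algebra C B) (M : Submonoid C),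
    Algebra.Etale A C ∧ IsLocalization M B ∧ IsScalarTower A C B

namespace IsEssentiallyEtale

theorem formallyEtale (h : IsEssentiallyEtale A B) : Algebra.FormallyEtale A B := by
  obtain ⟨C, _, _, _, M, _, _, _⟩ := h
  have : Algebra.FormallyEtale C B := Algebra.FormallyEtale.of_isLocalization M
  exact Algebra.FormallyEtale.comp A C B

theorem isNoetherianRing [IsNoetherianRing A] (h : IsEssentiallyEtale A B) :
    IsNoetherianRing B := by
  obtain ⟨C, _, _, _, M, _, _, _⟩ := h
  exact IsLocalization.isNoetherianRing M B (Algebra.FiniteType.isNoetherianRing A C)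

theorem isDomain_and_isIntegrallyClosed [IsDomain A] [IsIntegrallyClosed A] [IsLocalRing B]
    (h : IsEssentiallyEtale A B) : IsDomain B ∧ IsIntegrallyClosed B := by
  obtain ⟨C, _, _, _, M, _, _, _⟩ := h
  exact isDomain_and_isIntegrallyClosed_of_etale (A := A) M

theorem tensorProduct (A' : Type u) [CommRing A'] [Algebra A A'] (h : IsEssentiallyEtale A B) :
    IsEssentiallyEtale A' (A' ⊗[A] B) := by
  obtain ⟨C, _, _, _, M, _, _, _⟩ := h
  let ψ : A' ⊗[A] C →ₐ[A'] A' ⊗[A] B :=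
    Algebra.TensorProduct.map (AlgHom.id A' A') (IsScalarTower.toAlgHom A C B)
  let _ : Algebra (A' ⊗[A] C) (A' ⊗[A] B) := ψ.toAlgebra
  exact ⟨A' ⊗[A] C, inferInstance, inferInstance, inferInstance,
    M.map Algebra.TensorProduct.includeRight, inferInstance,
    IsLocalization.tensorProduct_tensorProduct_right A A' M B
      (by ext; simp [ψ, RingHom.algebraMap_toAlgebra]),
    .of_algebraMap_eq' ψ.comp_algebraMap.symm⟩

theorem isPrime_map [IsLocalRing B] (h : IsEssentiallyEtale A B) {I : Ideal A} [IsDomain (A ⧸ I)]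
    [IsIntegrallyClosed (A ⧸ I)] (hI : I.map (algebraMap A B) ≠ ⊤) :
    (I.map (algebraMap A B)).IsPrime := by
  have : Nontrivial (B ⧸ I.map (algebraMap A B)) := Ideal.Quotient.nontrivial_iff.2 hI
  have : IsLocalRing (B ⧸ I.map (algebraMap A B)) :=
    .of_surjective' _ Ideal.Quotient.mk_surjective
  let e := Algebra.TensorProduct.quotIdealMapEquivQuotTensor B I
  have : IsLocalRing ((A ⧸ I) ⊗[A] B) := e.toRingEquiv.isLocalRing
  have := (h.tensorProduct (A ⧸ I)).isDomain_and_isIntegrallyClosed.1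
  rw [← Ideal.Quotient.isDomain_iff_prime]
  exact e.toMulEquiv.isDomain _

end IsEssentiallyEtale

end IsEssentiallyEtale

lemma isDomain_and_isIntegrallyClosed_quotient_span_X (k : Type*) [Field k] {σ : Type*} (i : σ) :
    IsDomain (MvPolynomial σ k ⧸ Ideal.span {(MvPolynomial.X i : MvPolynomial σ k)}) ∧
      IsIntegrallyClosed (MvPolynomial σ k ⧸
        Ideal.span {(MvPolynomial.X i : MvPolynomial σ k)}) := by
  classical
  let A := MvPolynomial {a : σ // a ≠ i} k
  let e₁ : MvPolynomial σ k ≃ₐ[k] Polynomial A :=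
    (MvPolynomial.renameEquiv k (Equiv.optionSubtypeNe i).symm).trans
      (MvPolynomial.optionEquivLeft k {a : σ // a ≠ i})
  have hX : e₁ (MvPolynomial.X i) = Polynomial.X :=
    (congr_arg (MvPolynomial.optionEquivLeft k _) ((MvPolynomial.rename_X _ _).trans
      (congr_arg _ (Equiv.optionSubtypeNe_symm_self i)))).trans
        (MvPolynomial.optionEquivLeft_X_none k _)
  have he₁ : Ideal.span {Polynomial.X - Polynomial.C (0 : A)} =
      (Ideal.span {(MvPolynomial.X i : MvPolynomial σ k)}).map (e₁.toRingEquiv : _ →+* _) := by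
    rw [Ideal.map_span, Set.image_singleton, map_zero, sub_zero, ← hX]
    rfl
  let e := (Ideal.quotientEquiv _ _ e₁.toRingEquiv he₁).trans
    (Polynomial.quotientSpanXSubCAlgEquiv (0 : A)).toRingEquiv
  exact ⟨e.toMulEquiv.isDomain _, IsIntegrallyClosed.of_equiv e.symm⟩

/-- The elements `x_i` of `B` are local coordinates: they define a morphism `k[X_i] → B` which is
a localization of an étale one. -/
def HasEtaleCoordinates (k : Type u) {B : Type u} [CommRing k] [CommRing B] [Algebra k B]
    {ι : Type} (x : ι → B) : Prop :=
  @IsEssentiallyEtale (MvPolynomial ι k) B _ _ (MvPolynomial.aeval x).toAlgebra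

namespace HasEtaleCoordinates

variable {k B : Type u} [CommRing B] {ι : Type} {x : ι → B}

section CommRing

variable [CommRing k] [Algebra k B]

theorem formallyEtale (h : HasEtaleCoordinates k x) :
    (MvPolynomial.aeval (R := k) x).toRingHom.FormallyEtale :=
  let _ := (MvPolynomial.aeval (R := k) x).toAlgebra
  IsEssentiallyEtale.formallyEtale h

theorem exists_basis (h : HasEtaleCoordinates k x) :
    ∃ b : Module.Basis ι B (Ω[B⁄k]), ∀ i, b i = D k B (x i) := by
  obtain ⟨b, hb⟩ := exists_basis_of_formallyEtale _ h.formallyEtale (mvPolynomialBasis k ι)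
  exact ⟨b, fun i ↦ by rw [hb, mvPolynomialBasis_apply, diffMap_D, MvPolynomial.aeval_X]⟩

lemma ne_zero [Nontrivial B] (h : HasEtaleCoordinates k x) (i : ι) : x i ≠ 0 := by
  obtain ⟨b, hb⟩ := h.exists_basis
  intro hi
  exact b.ne_zero i (by rw [hb, hi, map_zero])

theorem formallySmooth (h : HasEtaleCoordinates k x) : Algebra.FormallySmooth k B := by
  let _ := (MvPolynomial.aeval (R := k) x).toAlgebra
  have : IsScalarTower k (MvPolynomial ι k) B :=
    .of_algebraMap_eq' (MvPolynomial.aeval (R := k) x).comp_algebraMap.symm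
  have : Algebra.FormallyEtale (MvPolynomial ι k) B := h.formallyEtale
  exact Algebra.FormallySmooth.comp k (MvPolynomial ι k) B

theorem isNoetherianRing [IsNoetherianRing k] [Finite ι] (h : HasEtaleCoordinates k x) :
    IsNoetherianRing B :=
  let _ := (MvPolynomial.aeval (R := k) x).toAlgebra
  IsEssentiallyEtale.isNoetherianRing h

end CommRing

variable [Field k] [Algebra k B] [IsLocalRing B]

theorem isDomain_and_isIntegrallyClosed (h : HasEtaleCoordinates k x) :
    IsDomain B ∧ IsIntegrallyClosed B :=
  let _ := (MvPolynomial.aeval (R := k) x).toAlgebra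
  IsEssentiallyEtale.isDomain_and_isIntegrallyClosed h

theorem isPrime_span_singleton (h : HasEtaleCoordinates k x) {i : ι} (hi : ¬ IsUnit (x i)) :
    (Ideal.span {x i}).IsPrime := by
  let _ := (MvPolynomial.aeval (R := k) x).toAlgebra
  obtain ⟨_, _⟩ := isDomain_and_isIntegrallyClosed_quotient_span_X k i
  have hmap : (Ideal.span {(MvPolynomial.X i : MvPolynomial ι k)}).map
      (algebraMap (MvPolynomial ι k) B) = Ideal.span {x i} := by
    rw [Ideal.map_span, Set.image_singleton]
    congr 2
    exact MvPolynomial.aeval_X _ _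
  rw [← hmap]
  refine IsEssentiallyEtale.isPrime_map h ?_
  rwa [hmap, ne_eq, Ideal.span_singleton_eq_top]

end HasEtaleCoordinates

section SmoothQuotient

variable {k B : Type u} [Field k] [CommRing B] [Algebra k B] [IsLocalRing B]
  [Algebra.FormallySmooth k B] (I : Ideal B) [Algebra.FormallySmooth k (B ⧸ I)]

/-- As the conormal sequence of `B → B/I` is split, `h` vanishes in `I/𝔪I` as soon as `dh` vanishes
modulo `𝔪`. -/
theorem mem_maximalIdeal_smul_of_D_mem (hI : I ≠ ⊤) {h : B} (hh : h ∈ I)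
    (hD : D k B h ∈ IsLocalRing.maximalIdeal B • (⊤ : Submodule B (Ω[B⁄k]))) :
    h ∈ IsLocalRing.maximalIdeal B • I := by
  let I' := RingHom.ker (algebraMap B (B ⧸ I))
  have hker : I' = I := Ideal.mk_ker
  obtain ⟨l, hl⟩ := (Algebra.FormallySmooth.iff_split_injection (R := k) (P := B) (A := B ⧸ I)
    Ideal.Quotient.mk_surjective).1 inferInstance
  let f : (Ω[B⁄k]) →ₗ[B] I'.Cotangent := l ∘ₗ TensorProduct.mk B (B ⧸ I) (Ω[B⁄k]) 1
  let h' : I' := ⟨h, hker.symm ▸ hh⟩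
  have hfh : f (D k B h) = Ideal.toCotangent _ h' := congr($hl (Ideal.toCotangent _ h'))
  have hcot : Ideal.toCotangent _ h' ∈
      (IsLocalRing.maximalIdeal B • (⊤ : Submodule B I')).map (Ideal.toCotangent I') := by
    have hf := Submodule.mem_map_of_mem (f := f) hD
    rw [Submodule.map_smul'', hfh] at hf
    rw [Submodule.map_smul'', Submodule.map_top,
      LinearMap.range_eq_top.2 (Ideal.toCotangent_surjective _)]
    exact Submodule.smul_mono le_rfl le_top hf
  obtain ⟨g, hg, hgh⟩ := hcot
  have hgI : (g : B) ∈ IsLocalRing.maximalIdeal B • I := by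
    have hsub := Submodule.mem_map_of_mem (f := I'.subtype) hg
    rw [Submodule.map_smul'', Submodule.map_top, Submodule.range_subtype] at hsub
    exact Submodule.smul_mono le_rfl hker.le hsub
  have hsq : I ^ 2 ≤ IsLocalRing.maximalIdeal B • I := by
    rw [pow_two, smul_eq_mul]
    exact Ideal.mul_mono_left (IsLocalRing.le_maximalIdeal hI)
  have hgh' := hsq (Ideal.pow_right_mono hker.le 2 ((Ideal.toCotangent_eq _).1 hgh))
  simpa only [sub_sub_cancel] using sub_mem hgI hgh'

end SmoothQuotient

theorem mem_of_formallySmooth_quotient (k : Type u) {B : Type u} [Field k] [CommRing B]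
    [Algebra k B] [IsLocalRing B] [IsNoetherianRing B] [Algebra.FormallySmooth k B] (I : Ideal B)
    [Algebra.FormallySmooth k (B ⧸ I)] (hI0 : I ≠ ⊥) {y : B}
    (hy : ¬ IsUnit y) (hIy : I ≤ Ideal.span {y}) : y ∈ I := by
  by_contra hyI
  have hItop : I ≠ ⊤ := by
    rintro rfl
    exact hyI Submodule.mem_top
  refine hI0 (Submodule.eq_bot_of_le_smul_of_le_jacobson_bot (IsLocalRing.maximalIdeal B) I
    (IsNoetherian.noetherian I) (fun h hh ↦ ?_) (IsLocalRing.maximalIdeal_le_jacobson _))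
  refine mem_maximalIdeal_smul_of_D_mem (k := k) I hItop hh ?_
  obtain ⟨b, rfl⟩ := Ideal.mem_span_singleton'.1 (hIy hh)
  have hb : b ∈ IsLocalRing.maximalIdeal B := by
    intro hb
    exact hyI ((Ideal.unit_mul_mem_iff_mem I hb).1 hh)
  rw [Derivation.leibniz]
  exact add_mem (Submodule.smul_mem_smul hb Submodule.mem_top)
    (Submodule.smul_mem_smul hy Submodule.mem_top)

theorem formallySmooth_quotient_map {k A B : Type u} [CommRing k] [CommRing A] [CommRing B]
    [Algebra k A] [Algebra k B] [Algebra A B] [IsScalarTower k A B] [Algebra.FormallySmooth A B]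
    (I : Ideal A) [Algebra.FormallySmooth k (A ⧸ I)] :
    Algebra.FormallySmooth k (B ⧸ I.map (algebraMap A B)) := by
  have : Algebra.FormallySmooth (A ⧸ I) (B ⧸ I.map (algebraMap A B)) :=
    .of_equiv (Algebra.TensorProduct.quotIdealMapEquivQuotTensor B I).symm
  have : IsScalarTower k (A ⧸ I) (B ⧸ I.map (algebraMap A B)) := .of_algebraMap_eq fun a ↦
    congr_arg (Ideal.Quotient.mk _) (IsScalarTower.algebraMap_apply k A B a)
  exact Algebra.FormallySmooth.comp k (A ⧸ I) _

end EtaleCoordinates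

/-! ### Pullback to a discrete valuation ring -/

section Lifting

section Span

variable {k B S L : Type u} [CommRing k] [CommRing B] [CommRing S] [Field L] [Algebra k S]
  [Algebra k L] {p : ℕ} {s : Set (SymForms k S p)}

lemma symFormsMap_mem_span_image (i : B →+* S) (φ : S →ₐ[k] L) {τ : SymForms k S p}
    (hτ : τ ∈ Submodule.span i.range s) :
    symFormsMap p φ τ ∈ Submodule.span ((φ : S →+* L).comp i).range (symFormsMap p φ '' s) := by
  induction hτ using Submodule.span_induction with
  | mem τ h => exact Submodule.subset_span ⟨τ, h, rfl⟩
  | zero => rw [map_zero]; exact zero_mem _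
  | add τ τ' _ _ h h' => rw [map_add]; exact add_mem h h'
  | smul r τ _ h =>
    obtain ⟨_, r, rfl⟩ := r
    rw [Subring.smul_def, symFormsMap_smul]
    exact Submodule.smul_mem _ (⟨_, r, rfl⟩ : ((φ : S →+* L).comp i).range) h

lemma exists_mem_span_symFormsMap_eq (i : B →+* S) (φ : S →ₐ[k] L) {ω : SymForms k L p}
    (hω : ω ∈ Submodule.span ((φ : S →+* L).comp i).range (symFormsMap p φ '' s)) :
    ∃ τ ∈ Submodule.span i.range s, symFormsMap p φ τ = ω := by
  induction hω using Submodule.span_induction with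
  | mem ω h =>
    obtain ⟨τ, hτ, rfl⟩ := h
    exact ⟨τ, Submodule.subset_span hτ, rfl⟩
  | zero => exact ⟨0, zero_mem _, map_zero _⟩
  | add ω ω' _ _ h h' =>
    obtain ⟨τ, hτ, rfl⟩ := h
    obtain ⟨τ', hτ', rfl⟩ := h'
    exact ⟨τ + τ', add_mem hτ hτ', map_add _ _ _⟩
  | smul r ω _ h =>
    obtain ⟨τ, hτ, rfl⟩ := h
    obtain ⟨_, r, rfl⟩ := r
    exact ⟨i r • τ, Submodule.smul_mem _ (⟨_, r, rfl⟩ : i.range) hτ, symFormsMap_smul p _ _ _⟩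

end Span

variable {k B S KB L : Type u} [CommRing k] [CommRing B] [IsDomain B] [CommRing S] [Field KB]
  [Field L] [Algebra k B] [Algebra k S] [Algebra k KB] [Algebra k L] [Algebra B S] [Algebra B KB]
  [IsScalarTower k B S] [IsScalarTower k B KB] [IsFractionRing B KB]
  {κ : Type} [Fintype κ] [LinearOrder κ] {y : κ → B} {m : κ → ℕ∞} {n p : ℕ}

theorem symFormsMap_mem_span_orbGenerator_of_isLocalization [Algebra S KB] [IsScalarTower k S KB]
    [IsScalarTower B S KB] (M : Submonoid B) [IsLocalization M S] (hy : HasEtaleCoordinates k y)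
    (hm : ∀ l, m l ≠ 1 → IsUnit (algebraMap B S (y l))) (β : S →ₐ[k] L) {τ : SymForms k S p}
    (hτ : symFormsMap p (IsScalarTower.toAlgHom k S KB) τ ∈ Submodule.span (algebraMap B KB).range
      (Set.range (logGenerator (k := k) (fun l ↦ algebraMap B KB (y l)) m n p))) :
    symFormsMap p β τ ∈ Submodule.span ((β : S →+* L).comp (algebraMap B S)).range
      (Set.range (orbGenerator (k := k) (fun l ↦ β (algebraMap B S (y l))) m n p)) := by
  obtain ⟨b, -⟩ := hy.exists_basis
  let i := IsScalarTower.toAlgHom k B S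
  let j := IsScalarTower.toAlgHom k S KB
  have hij : j.comp i = IsScalarTower.toAlgHom k B KB :=
    AlgHom.ext fun a ↦ (IsScalarTower.algebraMap_apply B S KB a).symm
  have hj : Function.Injective j := by
    have := IsFractionRing.isFractionRing_of_isDomain_of_isLocalization M S KB
    exact IsFractionRing.injective S KB
  obtain ⟨bS, hbS⟩ := exists_basis_of_isLocalization S M b
  obtain ⟨bK, hbK⟩ := exists_basis_of_isLocalization KB (nonZeroDivisors B) b
  have hrange {F : Type u} [Field F] [Algebra k F] (φ : S →ₐ[k] F) :
      Set.range (orbGenerator (k := k) (fun l ↦ φ (algebraMap B S (y l))) m n p) =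
        symFormsMap p φ '' Set.range (orbGenerator (fun l ↦ algebraMap B S (y l)) m n p) := by
    rw [← Set.range_comp]
    exact congr_arg _ (funext fun J ↦ (symFormsMap_orbGenerator J φ hm).symm)
  have hgen : logGenerator (k := k) (fun l ↦ algebraMap B KB (y l)) m n p =
      orbGenerator (fun l ↦ j (algebraMap B S (y l))) m n p := by
    funext J
    rw [logGenerator_eq_orbGenerator J fun l ↦
      (map_ne_zero_iff _ (IsFractionRing.injective B KB)).2 (hy.ne_zero l)]
    exact congr_arg (orbGenerator · m n p J) (funext fun l ↦ congr($hij (y l)).symm)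
  rw [hgen, hrange j, IsScalarTower.algebraMap_eq B S KB] at hτ
  obtain ⟨τ', hτ', heq⟩ := exists_mem_span_symFormsMap_eq (algebraMap B S) j hτ
  have hτeq : τ' = τ := symFormsMap_injective p
    (fun l ↦ by rw [hbS, hbK, ← diffMap_comp, hij]) hj heq
  rw [hrange β]
  exact symFormsMap_mem_span_image _ β (hτeq ▸ hτ')

/-- The point of `Spec B` below `β` may be a proper specialization of the generic one, whereas the
generators are given over `KB`; so one passes to the localization `S` of `B` at `ker β`, where the
`y_l` of multiplicity `≠ 1` are units. -/
theorem symFormsMap_mem_span_orbGenerator {A Aξ : Type u} [CommRing A] [CommRing Aξ] [Algebra k A]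
    [Algebra k Aξ] [Algebra A Aξ] [IsScalarTower k A Aξ] (N : Submonoid A) [IsLocalization N Aξ]
    (φ : A →ₐ[k] B) (σ : Aξ →ₐ[k] KB) (θ : Aξ →ₐ[k] L) (β : B →ₐ[k] L)
    (hσ : ∀ a, σ (algebraMap A Aξ a) = algebraMap B KB (φ a))
    (hθ : ∀ a, θ (algebraMap A Aξ a) = β (φ a)) (hy : HasEtaleCoordinates k y)
    (hm : ∀ l, m l ≠ 1 → β (y l) ≠ 0) {τ : SymForms k Aξ p}
    (hτ : symFormsMap p σ τ ∈ Submodule.span (algebraMap B KB).range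
      (Set.range (logGenerator (k := k) (fun l ↦ algebraMap B KB (y l)) m n p))) :
    symFormsMap p θ τ ∈ Submodule.span (β : B →+* L).range
      (Set.range (orbGenerator (k := k) (fun l ↦ β (y l)) m n p)) := by
  let q : Ideal B := RingHom.ker (β : B →+* L)
  have : q.IsPrime := RingHom.ker_isPrime _
  let S := Localization.AtPrime q
  let _ : Algebra S KB := IsLocalization.localizationAlgebraOfSubmonoidLe S KB q.primeCompl _
    q.primeCompl_le_nonZeroDivisors
  have : IsScalarTower B S KB := IsLocalization.localization_isScalarTower_of_submonoid_le S KB _ _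
    q.primeCompl_le_nonZeroDivisors
  have : IsScalarTower k S KB := .to₁₃₄ k B S KB
  have hunit {s : B} (hs : β s ≠ 0) : IsUnit (algebraMap B S s) :=
    IsLocalization.map_units S (⟨s, hs⟩ : q.primeCompl)
  let βS : S →ₐ[k] L := IsLocalization.liftAlgHom (M := q.primeCompl) (f := β)
    fun s ↦ IsUnit.mk0 (β s) s.2
  have hβS (s : B) : βS (algebraMap B S s) = β s := IsLocalization.lift_eq _ s
  let ψ : Aξ →ₐ[k] S := IsLocalization.liftAlgHom (M := N)
    (f := (IsScalarTower.toAlgHom k B S).comp φ) fun a ↦ hunit <|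
      ne_of_eq_of_ne (hθ a).symm ((IsLocalization.map_units Aξ a).map θ).ne_zero
  have hψ (a : A) : ψ (algebraMap A Aξ a) = algebraMap B S (φ a) := IsLocalization.lift_eq _ a
  have hψσ : (IsScalarTower.toAlgHom k S KB).comp ψ = σ :=
    AlgHom.coe_ringHom_injective <| IsLocalization.ringHom_ext N <| RingHom.ext fun a ↦
      (congr_arg (algebraMap S KB) (hψ a)).trans <|
        (IsScalarTower.algebraMap_apply B S KB _).symm.trans (hσ a).symm
  have hψθ : βS.comp ψ = θ :=
    AlgHom.coe_ringHom_injective <| IsLocalization.ringHom_ext N <| RingHom.ext fun a ↦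
      (congr_arg βS (hψ a)).trans <| (hβS _).trans (hθ a).symm
  rw [← hψσ, symFormsMap_comp] at hτ
  have hmem := symFormsMap_mem_span_orbGenerator_of_isLocalization q.primeCompl hy
    (fun l hl ↦ hunit (hm l hl)) βS hτ
  have hβ : (βS : S →+* L).comp (algebraMap B S) = β := RingHom.ext hβS
  rw [← symFormsMap_comp, hψθ, hβ] at hmem
  simpa only [hβS] using hmem

end Lifting

section FaithfullyFlatDescent

variable {O R K L σ : Type*} [CommRing O] [CommRing R] [IsDomain O] [Field K] [Field L]
  [Algebra O R] [Module.FaithfullyFlat O R] [Algebra O K] [IsFractionRing O K]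
  {j : R →+* L} (hj : Function.Injective j) (κ : K →+* L)
  (hκ : ∀ a, κ (algebraMap O K a) = j (algebraMap O R a))
include hj hκ

lemma exists_eq_mul_of_map_eq_mul {x : K} {e : O} {r : R} (h : κ x = j r * j (algebraMap O R e)) :
    ∃ r, x = algebraMap O K r * algebraMap O K e := by
  obtain ⟨a, s, hs, rfl⟩ := IsFractionRing.div_surjective (A := O) x
  have hs0 : algebraMap O K s ≠ 0 :=
    (map_ne_zero_iff _ (IsFractionRing.injective O K)).2 (nonZeroDivisors.ne_zero hs)
  have hR : algebraMap O R a = algebraMap O R (s * e) * r := by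
    refine hj ?_
    rw [map_div₀, div_eq_iff ((map_ne_zero κ).2 hs0), hκ, hκ] at h
    rw [h, map_mul, map_mul, map_mul]
    ring
  have hO : a ∈ Ideal.span {s * e} := by
    rw [← Ideal.comap_map_eq_self_of_faithfullyFlat (B := R) (Ideal.span {s * e}),
      Ideal.mem_comap, Ideal.map_span, Set.image_singleton, hR]
    exact Ideal.mul_mem_right _ _ (Ideal.mem_span_singleton_self _)
  obtain ⟨t, rfl⟩ := Ideal.mem_span_singleton'.1 hO
  refine ⟨t, ?_⟩
  rw [div_eq_iff hs0, map_mul, map_mul]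
  ring

theorem mem_coeffLattice_of_faithfullyFlat {n : ℕ} {e : (σ →₀ ℕ) → O} {P : MvPolynomial σ K}
    (h : MvPolynomial.map κ P ∈ coeffLattice j n fun μ ↦ j (algebraMap O R (e μ))) :
    P ∈ coeffLattice (algebraMap O K) n fun μ ↦ algebraMap O K (e μ) := by
  refine ⟨.of_map κ.injective h.1, fun μ ↦ ?_⟩
  obtain ⟨r, hr⟩ := h.2 μ
  rw [MvPolynomial.coeff_map] at hr
  exact exists_eq_mul_of_map_eq_mul hj κ hκ hr

end FaithfullyFlatDescent

section Domination

open TensorProduct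

variable (k A O B : Type u) [CommRing k] [CommRing A] [CommRing O] [CommRing B] [IsLocalRing A]
  [IsLocalRing O] [IsLocalRing B] [IsNoetherianRing O] [Algebra k A] [Algebra k O] [Algebra k B]
  [Algebra A O] [Algebra A B] [IsScalarTower k A O] [IsScalarTower k A B]

theorem exists_etale_domination [IsLocalHom (algebraMap A B)] [Module.Flat A B]
    [Algebra.FormallyEtale A B] [Algebra.EssFiniteType A B] :
    ∃ (R : Type u) (_ : CommRing R) (_ : IsLocalRing R) (_ : IsNoetherianRing R) (_ : Algebra k R)
      (_ : Algebra O R) (_ : IsScalarTower k O R) (β : B →ₐ[k] R),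
      (∀ a, β (algebraMap A B a) = algebraMap O R (algebraMap A O a)) ∧
      Module.FaithfullyFlat O R ∧ Algebra.FormallyEtale O R ∧
      (IsLocalRing.maximalIdeal O).map (algebraMap O R) = IsLocalRing.maximalIdeal R := by
  have : Module.FaithfullyFlat A B := Module.FaithfullyFlat.of_flat_of_isLocalHom
  obtain ⟨N, hN⟩ := PrimeSpectrum.comap_surjective_of_faithfullyFlat (A := O) (B := O ⊗[A] B)
    (IsLocalRing.closedPoint O)
  let R := Localization.AtPrime N.asIdeal
  have hRN : (IsLocalRing.maximalIdeal R).comap (algebraMap (O ⊗[A] B) R) = N.asIdeal :=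
    IsLocalization.AtPrime.under_maximalIdeal R N.asIdeal
  have hNO : N.asIdeal.comap (algebraMap O (O ⊗[A] B)) = IsLocalRing.maximalIdeal O :=
    congr_arg PrimeSpectrum.asIdeal hN
  have hlocal : IsLocalHom (algebraMap O R) := by
    refine ((IsLocalRing.local_hom_TFAE (algebraMap O R)).out 0 2).2 ?_
    rw [Ideal.map_le_iff_le_comap, IsScalarTower.algebraMap_eq O (O ⊗[A] B) R,
      ← Ideal.comap_comap, hRN, hNO]
  have hflat : Module.Flat O R := by
    have : Module.Flat (O ⊗[A] B) R := IsLocalization.flat R N.asIdeal.primeCompl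
    exact Module.Flat.trans O (O ⊗[A] B) R
  have hess : Algebra.EssFiniteType O R := inferInstance
  have hetale : Algebra.FormallyEtale O R := inferInstance
  let β : B →ₐ[k] R := (IsScalarTower.toAlgHom k (O ⊗[A] B) R).comp
    ((Algebra.TensorProduct.includeRight : B →ₐ[A] O ⊗[A] B).restrictScalars k)
  refine ⟨R, inferInstance, inferInstance, Algebra.EssFiniteType.isNoetherianRing O R,
    inferInstance, inferInstance, inferInstance, β, fun a ↦ ?_, .of_flat_of_isLocalHom, hetale,
    Algebra.FormallyUnramified.map_maximalIdeal⟩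
  change algebraMap (O ⊗[A] B) R (1 ⊗ₜ algebraMap A B a) = _
  rw [IsScalarTower.algebraMap_apply O (O ⊗[A] B) R, Algebra.TensorProduct.algebraMap_apply,
    ← Algebra.TensorProduct.tmul_one_eq_one_tmul]
  rfl

end Domination

section LocalPullback

open KaehlerDifferential Orbifold.Chart

section LogBasis

lemma exists_log_basis {k K : Type u} [CommRing k] [Field K] [Algebra k K] {ι : Type*} {x : ι → K}
    {b : Module.Basis ι K (Ω[K⁄k])} (hb : ∀ i, b i = D k K (x i)) (hx : ∀ i, x i ≠ 0) :
    ∃ ε : Module.Basis ι K (Ω[K⁄k]), ∀ i, ε i = (x i)⁻¹ • D k K (x i) :=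
  ⟨b.isUnitSMul fun i ↦ (inv_ne_zero (hx i)).isUnit, fun i ↦ by
    rw [Module.Basis.isUnitSMul_apply, hb]⟩

variable {k O : Type u} [CommRing k] [CommRing O] [Algebra k O] {ι : Type} {x : ι → O}

theorem HasEtaleCoordinates.exists_basis_algebraMap {R : Type u} [CommRing R] [Algebra k R]
    [Algebra O R] [IsScalarTower k O R] [Algebra.FormallyEtale O R] (hx : HasEtaleCoordinates k x) :
    ∃ b : Module.Basis ι R (Ω[R⁄k]), ∀ i, b i = D k R (algebraMap O R (x i)) := by
  obtain ⟨b, hb⟩ := hx.exists_basis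
  obtain ⟨b', hb'⟩ := exists_basis_of_formallyEtale (IsScalarTower.toAlgHom k O R)
    (RingHom.formallyEtale_algebraMap.2 inferInstance) b
  exact ⟨b', fun i ↦ by rw [hb', hb, diffMap_D]; rfl⟩

theorem HasEtaleCoordinates.isUnit_of_ne [IsLocalRing O] (hx : HasEtaleCoordinates k x) {i₀ i : ι}
    (hi₀ : IsLocalRing.maximalIdeal O = Ideal.span {x i₀}) (hi : i ≠ i₀) : IsUnit (x i) := by
  by_contra h
  obtain ⟨b, hb⟩ := hx.exists_basis
  obtain ⟨c, hc⟩ := Ideal.mem_span_singleton'.1 (hi₀ ▸ h : x i ∈ Ideal.span {x i₀})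
  have hcoord := congr_arg (fun z ↦ b.repr z i) (hb i)
  simp only [← hc, Derivation.leibniz, ← hb, map_add, map_smul, Module.Basis.repr_self,
    Finsupp.add_apply, Finsupp.smul_apply, Finsupp.single_eq_same, smul_eq_mul] at hcoord
  rw [Finsupp.single_eq_of_ne hi, mul_zero, zero_add] at hcoord
  have hmem : x i₀ ∈ IsLocalRing.maximalIdeal O := hi₀ ▸ Ideal.mem_span_singleton_self _
  exact hmem (IsUnit.of_mul_eq_one _ hcoord.symm)

end LogBasis

theorem symCoord_orbGenerator_mem_coeffLattice_of_isField {k R L : Type u} [Field k] [CommRing R]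
    [Field L] [Algebra k R] [Algebra k L] (hR : IsField R) {ι : Type} [Fintype ι] [LinearOrder ι]
    {x : ι → R} {b : Module.Basis ι R (Ω[R⁄k])} (hb : ∀ i, b i = D k R (x i)) {j : R →ₐ[k] L}
    (hj : Function.Injective j) {ε : Module.Basis ι L (Ω[L⁄k])}
    (hε : ∀ i, ε i = (j (x i))⁻¹ • D k L (j (x i))) {κ : Type*} [Fintype κ] [LinearOrder κ]
    {z : κ → R} {m' : κ → ℕ∞} (hz : ∀ l, m' l ≠ 1 → z l ≠ 0) (hm' : ∀ l, 1 ≤ m' l)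
    (mW : ι → ℕ∞) {n p : ℕ} (J : Fin n → (Fin p ↪o κ)) :
    symCoord ε p (orbGenerator (fun l ↦ j (z l)) m' n p J) ∈ coeffLattice (j : R →+* L) n
      fun μ ↦ ∏ i, j (x i) ^ ceilQuot (occ i μ) (mW i) := by
  have := hR.nontrivial
  have hunit {r : R} (hr : r ≠ 0) : IsUnit r :=
    let ⟨s, hs⟩ := hR.mul_inv_cancel hr
    .of_mul_eq_one s hs
  have hx (i : ι) : x i ≠ 0 := fun h ↦ b.ne_zero i (by rw [hb, h, map_zero])
  refine symCoord_orbGenerator_mem_coeffLattice_of_isUnit (ϖ := 1) (t := 0)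
    (u := fun l ↦ if h : m' l = 1 then 1 else (hunit (hz l h)).unit) hb
    (fun i ↦ (map_ne_zero_iff j hj).2 (hx i)) hε (fun _ _ ↦ rfl) (fun i ↦ hunit (hx i)) mW
    (by simp) (fun l hl ↦ ?_) (fun l hl ↦ (hl rfl).elim) hm' J
  simp [hl]

section DiscreteValuationRing

lemma exists_eq_pow_mul_unit {R : Type*} [CommRing R] [IsDomain R] [IsDiscreteValuationRing R]
    {ϖ : R} (hϖ : Irreducible ϖ) {κ : Type*} {z : κ → R} {m : κ → ℕ∞}
    (hz : ∀ l, m l ≠ 1 → z l ≠ 0) : ∃ (t : κ → ℕ) (u : κ → Rˣ), (∀ l, m l = 1 → t l = 0) ∧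
      ∀ l, m l ≠ 1 → z l = ϖ ^ t l * u l := by
  have h (l : κ) : ∃ (t : ℕ) (u : Rˣ), (m l = 1 → t = 0) ∧ (m l ≠ 1 → z l = ϖ ^ t * u) := by
    by_cases hl : m l = 1
    · exact ⟨0, 1, fun _ ↦ rfl, fun h ↦ (h hl).elim⟩
    · obtain ⟨t, u, h⟩ := IsDiscreteValuationRing.eq_unit_mul_pow_irreducible (hz l hl) hϖ
      exact ⟨t, u, fun h ↦ (hl h).elim, fun _ ↦ h.trans (mul_comm _ _)⟩
  choose t u h using h
  exact ⟨t, u, fun l ↦ (h l).1, fun l ↦ (h l).2⟩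

variable {k O R L : Type u} [Field k] [CommRing O] [IsDomain O] [IsDiscreteValuationRing O]
  [CommRing R] [IsDomain R] [IsDiscreteValuationRing R] [Field L] [Algebra k O] [Algebra k R]
  [Algebra k L] [Algebra O R] (hmR :
    (IsLocalRing.maximalIdeal O).map (algebraMap O R) = IsLocalRing.maximalIdeal R)
  {ι : Type} [Fintype ι] [LinearOrder ι] {x : ι → O} (hx : HasEtaleCoordinates k x)
  {b : Module.Basis ι R (Ω[R⁄k])} (hb : ∀ i, b i = D k R (algebraMap O R (x i)))
  {j : R →ₐ[k] L} (hj : Function.Injective j) {ε : Module.Basis ι L (Ω[L⁄k])}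
  (hε : ∀ i, ε i = (j (algebraMap O R (x i)))⁻¹ • D k L (j (algebraMap O R (x i))))
  {κ : Type*} [Fintype κ] [LinearOrder κ] {z : κ → R} {m' : κ → ℕ∞} {m : ℕ∞} {mW : ι → ℕ∞}
  (hz : ∀ l, m' l ≠ 1 → z l ≠ 0)
  (hle : ∀ l, m' l ≠ 1 → ¬ IsUnit (z l) → m' l ≤ IsDiscreteValuationRing.addVal R (z l) * m)
  (hm' : ∀ l, 1 ≤ m' l) (hm : 1 ≤ m) (hmW : ∀ i, ¬ IsUnit (x i) → m ≤ mW i)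
  (hm1 : (∀ i, IsUnit (x i)) → m = 1)
include hmR hx hb hj hε hz hle hm' hm hmW hm1

theorem symCoord_orbGenerator_mem_coeffLattice_of_isDiscreteValuationRing {n p : ℕ}
    (J : Fin n → (Fin p ↪o κ)) :
    symCoord ε p (orbGenerator (fun l ↦ j (z l)) m' n p J) ∈ coeffLattice (j : R →+* L) n
      fun μ ↦ ∏ i, j (algebraMap O R (x i)) ^ ceilQuot (occ i μ) (mW i) := by
  have hxR (i : ι) : j (algebraMap O R (x i)) ≠ 0 := by
    rw [Ne, map_eq_zero_iff j hj]
    intro h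
    exact b.ne_zero i (by rw [hb, h, map_zero])
  have hle' {ϖ : R} (hϖ : Irreducible ϖ) {t : κ → ℕ} {u : κ → Rˣ} (ht : ∀ l, m' l = 1 → t l = 0)
      (hy : ∀ l, m' l ≠ 1 → z l = ϖ ^ t l * u l) (l : κ) (hl : t l ≠ 0) : m' l ≤ t l * m := by
    have hl1 : m' l ≠ 1 := mt (ht l) hl
    rw [← IsDiscreteValuationRing.addVal_def (z l) (u l) hϖ (t l) (by rw [hy l hl1, mul_comm])]
    refine hle l hl1 fun hunit ↦ hϖ.not_isUnit ?_
    rw [hy l hl1] at hunit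
    exact (isUnit_pow_iff hl).1 (isUnit_of_mul_isUnit_left hunit)
  by_cases hunit : ∀ i, IsUnit (x i)
  · obtain ⟨ϖ, hϖ⟩ := IsDiscreteValuationRing.exists_irreducible R
    obtain ⟨t, u, ht, hy⟩ := exists_eq_pow_mul_unit hϖ hz
    refine symCoord_orbGenerator_mem_coeffLattice_of_isUnit (x := fun i ↦ algebraMap O R (x i)) hb
      hxR hε ht (fun i ↦ (hunit i).map _) mW ((map_ne_zero_iff j hj).2 hϖ.ne_zero) hy
      (fun l hl ↦ ?_) hm' J
    simpa only [hm1 hunit, mul_one] using hle' hϖ ht hy l hl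
  · obtain ⟨i₀, hi₀⟩ := not_forall.1 hunit
    have hirr : Irreducible (x i₀) := ((Ideal.span_singleton_prime (hx.ne_zero i₀)).1
      (hx.isPrime_span_singleton hi₀)).irreducible
    have hϖ : Irreducible (algebraMap O R (x i₀)) := by
      rw [IsDiscreteValuationRing.irreducible_iff_uniformizer, ← hmR, hirr.maximalIdeal_eq,
        Ideal.map_span, Set.image_singleton]
    obtain ⟨t, u, ht, hy⟩ := exists_eq_pow_mul_unit hϖ hz
    exact symCoord_orbGenerator_mem_coeffLattice_of_branch (x := fun i ↦ algebraMap O R (x i)) hb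
      hxR hε ht (fun i hi ↦ (hx.isUnit_of_ne hirr.maximalIdeal_eq hi).map _) hm (hmW i₀ hi₀) hy
      (hle' hϖ ht hy) hm' J

end DiscreteValuationRing

lemma symCoord_mem_coeffLattice_of_mem_span {k R L : Type u} [CommRing k] [CommRing R] [Field L]
    [Algebra k L] {j : R →+* L} {ι : Type*} [LinearOrder ι] {n p : ℕ}
    {ε : Module.Basis ι L (Ω[L⁄k])} {e : ((Fin p ↪o ι) →₀ ℕ) → L} {S : Subring L} (hS : S ≤ j.range)
    {s : Set (SymForms k L p)} (hs : ∀ G ∈ s, symCoord ε p G ∈ coeffLattice j n e)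
    {v : SymForms k L p} (hv : v ∈ Submodule.span S s) :
    symCoord ε p v ∈ coeffLattice j n e := by
  induction hv using Submodule.span_induction with
  | mem v hv => exact hs v hv
  | zero =>
    rw [map_zero]
    exact zero_mem _
  | add v w _ _ hv hw =>
    rw [map_add]
    exact add_mem hv hw
  | smul r v _ hv =>
    obtain ⟨r', hr'⟩ := hS r.2
    rw [Subring.smul_def, map_smul, MvPolynomial.smul_eq_C_mul]
    exact C_mul_mem_coeffLattice hv fun μ ↦ ⟨r', by rw [hr']⟩

variable {k A O B K Aξ KB : Type u} [Field k] [CommRing A] [CommRing O] [IsDomain O]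
  [CommRing B] [Field K] [CommRing Aξ] [Field KB] [Algebra k A] [Algebra k O] [Algebra k B]
  [Algebra k K] [Algebra k Aξ] [Algebra k KB] [Algebra A O] [Algebra A B] [Algebra A Aξ]
  [Algebra O K] [Algebra B KB] [IsScalarTower k A B] [IsScalarTower k A Aξ] [IsScalarTower k O K]
  [IsScalarTower k B KB] [IsFractionRing O K] [IsFractionRing B KB]
  (N : Submonoid A) [IsLocalization N Aξ] {σ : Aξ →ₐ[k] KB} {θ : Aξ →ₐ[k] K}
  (hσ : ∀ a, σ (algebraMap A Aξ a) = algebraMap B KB (algebraMap A B a))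
  (hθ : ∀ a, θ (algebraMap A Aξ a) = algebraMap O K (algebraMap A O a))
  {ι : Type} [Fintype ι] [LinearOrder ι] {x : ι → O} (hx : HasEtaleCoordinates k x)
  {ε : Module.Basis ι K (Ω[K⁄k])}
  (hε : ∀ i, ε i = (algebraMap O K (x i))⁻¹ • D k K (algebraMap O K (x i)))
  {κ : Type} [Fintype κ] [LinearOrder κ] {y : κ → B} (hy : HasEtaleCoordinates k y)
  {m' : κ → ℕ∞} {mW : ι → ℕ∞} {n p : ℕ} {τ : SymForms k Aξ p}
  (hτ : symFormsMap p σ τ ∈ Submodule.span (algebraMap B KB).range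
    (Set.range (logGenerator (k := k) (fun l ↦ algebraMap B KB (y l)) m' n p)))
include N hσ hθ hx hε hy hτ

theorem symCoord_symFormsMap_mem_coeffLattice_of_faithfullyFlat [IsDomain B] {R : Type u}
    [CommRing R] [IsDomain R] [Algebra k R] [Algebra O R] [IsScalarTower k O R]
    [Module.FaithfullyFlat O R] [Algebra.FormallyEtale O R] (β : B →ₐ[k] R)
    (hβ : ∀ a, β (algebraMap A B a) = algebraMap O R (algebraMap A O a))
    (hβy : ∀ l, m' l ≠ 1 → β (y l) ≠ 0)
    (hgen : ∀ {b : Module.Basis ι R (Ω[R⁄k])} (_ : ∀ i, b i = D k R (algebraMap O R (x i)))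
      {j : R →ₐ[k] FractionRing R} (_ : Function.Injective j)
      {ε : Module.Basis ι (FractionRing R) (Ω[FractionRing R⁄k])}
      (_ : ∀ i, ε i = (j (algebraMap O R (x i)))⁻¹ • D k _ (j (algebraMap O R (x i)))) J,
      symCoord ε p (orbGenerator (fun l ↦ j (β (y l))) m' n p J) ∈
        coeffLattice (j : R →+* FractionRing R) n
          fun μ ↦ ∏ i, j (algebraMap O R (x i)) ^ ceilQuot (occ i μ) (mW i)) :
    symCoord ε p (symFormsMap p θ τ) ∈ coeffLattice (algebraMap O K) n
      fun μ ↦ algebraMap O K (∏ i, x i ^ ceilQuot (occ i μ) (mW i)) := by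
  let L := FractionRing R
  let j : R →ₐ[k] L := IsScalarTower.toAlgHom k R L
  have hj : Function.Injective j := IsFractionRing.injective R L
  have hjO {a : O} (ha : a ≠ 0) : j (algebraMap O R a) ≠ 0 :=
    (map_ne_zero_iff _ hj).2 ((map_ne_zero_iff _ (FaithfulSMul.algebraMap_injective O R)).2 ha)
  let γ : K →ₐ[k] L := IsLocalization.liftAlgHom (M := nonZeroDivisors O)
    (f := j.comp (IsScalarTower.toAlgHom k O R)) fun s ↦
      isUnit_iff_ne_zero.2 (hjO (nonZeroDivisors.ne_zero s.2))
  have hγ (a : O) : γ (algebraMap O K a) = j (algebraMap O R a) := IsLocalization.lift_eq _ a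
  have hspan := symFormsMap_mem_span_orbGenerator N (IsScalarTower.toAlgHom k A B) σ (γ.comp θ)
    (j.comp β) hσ (fun a ↦ (congr_arg γ (hθ a)).trans ((hγ _).trans (congr_arg j (hβ a)).symm)) hy
    (fun l hl ↦ (map_ne_zero_iff _ hj).2 (hβy l hl)) hτ
  obtain ⟨bR, hbR⟩ := hx.exists_basis_algebraMap (R := R)
  have := Algebra.FormallyEtale.of_isLocalization (Rₘ := L) (nonZeroDivisors R)
  obtain ⟨bL, hbL⟩ := exists_basis_of_formallyEtale j
    (RingHom.formallyEtale_algebraMap.2 inferInstance) bR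
  obtain ⟨εL, hεL⟩ := exists_log_basis (x := fun i ↦ j (algebraMap O R (x i))) (b := bL)
    (fun i ↦ by rw [hbL, hbR, diffMap_D]) fun i ↦ hjO (hx.ne_zero i)
  have hεγ (i : ι) : εL i = diffMap γ (ε i) := by
    rw [hεL, hε, diffMap_smul, diffMap_D, map_inv₀, hγ]
  have hL := symCoord_mem_coeffLattice_of_mem_span (j := (j : R →+* L)) (ε := εL)
    (by rintro _ ⟨b, rfl⟩; exact ⟨β b, rfl⟩) (Set.forall_mem_range.2 (hgen hbR hj hεL)) hspan
  rw [symFormsMap_comp, symCoord_symFormsMap p hεγ] at hL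
  refine mem_coeffLattice_of_faithfullyFlat (R := R) hj (γ : K →+* L) hγ ?_
  simp only [map_prod, map_pow]
  exact hL

theorem symCoord_symFormsMap_mem_coeffLattice_of_isPrincipalIdealRing {X : Type u} [CommRing X]
    [IsScalarTower k A O] [IsLocalRing A] [IsLocalRing B] [IsLocalRing X] [IsDomain X]
    [IsNoetherianRing X] [IsLocalRing O] [IsPrincipalIdealRing O] [Algebra A X] [Algebra X O]
    [IsScalarTower A X O] [Module.FaithfullyFlat X O]
    (hmO : (IsLocalRing.maximalIdeal X).map (algebraMap X O) = IsLocalRing.maximalIdeal O)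
    [IsLocalHom (algebraMap A B)] [Module.Flat A B] [Algebra.FormallyEtale A B]
    [Algebra.EssFiniteType A B] {I : κ → Ideal A}
    (hI : ∀ l, m' l ≠ 1 → (I l).map (algebraMap A B) = Ideal.span {y l})
    (hI0 : ∀ l, m' l ≠ 1 → (I l).map (algebraMap A O) ≠ ⊥) {m : ℕ∞}
    (hle : IsDiscreteValuationRing O → ∀ l, m' l ≠ 1 → (I l).map (algebraMap A X) ≠ ⊤ →
      m' l ≤ Module.length X (X ⧸ (I l).map (algebraMap A X)) * m)
    (hm' : ∀ l, 1 ≤ m' l) (hm : 1 ≤ m)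
    (hmW : IsDiscreteValuationRing O → ∀ i, ¬ IsUnit (x i) → m ≤ mW i)
    (hm1 : IsDiscreteValuationRing O → (∀ i, IsUnit (x i)) → m = 1) :
    symCoord ε p (symFormsMap p θ τ) ∈ coeffLattice (algebraMap O K) n
      fun μ ↦ algebraMap O K (∏ i, x i ^ ceilQuot (occ i μ) (mW i)) := by
  have := hy.isDomain_and_isIntegrallyClosed.1
  obtain ⟨R, _, _, _, _, _, _, β, hβ, _, _, hmR⟩ := exists_etale_domination k A O B
  have hIβ (l : κ) (hl : m' l ≠ 1) :
      ((I l).map (algebraMap A O)).map (algebraMap O R) = Ideal.span {β (y l)} := by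
    have hcomp : (algebraMap O R).comp (algebraMap A O) = (β : B →+* R).comp (algebraMap A B) :=
      RingHom.ext fun a ↦ (hβ a).symm
    rw [Ideal.map_map, hcomp, ← Ideal.map_map, hI l hl, Ideal.map_span, Set.image_singleton]
    rfl
  have hβy (l : κ) (hl : m' l ≠ 1) : β (y l) ≠ 0 := by
    rw [Ne, ← Ideal.span_singleton_eq_bot, ← hIβ l hl,
      Ideal.map_eq_bot_iff_of_injective (FaithfulSMul.algebraMap_injective O R)]
    exact hI0 l hl
  by_cases hO : IsLocalRing.maximalIdeal O = ⊥
  · have hR : IsField R := by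
      rw [IsLocalRing.isField_iff_maximalIdeal_eq, ← hmR, hO, Ideal.map_bot]
    have := hR.isDomain
    exact symCoord_symFormsMap_mem_coeffLattice_of_faithfullyFlat N hσ hθ hx hε hy hτ β hβ hβy
      fun hb _ hj _ hε J ↦
        symCoord_orbGenerator_mem_coeffLattice_of_isField hR hb hj hε hβy hm' mW J
  · have hDVR : IsDiscreteValuationRing O := { not_a_field' := hO }
    obtain ⟨_, _⟩ := isDiscreteValuationRing_of_map_maximalIdeal hmR
    let _ : Algebra X R := ((algebraMap O R).comp (algebraMap X O)).toAlgebra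
    have : IsScalarTower X O R := .of_algebraMap_eq fun _ ↦ rfl
    have : Module.FaithfullyFlat X R := .trans X O R
    have hmX : (IsLocalRing.maximalIdeal X).map (algebraMap X R) = IsLocalRing.maximalIdeal R := by
      rw [IsScalarTower.algebraMap_eq X O R, ← Ideal.map_map, hmO, hmR]
    have := isDiscreteValuationRing_of_faithfullyFlat hmX
    have hIX (l : κ) (hl : m' l ≠ 1) :
        ((I l).map (algebraMap A X)).map (algebraMap X R) = Ideal.span {β (y l)} := by
      rw [← hIβ l hl, IsScalarTower.algebraMap_eq X O R, ← Ideal.map_map,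
        Ideal.map_map (algebraMap A X), ← IsScalarTower.algebraMap_eq]
    refine symCoord_symFormsMap_mem_coeffLattice_of_faithfullyFlat N hσ hθ hx hε hy hτ β hβ hβy
      fun hb _ hj _ hε J ↦ symCoord_orbGenerator_mem_coeffLattice_of_isDiscreteValuationRing hmR hx
        hb hj hε hβy (fun l hl hu ↦ (hle hDVR l hl ?_).trans ?_) hm' hm (hmW hDVR) (hm1 hDVR) J
    · intro htop
      refine hu (Ideal.span_singleton_eq_top.1 ?_)
      rw [← hIX l hl, htop, Ideal.map_top]
    · gcongr
      exact length_quotient_le_addVal hmX (by rw [hIX l hl]; exact Ideal.mem_span_singleton_self _)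

end LocalPullback

/-! ### Local rings of schemes -/

section LocalRings

section StalkMap

theorem formallyEtale_stalkMap {X Y : Scheme.{u}} (f : X ⟶ Y) [Etale f] (x : X) :
    (f.stalkMap x).hom.FormallyEtale := by
  have hunramified : (f.stalkMap x).hom.FormallyUnramified := FormallyUnramified.stalkMap f x
  have hsmooth : (f.stalkMap x).hom.FormallySmooth := by
    rw [← Scheme.Hom.mem_smoothLocus, Scheme.Hom.smoothLocus_eq_top]
    trivial
  algebraize [(f.stalkMap x).hom]
  exact RingHom.formallyEtale_algebraMap.2 .of_formallyUnramified_and_formallySmooth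

variable (k : Type u) [Field k] {X Y : Scheme.{u}} [X.Over (Spec (.of k))] [Y.Over (Spec (.of k))]
  (f : X ⟶ Y) [f.IsOver (Spec (.of k))] {x : X} {y : Y}

/-- The map `𝒪_{Y,y} → 𝒪_{X,x}` for a point `y` equal to `f x`, which avoids transports along this
equality. -/
def stalkMapAt (h : f x = y) : Y.presheaf.stalk y →ₐ[k] X.presheaf.stalk x :=
  (stalkMapAlgHom k f x).comp (stalkSpecAlgHom k Y (specializes_of_eq h))

lemma stalkMapAt_rfl : stalkMapAt k f (rfl : f x = f x) = stalkMapAlgHom k f x := by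
  refine AlgHom.coe_ringHom_injective ?_
  change (Y.presheaf.stalkSpecializes (specializes_of_eq rfl) ≫ f.stalkMap x).hom = _
  rw [TopCat.Presheaf.stalkSpecializes_refl, Category.id_comp]
  rfl

theorem stalkMapAt_etale [Etale f] (h : f x = y) :
    (stalkMapAt k f h).toRingHom.Flat ∧ (stalkMapAt k f h).toRingHom.FormallyEtale ∧
      (stalkMapAt k f h).toRingHom.EssFiniteType ∧ IsLocalHom (stalkMapAt k f h).toRingHom := by
  subst h
  rw [stalkMapAt_rfl]
  exact ⟨Flat.stalkMap f x, formallyEtale_stalkMap f x, LocallyOfFiniteType.stalkMap f x,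
    inferInstanceAs (IsLocalHom (f.stalkMap x).hom)⟩

end StalkMap

section Generization

variable {X : Scheme.{u}} {x y : X}

theorem exists_isLocalization_stalkSpecializes (h : x ⤳ y) :
    letI := (X.presheaf.stalkSpecializes h).hom.toAlgebra
    ∃ N : Submonoid (X.presheaf.stalk y), IsLocalization N (X.presheaf.stalk x) := by
  let _ := (X.presheaf.stalkSpecializes h).hom.toAlgebra
  obtain ⟨U, hU, hyU, -⟩ := exists_isAffineOpen_mem_and_subset (Opens.mem_top y)
  have hxU : x ∈ U := h.mem_open U.2 hyU
  let _ : Algebra Γ(X, U) (X.presheaf.stalk x) :=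
    TopCat.Presheaf.algebra_section_stalk X.presheaf ⟨x, hxU⟩
  let _ : Algebra Γ(X, U) (X.presheaf.stalk y) :=
    TopCat.Presheaf.algebra_section_stalk X.presheaf ⟨y, hyU⟩
  have := hU.isLocalization_stalk ⟨x, hxU⟩
  have := hU.isLocalization_stalk ⟨y, hyU⟩
  have : IsScalarTower Γ(X, U) (X.presheaf.stalk y) (X.presheaf.stalk x) :=
    .of_algebraMap_eq' <| by
      change (X.presheaf.germ U x hxU).hom =
        (X.presheaf.germ U y hyU ≫ X.presheaf.stalkSpecializes h).hom
      rw [TopCat.Presheaf.germ_stalkSpecializes]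
  refine ⟨_, IsLocalization.isLocalization_of_submonoid_le (X.presheaf.stalk y)
    (X.presheaf.stalk x) (hU.primeIdealOf ⟨y, hyU⟩).asIdeal.primeCompl
    (hU.primeIdealOf ⟨x, hxU⟩).asIdeal.primeCompl fun s hs ↦ ?_⟩
  have hunit := (IsLocalization.map_units (X.presheaf.stalk y)
    (⟨s, hs⟩ : (hU.primeIdealOf ⟨y, hyU⟩).asIdeal.primeCompl)).map
      (algebraMap (X.presheaf.stalk y) (X.presheaf.stalk x))
  rw [← IsScalarTower.algebraMap_apply] at hunit
  exact (IsLocalization.AtPrime.isUnit_to_map_iff _ (hU.primeIdealOf ⟨x, hxU⟩).asIdeal s).1 hunit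

/-- The prime ideal of `𝒪_{X,y}` which corresponds to a generization `x` of `y`. -/
def generizationIdeal (h : x ⤳ y) : Ideal (X.presheaf.stalk y) :=
  (IsLocalRing.maximalIdeal (X.presheaf.stalk x)).comap (X.presheaf.stalkSpecializes h).hom

instance (h : x ⤳ y) : (generizationIdeal h).IsPrime := Ideal.comap_isPrime _ _

lemma fromSpecStalk_generizationIdeal (h : x ⤳ y) :
    X.fromSpecStalk y ⟨generizationIdeal h, inferInstance⟩ = x := by
  have := Scheme.fromSpecStalk_closedPoint (x := x)
  rwa [← Scheme.SpecMap_stalkSpecializes_fromSpecStalk h] at this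

theorem specializes_of_generizationIdeal_le {x' : X} (h : x ⤳ y) (h' : x' ⤳ y)
    (hle : generizationIdeal h ≤ generizationIdeal h') : x ⤳ x' := by
  rw [← fromSpecStalk_generizationIdeal h, ← fromSpecStalk_generizationIdeal h']
  exact ((PrimeSpectrum.le_iff_specializes _ _).1 hle).map (X.fromSpecStalk y).continuous

theorem exists_generizationIdeal_eq (P : Ideal (X.presheaf.stalk y)) [hP : P.IsPrime] :
    ∃ (x : X) (h : x ⤳ y), generizationIdeal h = P := by
  have h : X.fromSpecStalk y ⟨P, hP⟩ ⤳ y := by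
    have : X.fromSpecStalk y ⟨P, hP⟩ ∈ Set.range (X.fromSpecStalk y) := Set.mem_range_self _
    rwa [Scheme.range_fromSpecStalk] at this
  exact ⟨_, h, congr_arg PrimeSpectrum.asIdeal <|
    (IsPreimmersion.isEmbedding (X.fromSpecStalk y)).injective (fromSpecStalk_generizationIdeal h)⟩

theorem isLocalization_generizationIdeal (h : x ⤳ y) :
    letI := (X.presheaf.stalkSpecializes h).hom.toAlgebra
    IsLocalization.AtPrime (X.presheaf.stalk x) (generizationIdeal h) := by
  let _ := (X.presheaf.stalkSpecializes h).hom.toAlgebra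
  obtain ⟨N, hN⟩ := exists_isLocalization_stalkSpecializes h
  refine IsLocalization.of_le N _ (fun s hs hs' ↦ hs' ?_) fun s hs ↦ ?_
  · exact IsLocalization.map_units (X.presheaf.stalk x) (⟨s, hs⟩ : N)
  · exact not_not.1 hs

theorem generizationIdeal_eq_map (h : x ⤳ y) {U : X.Opens} (hU : IsAffineOpen U) (hy : y ∈ U) :
    generizationIdeal h = (hU.primeIdealOf ⟨x, h.mem_open U.2 hy⟩).asIdeal.map
      (X.presheaf.germ U y hy).hom := by
  have hx : x ∈ U := h.mem_open U.2 hy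
  let _ : Algebra Γ(X, U) (X.presheaf.stalk y) :=
    TopCat.Presheaf.algebra_section_stalk X.presheaf ⟨y, hy⟩
  let _ : Algebra Γ(X, U) (X.presheaf.stalk x) :=
    TopCat.Presheaf.algebra_section_stalk X.presheaf ⟨x, hx⟩
  have := hU.isLocalization_stalk ⟨y, hy⟩
  have := hU.isLocalization_stalk ⟨x, hx⟩
  rw [← IsLocalization.map_under (hU.primeIdealOf ⟨y, hy⟩).asIdeal.primeCompl
    (X.presheaf.stalk y) (generizationIdeal h)]
  refine congr_arg (Ideal.map _) (Ideal.ext fun s ↦ ?_)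
  change ((X.presheaf.germ U y hy ≫ X.presheaf.stalkSpecializes h).hom s) ∈
    IsLocalRing.maximalIdeal (X.presheaf.stalk x) ↔ s ∈ (hU.primeIdealOf ⟨x, hx⟩).asIdeal
  rw [TopCat.Presheaf.germ_stalkSpecializes]
  exact IsLocalization.AtPrime.to_map_mem_maximal_iff (X.presheaf.stalk x)
    (hU.primeIdealOf ⟨x, hx⟩).asIdeal s

end Generization

section Codimension

theorem isDiscreteValuationRing_of_coheight_eq_one {X : Scheme.{u}} {x : X}
    [IsDomain (X.presheaf.stalk x)] [IsNoetherianRing (X.presheaf.stalk x)]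
    [IsIntegrallyClosed (X.presheaf.stalk x)] (h : Order.coheight x = 1) :
    IsDiscreteValuationRing (X.presheaf.stalk x) := by
  have hdim := ringKrullDim_stalk_eq_coheight x
  rw [h] at hdim
  have hfield : ¬ IsField (X.presheaf.stalk x) := by
    intro hf
    rw [ringKrullDim_eq_zero_of_isField hf] at hdim
    exact zero_ne_one (α := ℕ) (by exact_mod_cast hdim)
  have hle : Ring.KrullDimLE 1 (X.presheaf.stalk x) := krullDimLE_of_coheight_le h.le
  have : Ring.DimensionLEOne (X.presheaf.stalk x) :=
    ⟨fun {P} hP hP' ↦ Ring.krullDimLE_one_iff_of_noZeroDivisors.1 hle P hP hP'⟩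
  have : IsDedekindDomain (X.presheaf.stalk x) := { }
  exact ((IsDiscreteValuationRing.TFAE (X.presheaf.stalk x) hfield).out 0 2).2 this

theorem coheight_eq_one_of_isDiscreteValuationRing {X : Scheme.{u}} {x : X}
    [IsDomain (X.presheaf.stalk x)] [IsDiscreteValuationRing (X.presheaf.stalk x)] :
    Order.coheight x = 1 := by
  have hdim := ringKrullDim_stalk_eq_coheight x
  rw [IsDiscreteValuationRing.ringKrullDim_eq_one] at hdim
  exact_mod_cast hdim.symm

variable {X Y : Scheme.{u}} (f : X ⟶ Y) [Etale f] (x : X)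

theorem faithfullyFlat_stalkMap : (f.stalkMap x).hom.FaithfullyFlat := by
  let _ := (f.stalkMap x).hom.toAlgebra
  have : Module.Flat (Y.presheaf.stalk (f x)) (X.presheaf.stalk x) := Flat.stalkMap f x
  have : IsLocalHom (algebraMap (Y.presheaf.stalk (f x)) (X.presheaf.stalk x)) :=
    inferInstanceAs (IsLocalHom (f.stalkMap x).hom)
  exact Module.FaithfullyFlat.of_flat_of_isLocalHom

theorem map_maximalIdeal_stalkMap :
    (IsLocalRing.maximalIdeal (Y.presheaf.stalk (f x))).map (f.stalkMap x).hom =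
      IsLocalRing.maximalIdeal (X.presheaf.stalk x) := by
  let _ := (f.stalkMap x).hom.toAlgebra
  have : Algebra.FormallyEtale (Y.presheaf.stalk (f x)) (X.presheaf.stalk x) :=
    formallyEtale_stalkMap f x
  have : Algebra.EssFiniteType (Y.presheaf.stalk (f x)) (X.presheaf.stalk x) :=
    LocallyOfFiniteType.stalkMap f x
  have : IsLocalHom (algebraMap (Y.presheaf.stalk (f x)) (X.presheaf.stalk x)) :=
    inferInstanceAs (IsLocalHom (f.stalkMap x).hom)
  exact Algebra.FormallyUnramified.map_maximalIdeal

theorem coheight_apply_eq_one_of_etale [IsDomain (X.presheaf.stalk x)]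
    [IsDiscreteValuationRing (X.presheaf.stalk x)] [IsDomain (Y.presheaf.stalk (f x))]
    [IsNoetherianRing (Y.presheaf.stalk (f x))] : Order.coheight (f x) = 1 := by
  let _ := (f.stalkMap x).hom.toAlgebra
  have : Module.FaithfullyFlat (Y.presheaf.stalk (f x)) (X.presheaf.stalk x) :=
    faithfullyFlat_stalkMap f x
  have : IsDiscreteValuationRing (Y.presheaf.stalk (f x)) :=
    isDiscreteValuationRing_of_faithfullyFlat (map_maximalIdeal_stalkMap f x)
  exact coheight_eq_one_of_isDiscreteValuationRing

end Codimension

section Sections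

variable {X : Scheme.{u}}

/-- The map `R → Γ(X, U)` given by a structure morphism `f : X ⟶ Spec R`. -/
def sectionsMap {R : CommRingCat.{u}} (f : X ⟶ Spec R) (U : X.Opens) : R →+* Γ(X, U) :=
  (f.appLE ⊤ U le_top).hom.comp (Scheme.ΓSpecIso R).inv.hom

section sectionsMap

variable {R : CommRingCat.{u}} (f : X ⟶ Spec R) {U : X.Opens}

lemma germ_sectionsMap {x : X} (hx : x ∈ U) (r : R) :
    (X.presheaf.germ U x hx).hom (sectionsMap f U r) =
      (X.presheaf.germ ⊤ x (Opens.mem_top x)).hom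
        (f.appTop.hom ((Scheme.ΓSpecIso R).inv.hom r)) := by
  change ((f.app ⊤ ≫ X.presheaf.map _) ≫ X.presheaf.germ U x hx).hom _ = _
  rw [Category.assoc, TopCat.Presheaf.germ_res]
  rfl

lemma sectionsMap_smooth [Smooth f] (hU : IsAffineOpen U) : (sectionsMap f U).Smooth :=
  RingHom.Smooth.respectsIso.2 _ (Scheme.ΓSpecIso R).symm.commRingCatIsoToRingEquiv
    (f.smooth_appLE (isAffineOpen_top _) hU _)

lemma sectionsMap_etale [Etale f] (hU : IsAffineOpen U) : (sectionsMap f U).Etale :=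
  (HasRingHomProperty.isLocal_ringHomProperty @Etale).respectsIso.2 _
    (Scheme.ΓSpecIso R).symm.commRingCatIsoToRingEquiv
    (HasRingHomProperty.appLE @Etale f inferInstance ⟨⊤, isAffineOpen_top _⟩ ⟨U, hU⟩ _)

lemma sectionsMap_finiteType [LocallyOfFiniteType f] (hU : IsAffineOpen U) :
    (sectionsMap f U).FiniteType :=
  RingHom.finiteType_respectsIso.2 _ (Scheme.ΓSpecIso R).symm.commRingCatIsoToRingEquiv
    (LocallyOfFiniteType.finiteType_appLE f (isAffineOpen_top _) hU _)

end sectionsMap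

variable {k : Type u} [Field k]

section Stalks

variable (k) [X.Over (Spec (.of k))]

lemma isScalarTower_sections_stalk {U : X.Opens} (x : U) :
    letI : Algebra k Γ(X, U) := (sectionsMap (X ↘ Spec (.of k)) U).toAlgebra
    IsScalarTower k Γ(X, U) (X.presheaf.stalk x.1) :=
  letI : Algebra k Γ(X, U) := (sectionsMap (X ↘ Spec (.of k)) U).toAlgebra
  .of_algebraMap_eq fun a ↦ (germ_sectionsMap (X ↘ Spec (.of k)) x.2 a).symm

theorem formallySmooth_stalk [Smooth (X ↘ Spec (.of k))] (x : X) :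
    Algebra.FormallySmooth k (X.presheaf.stalk x) := by
  obtain ⟨U, hU, hxU, -⟩ := exists_isAffineOpen_mem_and_subset (Opens.mem_top x)
  let _ : Algebra k Γ(X, U) := (sectionsMap (X ↘ Spec (.of k)) U).toAlgebra
  have : Algebra.Smooth k Γ(X, U) := sectionsMap_smooth (X ↘ Spec (.of k)) hU
  let _ : Algebra Γ(X, U) (X.presheaf.stalk x) :=
    TopCat.Presheaf.algebra_section_stalk X.presheaf ⟨x, hxU⟩
  have := isScalarTower_sections_stalk k (⟨x, hxU⟩ : U)
  have := hU.isLocalization_stalk ⟨x, hxU⟩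
  have : Algebra.FormallyEtale Γ(X, U) (X.presheaf.stalk x) :=
    Algebra.FormallyEtale.of_isLocalization (hU.primeIdealOf ⟨x, hxU⟩).asIdeal.primeCompl
  exact Algebra.FormallySmooth.comp k Γ(X, U) (X.presheaf.stalk x)

theorem essFiniteType_stalk [LocallyOfFiniteType (X ↘ Spec (.of k))] (x : X) :
    Algebra.EssFiniteType k (X.presheaf.stalk x) := by
  obtain ⟨U, hU, hxU, -⟩ := exists_isAffineOpen_mem_and_subset (Opens.mem_top x)
  let _ : Algebra k Γ(X, U) := (sectionsMap (X ↘ Spec (.of k)) U).toAlgebra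
  have : Algebra.FiniteType k Γ(X, U) := sectionsMap_finiteType (X ↘ Spec (.of k)) hU
  let _ : Algebra Γ(X, U) (X.presheaf.stalk x) :=
    TopCat.Presheaf.algebra_section_stalk X.presheaf ⟨x, hxU⟩
  have := isScalarTower_sections_stalk k (⟨x, hxU⟩ : U)
  have := hU.isLocalization_stalk ⟨x, hxU⟩
  have := Algebra.EssFiniteType.of_isLocalization (X.presheaf.stalk x)
    (hU.primeIdealOf ⟨x, hxU⟩).asIdeal.primeCompl
  exact Algebra.EssFiniteType.comp k Γ(X, U) (X.presheaf.stalk x)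

theorem exists_basis_stalk [Smooth (X ↘ Spec (.of k))] (x : X) :
    ∃ d : ℕ, Nonempty (Module.Basis (Fin d) (X.presheaf.stalk x) (Ω[X.presheaf.stalk x⁄k])) := by
  have := formallySmooth_stalk k x
  have := essFiniteType_stalk k x
  have : Module.Free (X.presheaf.stalk x) (Ω[X.presheaf.stalk x⁄k]) :=
    Module.free_of_flat_of_isLocalRing
  exact ⟨_, ⟨Module.finBasis _ _⟩⟩

end Stalks

end Sections

end LocalRings

section SmoothComponents

variable {Y : Scheme.{u}}

lemma vanishingIdeal_closure_ideal {E : Y} {U : Y.Opens} (hU : IsAffineOpen U) (hE : E ∈ U) :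
    (Scheme.IdealSheafData.vanishingIdeal (Closeds.closure {E})).ideal ⟨U, hU⟩ =
      (hU.primeIdealOf ⟨E, hE⟩).asIdeal := by
  have := hU.isOpenImmersion_fromSpec
  have hfE : hU.fromSpec (hU.primeIdealOf ⟨E, hE⟩) = E := hU.fromSpec_primeIdealOf ⟨E, hE⟩
  rw [Scheme.IdealSheafData.vanishingIdeal_ideal]
  ext s
  rw [PrimeSpectrum.mem_vanishingIdeal]
  refine ⟨fun hs ↦ hs (hU.primeIdealOf ⟨E, hE⟩) ?_, fun hs q hq ↦ ?_⟩
  · change hU.fromSpec _ ∈ closure {E}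
    rw [hfE]
    exact subset_closure rfl
  · have hspec : E ⤳ hU.fromSpec q := specializes_iff_mem_closure.2 hq
    rw [← hfE] at hspec
    exact (PrimeSpectrum.le_iff_specializes _ _).2
      (hU.fromSpec.isOpenEmbedding.isInducing.specializes_iff.1 hspec) hs

variable (k : Type u) [Field k] [Y.Over (Spec (.of k))]

lemma formallySmooth_quotient_ideal (𝓘 : Y.IdealSheafData)
    [Smooth (𝓘.subschemeι ≫ Y ↘ Spec (.of k))] {U : Y.Opens} (hU : IsAffineOpen U) :
    letI : Algebra k Γ(Y, U) := (sectionsMap (Y ↘ Spec (.of k)) U).toAlgebra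
    Algebra.FormallySmooth k (Γ(Y, U) ⧸ 𝓘.ideal ⟨U, hU⟩) := by
  let V := 𝓘.subschemeι ⁻¹ᵁ U
  let _ : Algebra k Γ(Y, U) := (sectionsMap (Y ↘ Spec (.of k)) U).toAlgebra
  let _ : Algebra k Γ(𝓘.subscheme, V) :=
    (sectionsMap (𝓘.subschemeι ≫ Y ↘ Spec (.of k)) V).toAlgebra
  have : Algebra.Smooth k Γ(𝓘.subscheme, V) :=
    sectionsMap_smooth (𝓘.subschemeι ≫ Y ↘ Spec (.of k)) (hU.preimage 𝓘.subschemeι)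
  let φ : Γ(Y, U) →ₐ[k] Γ(𝓘.subscheme, V) :=
    { (𝓘.subschemeι.app U).hom with
      commutes' := fun a ↦ by
        change ((Y ↘ Spec (.of k)).appLE ⊤ U le_top ≫ 𝓘.subschemeι.app U).hom _ = _
        rw [Scheme.Hom.app_eq_appLE]
        exact congr($(Scheme.Hom.appLE_comp_appLE 𝓘.subschemeι (Y ↘ Spec (.of k)) ⊤ U V le_top
          le_rfl).hom _) }
  have hφ : Function.Surjective φ := 𝓘.subschemeι_app_surjective ⟨U, hU⟩
  have hker : RingHom.ker φ = 𝓘.ideal ⟨U, hU⟩ := 𝓘.ker_subschemeι_app ⟨U, hU⟩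
  exact .of_equiv ((Ideal.quotientEquivAlgOfEq k hker).symm.trans
    (Ideal.quotientKerAlgEquivOfSurjective hφ)).symm

theorem formallySmooth_quotient_generizationIdeal {E y : Y} (h : E ⤳ y)
    (hE : Smooth ((Scheme.IdealSheafData.vanishingIdeal (Closeds.closure {E})).subschemeι ≫
      Y ↘ Spec (.of k))) :
    Algebra.FormallySmooth k (Y.presheaf.stalk y ⧸ generizationIdeal h) := by
  obtain ⟨U, hU, hyU, -⟩ := exists_isAffineOpen_mem_and_subset (Opens.mem_top y)
  have hEU : E ∈ U := h.mem_open U.2 hyU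
  let _ : Algebra k Γ(Y, U) := (sectionsMap (Y ↘ Spec (.of k)) U).toAlgebra
  have hsmooth := formallySmooth_quotient_ideal k
    (Scheme.IdealSheafData.vanishingIdeal (Closeds.closure {E})) hU
  rw [vanishingIdeal_closure_ideal hU hEU] at hsmooth
  let _ : Algebra Γ(Y, U) (Y.presheaf.stalk y) :=
    TopCat.Presheaf.algebra_section_stalk Y.presheaf ⟨y, hyU⟩
  have := isScalarTower_sections_stalk k (⟨y, hyU⟩ : U)
  have := hU.isLocalization_stalk ⟨y, hyU⟩
  have : Algebra.FormallyEtale Γ(Y, U) (Y.presheaf.stalk y) :=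
    Algebra.FormallyEtale.of_isLocalization (hU.primeIdealOf ⟨y, hyU⟩).asIdeal.primeCompl
  rw [generizationIdeal_eq_map h hU hyU]
  exact formallySmooth_quotient_map (hU.primeIdealOf ⟨E, hEU⟩).asIdeal

end SmoothComponents

/-! ### Charts and multiplicities -/

section Coordinates

/-- The morphism `X → Spec k[X_i]` defined by functions `v_i` on a `k`-scheme `X`. -/
def vectorToSpec (k : Type u) [Field k] {X : Scheme.{u}} [X.Over (Spec (.of k))] {ι : Type u}
    (v : ι → Γ(X, ⊤)) : X ⟶ Spec (.of (MvPolynomial ι k)) :=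
  AffineSpace.homOfVector (X ↘ Spec (.of k)) v ≫ (AffineSpace.SpecIso ι (.of k)).hom

lemma germ_sectionsMap_vectorToSpec (k : Type u) [Field k] {X : Scheme.{u}}
    [X.Over (Spec (.of k))] {ι : Type u} (v : ι → Γ(X, ⊤)) {U : X.Opens} {x : X} (hx : x ∈ U)
    (q : MvPolynomial ι k) :
    (X.presheaf.germ U x hx).hom (sectionsMap (vectorToSpec k v) U q) =
      MvPolynomial.aeval (fun i ↦ (X.presheaf.germ ⊤ x (Opens.mem_top x)).hom (v i)) q := by
  have hcoord (q : MvPolynomial ι k) : (AffineSpace.SpecIso ι (.of k)).hom.appTop.hom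
      ((Scheme.ΓSpecIso (.of (MvPolynomial ι k))).inv.hom q) =
      MvPolynomial.eval₂Hom ((Scheme.ΓSpecIso (.of k)).inv ≫
        (𝔸(ι; Spec (.of k)) ↘ Spec (.of k)).appTop).hom (AffineSpace.coord (Spec (.of k))) q := by
    rw [AffineSpace.SpecIso_hom_appTop]
    exact congr_arg (MvPolynomial.eval₂Hom _ _)
      congr($((Scheme.ΓSpecIso (.of (MvPolynomial ι k))).inv_hom_id).hom q)
  have hconst : (𝔸(ι; Spec (.of k)) ↘ Spec (.of k)).appTop ≫
      (AffineSpace.homOfVector (X ↘ Spec (.of k)) v).appTop = (X ↘ Spec (.of k)).appTop := by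
    rw [← Scheme.Hom.comp_appTop, AffineSpace.homOfVector_over]
  rw [germ_sectionsMap]
  refine (congr_arg (fun r ↦ (X.presheaf.germ ⊤ x _).hom
    ((AffineSpace.homOfVector (X ↘ Spec (.of k)) v).appTop.hom r)) (hcoord q)).trans ?_
  induction q using MvPolynomial.induction_on with
  | C a =>
    rw [MvPolynomial.coe_eval₂Hom, MvPolynomial.eval₂_C, MvPolynomial.aeval_C]
    exact congr_arg (X.presheaf.germ ⊤ x _).hom
      congr($(hconst).hom ((Scheme.ΓSpecIso (.of k)).inv.hom a))
  | add q r hq hr => rw [map_add, map_add, map_add, hq, hr, map_add]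
  | mul_X q i hq =>
    rw [map_mul, map_mul, map_mul, hq, map_mul, MvPolynomial.aeval_X]
    congr 1
    rw [MvPolynomial.coe_eval₂Hom, MvPolynomial.eval₂_X]
    exact congr_arg _ (AffineSpace.homOfVector_appTop_coord _ _ _)

end Coordinates

namespace Orbifold

section Charts

variable {k : Type u} [Field k] {𝒳 : Orbifold k} (c : 𝒳.Chart)

namespace Chart

/-- The coordinate `x_j` as an element of the local ring of a point. -/
def coordAt (w : c.W) (j : Fin c.d) : c.W.presheaf.stalk w :=
  (c.W.presheaf.germ ⊤ w (Opens.mem_top _)).hom (c.coord j)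

lemma stalkSpecializes_coordAt {w w' : c.W} (h : w' ⤳ w) (j : Fin c.d) :
    (c.W.presheaf.stalkSpecializes h).hom (c.coordAt w j) = c.coordAt w' j := by
  change (c.W.presheaf.germ ⊤ w _ ≫ c.W.presheaf.stalkSpecializes h).hom _ = _
  rw [TopCat.Presheaf.germ_stalkSpecializes]
  rfl

lemma algebraMap_coordAt (w : c.W) (j : Fin c.d) :
    algebraMap (c.W.presheaf.stalk w) c.W.functionField (c.coordAt w j) = c.coordK j :=
  c.stalkSpecializes_coordAt _ j

lemma isUnit_coordAt (w : c.W) (j : Fin c.d) :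
    IsUnit (c.coordAt w j) ↔ w ∈ c.W.basicOpen (c.coord j) :=
  (Scheme.mem_basicOpen_top _ _ _).symm

theorem hasEtaleCoordinates (w : c.W) : HasEtaleCoordinates k (c.coordAt w) := by
  obtain ⟨U, hU, hw, -⟩ := exists_isAffineOpen_mem_and_subset (Opens.mem_top w)
  let ψ := vectorToSpec k fun j : ULift.{u} (Fin c.d) ↦ c.coord j.down
  have : Etale (AffineSpace.homOfVector (n := ULift.{u} (Fin c.d)) (c.W ↘ Spec (.of k))
      fun j ↦ c.coord j.down) := c.etale_coord
  have : Etale ψ := by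
    unfold ψ vectorToSpec
    infer_instance
  let e := MvPolynomial.renameEquiv k (Equiv.ulift.{u} (α := Fin c.d)).symm
  have hα : ((sectionsMap ψ U).comp e.toRingEquiv.toRingHom).Etale :=
    (HasRingHomProperty.isLocal_ringHomProperty @Etale).respectsIso.2 _ e.toRingEquiv
      (sectionsMap_etale ψ hU)
  let _ : Algebra (MvPolynomial (Fin c.d) k) Γ(c.W, U) := RingHom.toAlgebra <|
    (sectionsMap ψ U).comp e.toRingEquiv.toRingHom
  let _ : Algebra Γ(c.W, U) (c.W.presheaf.stalk w) :=
    TopCat.Presheaf.algebra_section_stalk c.W.presheaf ⟨w, hw⟩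
  let _ := (MvPolynomial.aeval (R := k) (c.coordAt w)).toAlgebra
  refine ⟨Γ(c.W, U), inferInstance, inferInstance, inferInstance,
    (hU.primeIdealOf ⟨w, hw⟩).asIdeal.primeCompl, hα, hU.isLocalization_stalk ⟨w, hw⟩,
    .of_algebraMap_eq fun q ↦ ?_⟩
  have hq := germ_sectionsMap_vectorToSpec k (fun j : ULift.{u} (Fin c.d) ↦ c.coord j.down) hw (e q)
  rw [MvPolynomial.renameEquiv_apply, MvPolynomial.aeval_rename] at hq
  exact hq.symm

end Chart

end Charts

section Multiplicities

variable {k : Type u} [Field k] {𝒳 : Orbifold k}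

lemma mult_eq_one {E : 𝒳.X} (h : 𝒳.Δ E = 0) : 𝒳.mult E = 1 := by
  unfold mult
  rw [h, if_neg zero_ne_one, sub_zero, inv_one, Nat.floor_one, Nat.cast_one]

lemma one_le_mult (E : 𝒳.X) : 1 ≤ 𝒳.mult E := by
  unfold mult
  split_ifs with h
  · exact le_top
  · have hpos : 0 < 1 - 𝒳.Δ E := sub_pos.2 (lt_of_le_of_ne (𝒳.coeff_le_one E) h)
    have hinv : 1 ≤ (1 - 𝒳.Δ E)⁻¹ := (one_le_inv₀ hpos).2 (by linarith [𝒳.coeff_nonneg E])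
    exact_mod_cast Nat.le_floor (by exact_mod_cast hinv)

namespace Chart

variable (c : 𝒳.Chart)

lemma one_le_coordMult (w : c.W) (j : Fin c.d) : 1 ≤ c.coordMult w j :=
  le_max_left _ _

lemma mult_le_coordMult {w D : c.W} (h : D ⤳ w) (hD : Order.coheight D = 1)
    {j : Fin c.d} (hj : ¬ IsUnit (c.coordAt D j)) : 𝒳.mult (c.g D) ≤ c.coordMult w j :=
  le_max_of_le_right (le_iSup₂_of_le (f := fun D (_ : D ∈ {D : c.W | D ⤳ w ∧ Order.coheight D = 1 ∧
    D ∉ c.W.basicOpen (c.coord j)}) ↦ 𝒳.mult (c.g D)) D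
    ⟨h, hD, fun h' ↦ hj ((c.isUnit_coordAt D j).2 h')⟩ le_rfl)

lemma coordMult_le {w : c.W} {j : Fin c.d} {N : ℕ∞} (hN : 1 ≤ N)
    (h : ∀ D, D ⤳ w → Order.coheight D = 1 → ¬ IsUnit (c.coordAt D j) → 𝒳.Δ (c.g D) ≠ 0 →
      𝒳.mult (c.g D) ≤ N) : c.coordMult w j ≤ N := by
  refine max_le hN (iSup₂_le fun D ⟨hDw, hD, hj⟩ ↦ ?_)
  by_cases hΔ : 𝒳.Δ (c.g D) = 0
  · rwa [mult_eq_one hΔ]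
  · exact h D hDw hD (fun h' ↦ hj ((c.isUnit_coordAt D j).1 h')) hΔ

lemma exists_of_coordMult_ne_one {w : c.W} {j : Fin c.d} (h : c.coordMult w j ≠ 1) :
    ∃ D, D ⤳ w ∧ Order.coheight D = 1 ∧ ¬ IsUnit (c.coordAt D j) ∧ 𝒳.Δ (c.g D) ≠ 0 := by
  by_contra! h'
  exact h (le_antisymm (c.coordMult_le le_rfl fun D hDw hD hj hΔ ↦ (hΔ (h' D hDw hD hj)).elim)
    (c.one_le_coordMult w j))

lemma mult_eq_one_of_isUnit {D : c.W} (h : ∀ j, IsUnit (c.coordAt D j)) :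
    𝒳.mult (c.g D) = 1 := by
  refine mult_eq_one ?_
  by_contra hΔ
  refine (c.mem_supp_iff D).1 ⟨c.g D, hΔ, specializes_rfl⟩ ?_
  rw [Scheme.mem_basicOpen_top, map_prod]
  exact Finset.prod_induction _ IsUnit (fun _ _ ↦ IsUnit.mul) isUnit_one fun j _ ↦ h j

end Chart

end Multiplicities

end Orbifold

section FunctionFields

variable (k : Type u) [Field k]

lemma stalkSpecAlgHom_stalkMapAlgHom {X Y : Scheme.{u}} [X.Over (Spec (.of k))]
    [Y.Over (Spec (.of k))] (f : X ⟶ Y) [f.IsOver (Spec (.of k))] {x x' : X} (h : x ⤳ x')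
    (a : Y.presheaf.stalk (f x')) :
    stalkSpecAlgHom k X h (stalkMapAlgHom k f x' a) =
      stalkMapAlgHom k f x (stalkSpecAlgHom k Y (h.map f.continuous) a) :=
  congr($(Scheme.Hom.stalkSpecializes_stalkMap f x x' h).hom a).symm

lemma stalkSpecAlgHom_stalkSpecAlgHom {X : Scheme.{u}} [X.Over (Spec (.of k))] {x y z : X}
    (h : x ⤳ y) (h' : y ⤳ z) (a : X.presheaf.stalk z) :
    stalkSpecAlgHom k X h (stalkSpecAlgHom k X h' a) = stalkSpecAlgHom k X (h.trans h') a := by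
  change (X.presheaf.stalkSpecializes h' ≫ X.presheaf.stalkSpecializes h).hom a = _
  rw [TopCat.Presheaf.stalkSpecializes_comp]
  rfl

lemma functionFieldMap_algebraMap {W X : Scheme.{u}} [W.Over (Spec (.of k))]
    [X.Over (Spec (.of k))] [IsIntegral W] [IsIntegral X] (g : W ⟶ X) [g.IsOver (Spec (.of k))]
    [Etale g] {w : W} {x : X} (h : g w = x) (a : X.presheaf.stalk x) :
    functionFieldMap k g (algebraMap (X.presheaf.stalk x) X.functionField a) =
      algebraMap (W.presheaf.stalk w) W.functionField (stalkMapAt k g h a) := by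
  subst h
  refine Eq.trans ?_ (stalkSpecAlgHom_stalkMapAlgHom k g
    ((genericPoint_spec W).specializes (Set.mem_univ w)) _).symm
  refine congr_arg (stalkMapAlgHom k g (genericPoint W)) ?_
  refine (stalkSpecAlgHom_stalkSpecAlgHom k _ _ a).trans ?_
  exact (stalkSpecAlgHom_stalkSpecAlgHom k _ _ a).symm

lemma isScalarTower_stalk_functionField (X : Scheme.{u}) [X.Over (Spec (.of k))] [IsIntegral X]
    (x : X) : IsScalarTower k (X.presheaf.stalk x) X.functionField :=
  IsScalarTower.of_algebraMap_eq' (stalkSpecAlgHom k X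
    ((genericPoint_spec X).specializes (Set.mem_univ x))).comp_algebraMap.symm

end FunctionFields

section Generizations

lemma generizationIdeal_ne_bot {Y : Scheme.{u}} {E y : Y} (h : E ⤳ y) (hE : ¬ IsMax E) :
    generizationIdeal h ≠ ⊥ := by
  intro hbot
  obtain ⟨z, hz⟩ := not_isMax_iff.1 hE
  exact hz.not_ge (specializes_of_generizationIdeal_le h (Specializes.trans hz.le h)
    (hbot ▸ bot_le))

variable (k : Type u) [Field k] {X Y : Scheme.{u}} [X.Over (Spec (.of k))]
  [Y.Over (Spec (.of k))] (f : X ⟶ Y) [f.IsOver (Spec (.of k))]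

lemma stalkSpecAlgHom_stalkMapAt {x x' : X} {y : Y} (hx : x ⤳ x') (h : f x' = y)
    (a : Y.presheaf.stalk y) :
    stalkSpecAlgHom k X hx (stalkMapAt k f h a) =
      stalkMapAlgHom k f x (stalkSpecAlgHom k Y (h ▸ hx.map f.continuous) a) :=
  (stalkSpecAlgHom_stalkMapAlgHom k f hx _).trans
    (congr_arg _ (stalkSpecAlgHom_stalkSpecAlgHom k _ _ a))

lemma comap_generizationIdeal {x x' : X} {y : Y} (hx : x ⤳ x') (h : f x' = y) (hy : f x ⤳ y) :
    (generizationIdeal hx).comap (stalkMapAt k f h).toRingHom = generizationIdeal hy := by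
  ext a
  change stalkSpecAlgHom k X hx (stalkMapAt k f h a) ∈ IsLocalRing.maximalIdeal _ ↔ _
  rw [stalkSpecAlgHom_stalkMapAt]
  exact (isUnit_map_iff (f.stalkMap x).hom _).not

end Generizations

namespace Orbifold

section Components

variable {k : Type u} [Field k] {𝒴 : Orbifold k}

instance (𝒳 : Orbifold k) : IsLocallyNoetherian 𝒳.X :=
  LocallyOfFiniteType.isLocallyNoetherian (𝒳.X ↘ Spec (.of k))

lemma not_isMax {E : 𝒴.X} (hE : 𝒴.Δ E ≠ 0) : ¬ IsMax E := by
  rw [← Order.coheight_eq_zero, 𝒴.coheight_eq_one E hE]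
  exact one_ne_zero

namespace Chart

variable (c : 𝒴.Chart) {w D : c.W} {l : Fin c.d}

theorem generizationIdeal_eq_span_coordAt (hD : D ⤳ w) (hD1 : Order.coheight D = 1)
    (hl : ¬ IsUnit (c.coordAt D l)) : generizationIdeal hD = Ideal.span {c.coordAt w l} := by
  have hD' := c.hasEtaleCoordinates D
  have := hD'.isNoetherianRing
  have := hD'.isDomain_and_isIntegrallyClosed.2
  have := isDiscreteValuationRing_of_coheight_eq_one hD1
  let _ := (c.W.presheaf.stalkSpecializes hD).hom.toAlgebra
  have hloc := isLocalization_generizationIdeal hD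
  have hcoord : algebraMap _ (c.W.presheaf.stalk D) (c.coordAt w l) = c.coordAt D l :=
    c.stalkSpecializes_coordAt hD l
  have hprime := (c.hasEtaleCoordinates w).isPrime_span_singleton fun hu : IsUnit (c.coordAt w l) ↦
    hl (hcoord ▸ hu.map _)
  have hle : Ideal.span {c.coordAt w l} ≤ generizationIdeal hD :=
    (Ideal.span_singleton_le_iff_mem _).2 <| Ideal.mem_comap.2 <|
      (c.stalkSpecializes_coordAt hD l).symm ▸ hl
  have hdisj : Disjoint ((generizationIdeal hD).primeCompl : Set (c.W.presheaf.stalk w))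
      (Ideal.span {c.coordAt w l} : Ideal (c.W.presheaf.stalk w)) :=
    Set.disjoint_left.2 fun a ha ha' ↦ ha (hle ha')
  have hmax : (Ideal.span {c.coordAt w l}).map (algebraMap _ (c.W.presheaf.stalk D)) =
      IsLocalRing.maximalIdeal _ := by
    refine IsLocalRing.eq_maximalIdeal (Ring.DimensionLEOne.maximalOfPrime ?_
      (IsLocalization.isPrime_of_isPrime_disjoint (generizationIdeal hD).primeCompl _ _ hprime
        hdisj))
    rw [Ideal.map_span, Set.image_singleton, hcoord, Ne, Ideal.span_singleton_eq_bot]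
    exact hD'.ne_zero l
  have hunder := IsLocalization.under_map_of_isPrime_disjoint (generizationIdeal hD).primeCompl
    (c.W.presheaf.stalk D) hprime hdisj
  rwa [hmax] at hunder

variable {y : 𝒴.X} (h : c.g w = y)

/-- The ideal in `𝒪_{Y,y}` of the image in `Y` of the branch `x_l = 0` through a point over `y`. -/
def branchIdeal (l : Fin c.d) : Ideal (𝒴.X.presheaf.stalk y) :=
  (Ideal.span {c.coordAt w l}).comap (stalkMapAt k c.g h).toRingHom

lemma generizationIdeal_eq_branchIdeal (hD : D ⤳ w) (hD1 : Order.coheight D = 1)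
    (hl : ¬ IsUnit (c.coordAt D l)) (hE : c.g D ⤳ y) :
    generizationIdeal hE = c.branchIdeal h l := by
  rw [branchIdeal, ← c.generizationIdeal_eq_span_coordAt hD hD1 hl, comap_generizationIdeal]

lemma exists_generizationIdeal_eq_branchIdeal (hl : c.coordMult w l ≠ 1) :
    ∃ (E : 𝒴.X) (hE : E ⤳ y), 𝒴.Δ E ≠ 0 ∧ generizationIdeal hE = c.branchIdeal h l := by
  obtain ⟨D, hD, hD1, hDl, hE0⟩ := c.exists_of_coordMult_ne_one hl
  exact ⟨c.g D, h ▸ hD.map c.g.continuous, hE0,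
    c.generizationIdeal_eq_branchIdeal h hD hD1 hDl _⟩

-- The ideal of the smooth divisor `E` cannot be contained in `(x_l)` without being equal to it.
theorem map_branchIdeal (h𝒴 : 𝒴.IsSmooth) (hl : c.coordMult w l ≠ 1) :
    (c.branchIdeal h l).map (stalkMapAt k c.g h).toRingHom = Ideal.span {c.coordAt w l} := by
  have hle : (c.branchIdeal h l).map (stalkMapAt k c.g h).toRingHom ≤
    Ideal.span {c.coordAt w l} := Ideal.map_comap_le
  refine le_antisymm hle ((Ideal.span_singleton_le_iff_mem _).2 ?_)
  obtain ⟨E, hE, hE0, hEl⟩ := c.exists_generizationIdeal_eq_branchIdeal h hl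
  have hw := c.hasEtaleCoordinates w
  have := hw.isNoetherianRing
  have := hw.isDomain_and_isIntegrallyClosed.1
  have := hw.formallySmooth
  let φ := stalkMapAt k c.g h
  algebraize [φ.toRingHom]
  have : IsScalarTower k (𝒴.X.presheaf.stalk y) (c.W.presheaf.stalk w) :=
    .of_algebraMap_eq' φ.comp_algebraMap.symm
  obtain ⟨hflat, hetale, -, hlocal⟩ := stalkMapAt_etale k c.g h
  have : Algebra.FormallyEtale (𝒴.X.presheaf.stalk y) (c.W.presheaf.stalk w) := hetale
  have : Module.Flat (𝒴.X.presheaf.stalk y) (c.W.presheaf.stalk w) := hflat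
  have : IsLocalHom (algebraMap (𝒴.X.presheaf.stalk y) (c.W.presheaf.stalk w)) := hlocal
  have : Module.FaithfullyFlat (𝒴.X.presheaf.stalk y) (c.W.presheaf.stalk w) :=
    .of_flat_of_isLocalHom
  have := formallySmooth_quotient_generizationIdeal k hE (h𝒴.smooth_component _ hE0)
  rw [hEl] at this
  have : Algebra.FormallySmooth k (c.W.presheaf.stalk w ⧸
      (c.branchIdeal h l).map φ.toRingHom) := formallySmooth_quotient_map (c.branchIdeal h l)
  refine mem_of_formallySmooth_quotient k _ ?_ (fun hu ↦ ?_) hle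
  · refine (Ideal.map_eq_bot_iff_of_injective (FaithfulSMul.algebraMap_injective _ _)).not.2 ?_
    exact hEl ▸ generizationIdeal_ne_bot hE (not_isMax hE0)
  · refine Ideal.IsPrime.ne_top (inferInstance : (generizationIdeal hE).IsPrime) ?_
    rw [hEl, branchIdeal, Ideal.span_singleton_eq_top.2 hu, Ideal.comap_top]

end Chart

variable {𝒳 : Orbifold k} {f : 𝒳.X ⟶ 𝒴.X} [f.IsOver (Spec (.of k))]

theorem IsMorphism.genericPoint_notMem_supp (hf : IsMorphism 𝒳 𝒴 f) :
    f (genericPoint 𝒳.X) ∉ 𝒴.supp := by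
  rintro ⟨E, hE0, hE⟩
  refine hf.not_subset ?_
  rintro _ ⟨x, rfl⟩
  exact ⟨E, hE0, hE.trans (((genericPoint_spec 𝒳.X).specializes trivial).map f.continuous)⟩

theorem IsMorphism.map_generizationIdeal_ne_bot (hf : IsMorphism 𝒳 𝒴 f) {E : 𝒴.X}
    (hE0 : 𝒴.Δ E ≠ 0) {x : 𝒳.X} (hE : E ⤳ f x) :
    (generizationIdeal hE).map (stalkMapAlgHom k f x).toRingHom ≠ ⊥ := by
  intro hbot
  have hη := (genericPoint_spec 𝒳.X).specializes (Set.mem_univ x)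
  refine hf.genericPoint_notMem_supp ⟨E, hE0,
    specializes_of_generizationIdeal_le hE (hη.map f.continuous) fun a ha hu ↦ ?_⟩
  have ha0 : stalkMapAlgHom k f x a = 0 := (Ideal.map_eq_bot_iff_le_ker _).1 hbot ha
  have hu' : IsUnit (stalkMapAlgHom k f (genericPoint 𝒳.X)
    (stalkSpecAlgHom k 𝒴.X (hη.map f.continuous) a)) := hu.map _
  rw [← stalkSpecAlgHom_stalkMapAlgHom k f hη, ha0, map_zero] at hu'
  exact not_isUnit_zero hu'

theorem IsMorphism.map_branchIdeal_ne_bot (hf : IsMorphism 𝒳 𝒴 f) (c : 𝒴.Chart) {w : c.W} {x : 𝒳.X}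
    (h : c.g w = f x) {l : Fin c.d} (hl : c.coordMult w l ≠ 1) :
    (c.branchIdeal h l).map (stalkMapAlgHom k f x).toRingHom ≠ ⊥ := by
  obtain ⟨E, hE, hE0, hEl⟩ := c.exists_generizationIdeal_eq_branchIdeal h hl
  exact hEl ▸ hf.map_generizationIdeal_ne_bot hE0 hE

theorem IsMorphism.coordMult_le_length_mul (hf : IsMorphism 𝒳 𝒴 f) (c : 𝒴.Chart) {w : c.W}
    {D : 𝒳.X} (h : c.g w = f D) (hD : Order.coheight D = 1) {l : Fin c.d}
    (hl : (c.branchIdeal h l).map (stalkMapAlgHom k f D).toRingHom ≠ ⊤) :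
    c.coordMult w l ≤ Module.length (𝒳.X.presheaf.stalk D) (𝒳.X.presheaf.stalk D ⧸
      (c.branchIdeal h l).map (stalkMapAlgHom k f D).toRingHom) * 𝒳.mult D := by
  refine c.coordMult_le ?_ fun D' hD' hD1 hDl hE0 ↦ ?_
  · have := Ideal.Quotient.nontrivial_iff.2 hl
    exact one_le_mul (Order.one_le_iff_pos.2 Module.length_pos) (one_le_mult D)
  · have hE : c.g D' ⤳ f D := h ▸ hD'.map c.g.continuous
    rw [← c.generizationIdeal_eq_branchIdeal h hD' hD1 hDl hE]
    exact hf.mult_le _ _ hE hE0 hD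

end Components

end Orbifold

/-! ### Pullback of orbifold forms -/

section Normality

theorem mem_range_algebraMap_stalk_of_forall_specializes {X : Scheme.{u}} [IsIntegral X] {x : X}
    [IsNoetherianRing (X.presheaf.stalk x)] [IsIntegrallyClosed (X.presheaf.stalk x)]
    (v : X.functionField)
    (h : ∀ D, D ⤳ x → IsDiscreteValuationRing (X.presheaf.stalk D) →
      v ∈ Set.range (algebraMap (X.presheaf.stalk D) X.functionField)) :
    v ∈ Set.range (algebraMap (X.presheaf.stalk x) X.functionField) := by
  refine mem_range_algebraMap_of_forall_isDiscreteValuationRing v fun P _ hP ↦ ?_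
  obtain ⟨D, hD, rfl⟩ := exists_generizationIdeal_eq P
  let _ := (X.presheaf.stalkSpecializes hD).hom.toAlgebra
  have := isLocalization_generizationIdeal hD
  obtain ⟨r, rfl⟩ := h D hD <| IsDiscreteValuationRing.RingEquivClass.isDiscreteValuationRing
    (IsLocalization.algEquiv (generizationIdeal hD).primeCompl
      (Localization.AtPrime (generizationIdeal hD)) (X.presheaf.stalk D))
  obtain ⟨⟨a, s⟩, has⟩ := IsLocalization.surj (generizationIdeal hD).primeCompl r
  have hK (z : X.presheaf.stalk x) : algebraMap (X.presheaf.stalk x) X.functionField z =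
      algebraMap (X.presheaf.stalk D) X.functionField (algebraMap _ (X.presheaf.stalk D) z) :=
    congr($(TopCat.Presheaf.stalkSpecializes_comp X.presheaf
      ((genericPoint_spec X).specializes (Set.mem_univ D)) hD).hom z).symm
  exact ⟨s, s.2, a, by rw [hK, hK, ← map_mul, has]⟩

end Normality

namespace Orbifold

section ChartPullback

variable {k : Type u} [Field k] {𝒳 𝒴 : Orbifold k} {f : 𝒳.X ⟶ 𝒴.X} [f.IsOver (Spec (.of k))]
  {n p : ℕ}

namespace Chart

lemma localModule_eq_span_logGenerator (c : 𝒴.Chart) (n p : ℕ) (w : c.W) : c.localModule n p w =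
    Submodule.span (localSubring c.W w) (Set.range (logGenerator (k := k) (fun l ↦
      algebraMap (c.W.presheaf.stalk w) c.W.functionField (c.coordAt w l)) (c.coordMult w) n p)) :=
  have h : (fun l ↦ algebraMap (c.W.presheaf.stalk w) c.W.functionField (c.coordAt w l)) =
      c.coordK := funext (c.algebraMap_coordAt w)
  h ▸ rfl

lemma pull_symFormsMap (c : 𝒳.Chart) {S : Type u} [CommRing S] [Algebra k S]
    (ψ : S →ₐ[k] 𝒳.X.functionField) (τ : SymForms k S p) :
    c.pull p (symFormsMap p ψ τ) = symFormsMap p ((functionFieldMap k c.g).comp ψ) τ :=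
  (symFormsMap_comp p _ _ τ).symm

variable {τ : SymForms k (𝒴.X.presheaf.stalk (f (genericPoint 𝒳.X))) p}

theorem symCoord_pull_mem_coeffLattice (h𝒴 : 𝒴.IsSmooth) (hf : IsMorphism 𝒳 𝒴 f) (c : 𝒳.Chart)
    {ε : Module.Basis (Fin c.d) c.W.functionField (Ω[c.W.functionField⁄k])}
    (hε : ∀ i, ε i = (c.coordK i)⁻¹ • KaehlerDifferential.D k _ (c.coordK i)) {w D : c.W}
    (hDw : D ⤳ w) [IsPrincipalIdealRing (c.W.presheaf.stalk D)]
    (hτ : symFormsMap p (stalkSpecAlgHom k 𝒴.X ((genericPoint_spec 𝒴.X).specializes trivial)) τ ∈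
      𝒴.stalkForms n p (f (c.g D))) :
    symCoord ε p (c.pull p (symFormsMap p (stalkMapAlgHom k f (genericPoint 𝒳.X)) τ)) ∈
      coeffLattice (algebraMap (c.W.presheaf.stalk D) c.W.functionField) n
        fun μ ↦ algebraMap (c.W.presheaf.stalk D) c.W.functionField
          (∏ i, c.coordAt D i ^ ceilQuot (occ i μ) (c.coordMult w i)) := by
  obtain ⟨c', w', hw'⟩ := h𝒴.exists_chart (f (c.g D))
  have hη : genericPoint 𝒳.X ⤳ c.g D := (genericPoint_spec 𝒳.X).specializes (Set.mem_univ _)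
  let φB := stalkMapAt k c'.g hw'
  let φX := stalkMapAlgHom k f (c.g D)
  let φO := stalkMapAlgHom k c.g D
  let φξ := stalkSpecAlgHom k 𝒴.X (hη.map f.continuous)
  obtain ⟨_, _, _, _⟩ := stalkMapAt_etale k c'.g hw'
  have hX : φO.toRingHom.FaithfullyFlat := faithfullyFlat_stalkMap c.g D
  algebraize [φB.toRingHom, φX.toRingHom, φO.toRingHom, φξ.toRingHom, (φO.comp φX).toRingHom]
  have : IsScalarTower (𝒴.X.presheaf.stalk (f (c.g D))) (𝒳.X.presheaf.stalk (c.g D))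
    (c.W.presheaf.stalk D) := .of_algebraMap_eq' rfl
  have := IsScalarTower.of_algebraMap_eq' φB.comp_algebraMap.symm
  have := IsScalarTower.of_algebraMap_eq' (φO.comp φX).comp_algebraMap.symm
  have := IsScalarTower.of_algebraMap_eq' φξ.comp_algebraMap.symm
  have := isScalarTower_stalk_functionField k c.W D
  have := isScalarTower_stalk_functionField k c'.W w'
  obtain ⟨N, hN⟩ := exists_isLocalization_stalkSpecializes (hη.map f.continuous)
  have : IsLocalization N (𝒴.X.presheaf.stalk (f (genericPoint 𝒳.X))) := hN
  rw [pull_symFormsMap]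
  have hmem := hτ c' w' hw'
  rw [pull_symFormsMap, localModule_eq_span_logGenerator] at hmem
  refine symCoord_symFormsMap_mem_coeffLattice_of_isPrincipalIdealRing N ?_ ?_
    (c.hasEtaleCoordinates D) (fun i ↦ by rw [hε, c.algebraMap_coordAt])
    (c'.hasEtaleCoordinates w') hmem (map_maximalIdeal_stalkMap c.g D)
    (fun l hl ↦ c'.map_branchIdeal hw' h𝒴 hl) (fun l hl ↦ ?_)
    (fun _ l _ htop ↦ hf.coordMult_le_length_mul c' hw' ?_ htop) (c'.one_le_coordMult w')
    (one_le_mult _) (fun _ i hi ↦ c.mult_le_coordMult hDw ?_ hi)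
    fun _ ↦ c.mult_eq_one_of_isUnit
  · exact fun a ↦ (congr_arg _ (stalkSpecAlgHom_stalkSpecAlgHom k _ _ a)).trans
      (functionFieldMap_algebraMap k c'.g hw' a)
  · exact fun a ↦ (congr_arg _ (stalkSpecAlgHom_stalkMapAlgHom k f hη a).symm).trans <|
      (functionFieldMap_algebraMap k c.g rfl _).trans (by rw [stalkMapAt_rfl]; rfl)
  · rw [IsScalarTower.algebraMap_eq _ (𝒳.X.presheaf.stalk (c.g D)), ← Ideal.map_map, Ne,
      Ideal.map_eq_bot_iff_of_injective (FaithfulSMul.algebraMap_injective _ _)]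
    exact hf.map_branchIdeal_ne_bot c' hw' hl
  · exact coheight_apply_eq_one_of_etale c.g D
  · exact coheight_eq_one_of_isDiscreteValuationRing

theorem pull_mem_localModule (h𝒴 : 𝒴.IsSmooth) (hf : IsMorphism 𝒳 𝒴 f) (c : 𝒳.Chart) (w : c.W)
    (hτ : ∀ y, y ⤳ f (c.g w) → symFormsMap p
      (stalkSpecAlgHom k 𝒴.X ((genericPoint_spec 𝒴.X).specializes trivial)) τ ∈
      𝒴.stalkForms n p y) :
    c.pull p (symFormsMap p (stalkMapAlgHom k f (genericPoint 𝒳.X)) τ) ∈ c.localModule n p w := by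
  have hη : genericPoint c.W ⤳ w := (genericPoint_spec c.W).specializes (Set.mem_univ w)
  have hx := c.hasEtaleCoordinates w
  have hxη := c.hasEtaleCoordinates (genericPoint c.W)
  have := hx.isNoetherianRing
  have := hx.isDomain_and_isIntegrallyClosed.2
  have hx0 (i : Fin c.d) : c.coordK i ≠ 0 := hxη.ne_zero i
  obtain ⟨b, hb⟩ := hxη.exists_basis
  obtain ⟨ε, hε⟩ := exists_log_basis (x := c.coordK) hb hx0
  have hcoeff {D : c.W} (hD : D ⤳ w) [IsPrincipalIdealRing (c.W.presheaf.stalk D)] :=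
    c.symCoord_pull_mem_coeffLattice h𝒴 hf hε hD (hτ _ ((hD.map c.g.continuous).map f.continuous))
  simp only [map_prod, map_pow, algebraMap_coordAt] at hcoeff
  have : IsPrincipalIdealRing (c.W.presheaf.stalk (genericPoint c.W)) :=
    inferInstanceAs (IsPrincipalIdealRing c.W.functionField)
  refine mem_span_logGenerator _ hε ⟨(hcoeff hη).1, fun μ ↦ ?_⟩
  have he0 : ∏ i, c.coordK i ^ ceilQuot (occ i μ) (c.coordMult w i) ≠ 0 :=
    Finset.prod_ne_zero_iff.2 fun i _ ↦ pow_ne_zero _ (hx0 i)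
  refine ⟨⟨_, mem_range_algebraMap_stalk_of_forall_specializes (x := w) _ fun D hD _ ↦ ?_⟩,
    (div_mul_cancel₀ _ he0).symm⟩
  obtain ⟨r, hr⟩ := (hcoeff hD).2 μ
  exact ⟨r, eq_div_of_mul_eq he0 hr.symm⟩

end Chart

end ChartPullback

end Orbifold

section RegularForms

variable {k A B K L : Type u} [CommRing k] [CommRing A] [IsDomain A] [CommRing B] [Field K]
  [Field L] [Algebra k A] [Algebra k B] [Algebra k K] [Algebra k L] [Algebra A K]
  [IsScalarTower k A K] [IsFractionRing A K] {p : ℕ}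

theorem mem_range_symFormsMap_of_faithfullyFlat [Algebra A B] [IsScalarTower k A B]
    [Module.FaithfullyFlat A B] [Algebra.FormallyEtale A B] [Algebra B L] [IsScalarTower k B L]
    [IsFractionRing B L] {ι : Type*} [LinearOrder ι] [Finite (Fin p ↪o ι)]
    (b : Module.Basis ι A (Ω[A⁄k])) (κ : K →ₐ[k] L)
    (hκ : ∀ a, κ (algebraMap A K a) = algebraMap B L (algebraMap A B a)) {ω : SymForms k K p}
    (hω : symFormsMap p κ ω ∈ Set.range (symFormsMap p (IsScalarTower.toAlgHom k B L))) :
    ω ∈ Set.range (symFormsMap p (IsScalarTower.toAlgHom k A K)) := by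
  obtain ⟨bK, hbK⟩ := exists_basis_of_isLocalization K (nonZeroDivisors A) b
  obtain ⟨bB, hbB⟩ := exists_basis_of_formallyEtale (IsScalarTower.toAlgHom k A B)
    (RingHom.formallyEtale_algebraMap.2 inferInstance) b
  obtain ⟨bL, hbL⟩ := exists_basis_of_isLocalization L (nonZeroDivisors B) bB
  have hcomm : κ.comp (IsScalarTower.toAlgHom k A K) =
      (IsScalarTower.toAlgHom k B L).comp (IsScalarTower.toAlgHom k A B) := AlgHom.ext hκ
  have hκb (i : ι) : bL i = diffMap κ (bK i) := by
    rw [hbL, hbB, hbK, ← diffMap_comp, ← diffMap_comp, hcomm]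
  rw [mem_range_symFormsMap_iff_coeff p hbL] at hω
  rw [mem_range_symFormsMap_iff_coeff p hbK]
  intro μ
  obtain ⟨r, hr⟩ := hω μ
  rw [symCoord_symFormsMap p hκb, MvPolynomial.coeff_map] at hr
  have hmul : κ (MvPolynomial.coeff μ (symCoord bK p ω)) =
      algebraMap B L r * algebraMap B L (algebraMap A B 1) := by
    rw [map_one, map_one, mul_one]
    exact hr.symm
  obtain ⟨a, ha⟩ :=
    exists_eq_mul_of_map_eq_mul (IsFractionRing.injective B L) (κ : K →+* L) hκ hmul
  exact ⟨a, by rw [ha, map_one, mul_one]; rfl⟩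

theorem mem_range_symFormsMap_of_mem_span_logGenerator {κ : Type} [Fintype κ] [LinearOrder κ]
    {x : κ → A} (hx : HasEtaleCoordinates k x) {m : κ → ℕ∞} (hm : ∀ l, m l ≠ 1 → IsUnit (x l))
    {n : ℕ} {ω : SymForms k K p}
    (hω : ω ∈ Submodule.span (algebraMap A K).range (Set.range
      (logGenerator (k := k) (fun l ↦ algebraMap A K (x l)) m n p))) :
    ω ∈ Set.range (symFormsMap p (IsScalarTower.toAlgHom k A K)) := by
  have hgen : logGenerator (k := k) (fun l ↦ algebraMap A K (x l)) m n p =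
      symFormsMap p (IsScalarTower.toAlgHom k A K) ∘ orbGenerator x m n p := by
    funext J
    rw [Function.comp_apply, symFormsMap_orbGenerator J _ hm]
    exact logGenerator_eq_orbGenerator J (fun l ↦
      (map_ne_zero_iff _ (IsFractionRing.injective A K)).2 (hx.ne_zero l)) m
  have hid : (IsScalarTower.toAlgHom k A K : A →+* K).comp (RingHom.id A) = algebraMap A K :=
    RingHom.comp_id _
  rw [hgen, Set.range_comp, ← hid] at hω
  obtain ⟨τ, -, hτ⟩ := exists_mem_span_symFormsMap_eq (RingHom.id A) _ hω
  exact ⟨τ, hτ⟩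

end RegularForms

namespace Orbifold

section Regularity

variable {k : Type u} [Field k] {𝒳 𝒴 : Orbifold k} {n p : ℕ}

theorem mem_range_symFormsMap_of_notMem_supp (h𝒴 : 𝒴.IsSmooth) {y : 𝒴.X} (hy : y ∉ 𝒴.supp)
    {ω : SymForms k 𝒴.X.functionField p} (hω : ω ∈ 𝒴.stalkForms n p y) :
    ω ∈ Set.range (symFormsMap p
      (stalkSpecAlgHom k 𝒴.X ((genericPoint_spec 𝒴.X).specializes (Set.mem_univ y)))) := by
  obtain ⟨c, w, hw⟩ := h𝒴.exists_chart y
  have hm (l : Fin c.d) : c.coordMult w l = 1 := by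
    by_contra hl
    obtain ⟨D, hD, -, -, hD0⟩ := c.exists_of_coordMult_ne_one hl
    exact hy ⟨c.g D, hD0, hw ▸ hD.map c.g.continuous⟩
  let φ := stalkMapAt k c.g hw
  obtain ⟨_, _, -, _⟩ := stalkMapAt_etale k c.g hw
  algebraize [φ.toRingHom]
  have : IsLocalHom (algebraMap (𝒴.X.presheaf.stalk y) (c.W.presheaf.stalk w)) := ‹_›
  have : Module.FaithfullyFlat (𝒴.X.presheaf.stalk y) (c.W.presheaf.stalk w) :=
    .of_flat_of_isLocalHom
  have := IsScalarTower.of_algebraMap_eq' φ.comp_algebraMap.symm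
  have := isScalarTower_stalk_functionField k c.W w
  have := isScalarTower_stalk_functionField k 𝒴.X y
  have := h𝒴.smooth
  obtain ⟨d, ⟨b⟩⟩ := exists_basis_stalk k y
  refine mem_range_symFormsMap_of_faithfullyFlat b (functionFieldMap k c.g)
    (functionFieldMap_algebraMap k c.g hw) ?_
  have hpull := hω c w hw
  rw [c.localModule_eq_span_logGenerator] at hpull
  exact mem_range_symFormsMap_of_mem_span_logGenerator (c.hasEtaleCoordinates w)
    (fun l hl ↦ (hl (hm l)).elim) hpull

theorem symFormsMap_stalkSpecAlgHom_injective (h𝒴 : 𝒴.IsSmooth) (y : 𝒴.X) (p : ℕ) :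
    Function.Injective (symFormsMap p (stalkSpecAlgHom k 𝒴.X
      ((genericPoint_spec 𝒴.X).specializes (Set.mem_univ y)))) := by
  have := h𝒴.smooth
  have := isScalarTower_stalk_functionField k 𝒴.X y
  obtain ⟨d, ⟨b⟩⟩ := exists_basis_stalk k y
  obtain ⟨bK, hbK⟩ := exists_basis_of_isLocalization 𝒴.X.functionField
    (nonZeroDivisors (𝒴.X.presheaf.stalk y)) b
  exact symFormsMap_injective p hbK
    (IsFractionRing.injective (𝒴.X.presheaf.stalk y) 𝒴.X.functionField)

end Regularity

section IsPullback

variable {k : Type u} [Field k] {𝒳 𝒴 : Orbifold k} {f : 𝒳.X ⟶ 𝒴.X} [f.IsOver (Spec (.of k))]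
  {n p : ℕ}

namespace IsPullback

variable {ω η : SymForms k 𝒴.X.functionField p} {ω' η' : SymForms k 𝒳.X.functionField p}

theorem unique (h𝒴 : 𝒴.IsSmooth) (h : IsPullback k f p ω ω') (h' : IsPullback k f p ω η') :
    ω' = η' := by
  obtain ⟨τ, hτ, rfl⟩ := h
  obtain ⟨τ', hτ', rfl⟩ := h'
  rw [symFormsMap_stalkSpecAlgHom_injective h𝒴 _ p (hτ.trans hτ'.symm)]

theorem zero (p : ℕ) : IsPullback k f p 0 0 :=
  ⟨0, map_zero _, map_zero _⟩

theorem add (h : IsPullback k f p ω ω') (h' : IsPullback k f p η η') :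
    IsPullback k f p (ω + η) (ω' + η') := by
  obtain ⟨τ, rfl, rfl⟩ := h
  obtain ⟨τ', rfl, rfl⟩ := h'
  exact ⟨τ + τ', map_add _ _ _, map_add _ _ _⟩

theorem smul (h : IsPullback k f p ω ω') (x : 𝒳.X) (a : 𝒴.X.presheaf.stalk (f x)) :
    IsPullback k f p (algebraMap (𝒴.X.presheaf.stalk (f x)) 𝒴.X.functionField a • ω)
      (algebraMap (𝒳.X.presheaf.stalk x) 𝒳.X.functionField (stalkMapAlgHom k f x a) • ω') := by
  obtain ⟨τ, rfl, rfl⟩ := h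
  have hη := (genericPoint_spec 𝒳.X).specializes (Set.mem_univ x)
  refine ⟨stalkSpecAlgHom k 𝒴.X (hη.map f.continuous) a • τ, ?_, ?_⟩
  · rw [symFormsMap_smul, stalkSpecAlgHom_stalkSpecAlgHom]
    rfl
  · rw [symFormsMap_smul, ← stalkSpecAlgHom_stalkMapAlgHom k f hη]
    rfl

theorem mem_stalkForms (h𝒴 : 𝒴.IsSmooth) (hf : IsMorphism 𝒳 𝒴 f) (h : IsPullback k f p ω ω')
    {x : 𝒳.X} (hω : ∀ y, y ⤳ f x → ω ∈ 𝒴.stalkForms n p y) : ω' ∈ 𝒳.stalkForms n p x := by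
  obtain ⟨τ, rfl, rfl⟩ := h
  rintro c w rfl
  exact c.pull_mem_localModule h𝒴 hf w hω

end IsPullback

theorem IsMorphism.exists_isPullback (h𝒴 : 𝒴.IsSmooth) (hf : IsMorphism 𝒳 𝒴 f)
    {ω : SymForms k 𝒴.X.functionField p} (hω : ω ∈ 𝒴.stalkForms n p (f (genericPoint 𝒳.X))) :
    ∃ ω', IsPullback k f p ω ω' := by
  obtain ⟨τ, hτ⟩ := mem_range_symFormsMap_of_notMem_supp h𝒴 hf.genericPoint_notMem_supp hω
  exact ⟨_, τ, hτ, rfl⟩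

end IsPullback

end Orbifold

namespace Orbifold

section PullbackMorphism

variable {k : Type u} [Field k] {𝒳 𝒴 : Orbifold k} {f : 𝒳.X ⟶ 𝒴.X} [f.IsOver (Spec (.of k))]

theorem IsMorphism.exists_isPullback_of_section (h𝒴 : 𝒴.IsSmooth) (hf : IsMorphism 𝒳 𝒴 f)
    {n p : ℕ} {V : 𝒴.X.Opens} (s : 𝒴.formsSections n p V) (x : (f ⁻¹ᵁ V : 𝒳.X.Opens)) :
    ∃ ω', IsPullback k f p (s.1 ⟨f x, x.2⟩) ω' := by
  have hη : genericPoint 𝒳.X ∈ f ⁻¹ᵁ V :=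
    ((genericPoint_spec 𝒳.X).specializes (Set.mem_univ x.1)).mem_open (f ⁻¹ᵁ V).2 x.2
  rw [s.2.1 ⟨f x, x.2⟩ ⟨f (genericPoint 𝒳.X), hη⟩]
  exact hf.exists_isPullback h𝒴 (s.2.2 ⟨f (genericPoint 𝒳.X), hη⟩)

/-- Pullback of sections of `S^n Ω^p` along a morphism of orbifolds. The pulled back rational form
at a point is obtained by choice; it is unique by `IsPullback.unique`. -/
def pullbackSections (h𝒴 : 𝒴.IsSmooth) (hf : IsMorphism 𝒳 𝒴 f) (n p : ℕ) (V : 𝒴.X.Opens)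
    (s : 𝒴.formsSections n p V) : 𝒳.formsSections n p (f ⁻¹ᵁ V) :=
  ⟨fun x ↦ (hf.exists_isPullback_of_section h𝒴 s x).choose, fun x y ↦ by
    have hx := (hf.exists_isPullback_of_section h𝒴 s x).choose_spec
    exact ((congr_arg (IsPullback k f p · _) (s.2.1 ⟨f x, x.2⟩ ⟨f y, y.2⟩)).mp hx).unique h𝒴
      (hf.exists_isPullback_of_section h𝒴 s y).choose_spec, fun x ↦ by
    refine (hf.exists_isPullback_of_section h𝒴 s x).choose_spec.mem_stalkForms h𝒴 hf
      fun y hy ↦ ?_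
    rw [s.2.1 ⟨f x, x.2⟩ ⟨y, hy.mem_open V.2 x.2⟩]
    exact s.2.2 ⟨y, hy.mem_open V.2 x.2⟩⟩

theorem isPullback_pullbackSections (h𝒴 : 𝒴.IsSmooth) (hf : IsMorphism 𝒳 𝒴 f) {n p : ℕ}
    {V : 𝒴.X.Opens} (s : 𝒴.formsSections n p V) (x : (f ⁻¹ᵁ V : 𝒳.X.Opens)) :
    IsPullback k f p (s.1 ⟨f x, x.2⟩) ((pullbackSections h𝒴 hf n p V s).1 x) :=
  (hf.exists_isPullback_of_section h𝒴 s x).choose_spec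

theorem pullbackSections_eq (h𝒴 : 𝒴.IsSmooth) (hf : IsMorphism 𝒳 𝒴 f) {n p : ℕ}
    {V : 𝒴.X.Opens} (s : 𝒴.formsSections n p V) (t : 𝒳.formsSections n p (f ⁻¹ᵁ V))
    (h : ∀ x : (f ⁻¹ᵁ V : 𝒳.X.Opens), IsPullback k f p (s.1 ⟨f x, x.2⟩) (t.1 x)) :
    pullbackSections h𝒴 hf n p V s = t :=
  Subtype.ext <| funext fun x ↦ (isPullback_pullbackSections h𝒴 hf s x).unique h𝒴 (h x)

theorem pullbackSections_smul (h𝒴 : 𝒴.IsSmooth) (hf : IsMorphism 𝒳 𝒴 f) {n p : ℕ}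
    {V : 𝒴.X.Opens} (r : Γ(𝒴.X, V)) (s : 𝒴.formsSections n p V) :
    pullbackSections h𝒴 hf n p V (r • s) = (f.app V).hom r • pullbackSections h𝒴 hf n p V s := by
  refine pullbackSections_eq h𝒴 hf _ _ fun x ↦ ?_
  have hgerm : (𝒳.X.presheaf.germ (f ⁻¹ᵁ V) x.1 x.2).hom ((f.app V).hom r) =
      stalkMapAlgHom k f x.1 ((𝒴.X.presheaf.germ V (f x.1) x.2).hom r) :=
    congr($(Scheme.Hom.germ_stalkMap f V x.1 x.2).hom r).symm
  rw [formsSections_smul_apply, formsSections_smul_apply, hgerm]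
  exact (isPullback_pullbackSections h𝒴 hf s x).smul x.1 _

/-- The morphism `S^n Ω^p_{(Y,Δ_Y)} → f_* S^n Ω^p_{(X,Δ_X)}` given by `pullbackSections`; its
adjoint is the morphism `f^* S^n Ω^p_{(Y,Δ_Y)} → S^n Ω^p_{(X,Δ_X)}`. -/
def pushforwardHom (h𝒴 : 𝒴.IsSmooth) (hf : IsMorphism 𝒳 𝒴 f) (n p : ℕ) :
    𝒴.symDiff n p ⟶ (Scheme.Modules.pushforward f).obj (𝒳.symDiff n p) where
  val := PresheafOfModules.homMk
    { app := fun V ↦ AddCommGrpCat.ofHom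
        { toFun := pullbackSections h𝒴 hf n p V.unop
          map_zero' := pullbackSections_eq h𝒴 hf _ _ fun _ ↦ IsPullback.zero p
          map_add' := fun s t ↦ pullbackSections_eq h𝒴 hf _ _ fun x ↦
            (isPullback_pullbackSections h𝒴 hf s x).add (isPullback_pullbackSections h𝒴 hf t x) }
      naturality := fun V V' i ↦ by
        ext s
        exact pullbackSections_eq h𝒴 hf _ _ fun x ↦
          isPullback_pullbackSections h𝒴 hf s ⟨x.1, i.unop.le x.2⟩ }
    fun V r s ↦ pullbackSections_smul h𝒴 hf r s

end PullbackMorphism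

end Orbifold

end

theorem lemma4p3_general {k : Type u} [Field k] (𝒳 𝒴 : Orbifold k) (h𝒴 : 𝒴.IsSmooth)
    (f : 𝒳.X ⟶ 𝒴.X) [f.IsOver (Spec (.of k))] (hf : Orbifold.IsMorphism 𝒳 𝒴 f) (n p : ℕ) :
    ∃! φ : (Scheme.Modules.pullback f).obj (𝒴.symDiff n p) ⟶ 𝒳.symDiff n p,
      Orbifold.IsInducedByPullback f n p φ := by
  let e := (Scheme.Modules.pullbackPushforwardAdjunction f).homEquiv (𝒴.symDiff n p)
    (𝒳.symDiff n p)
  refine ⟨e.symm (Orbifold.pushforwardHom h𝒴 hf n p), fun V ω x ↦ ?_, fun φ hφ ↦ ?_⟩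
  · change Orbifold.IsPullback k f p _ (𝒳.evalForm (((e (e.symm _)).app V).hom ω) x)
    rw [Equiv.apply_symm_apply]
    exact Orbifold.isPullback_pullbackSections h𝒴 hf ω x
  · refine e.injective ?_
    rw [Equiv.apply_symm_apply]
    refine Scheme.Modules.hom_ext _ _ fun V ↦ ?_
    ext ω
    exact (Orbifold.pullbackSections_eq h𝒴 hf ω _ fun x ↦ hφ V ω x).symm

theorem lemma4p3 {k : Type u} [Field k] [IsAlgClosed k] (𝒳 𝒴 : Orbifold k) (h𝒳 : 𝒳.IsSmooth)
    (h𝒴 : 𝒴.IsSmooth) (f : 𝒳.X ⟶ 𝒴.X) [f.IsOver (Spec (.of k))]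
    (hf : Orbifold.IsMorphism 𝒳 𝒴 f) (n p : ℕ) :
    ∃! φ : (Scheme.Modules.pullback f).obj (𝒴.symDiff n p) ⟶ 𝒳.symDiff n p,
      Orbifold.IsInducedByPullback f n p φ :=
  lemma4p3_general 𝒳 𝒴 h𝒴 f hf n p
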